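/- Let $s\ge 1$ be a constant. A (finite, simple) graph $G$ is $sP_2$-free if no induced subgraph of $G$ is isomorphic to $sP_2$, the disjoint union of $s$ copies of the path $P_2$ on two vertices. A set $S\subseteq V(G)$ is a feedback vertex set of $G$ if $G-S$ is a forest, and it is connected if it induces a connected subgraph of $G$. Feedback Vertex Set (respectively, Connected Feedback Vertex Set) is the problem of deciding, for a given graph $G$ and integer $k$, whether $G$ has a feedback vertex set (respectively, a connected feedback vertex set) $S$ with $|S|\le k$. **Theorem.** For every constant $s\ge 1$, Feedback Vertex Set and Connected Feedback Vertex Set can be solved in polynomial time on $sP_2$-free graphs; that is, for each of the two problems there is a deterministic Turing machine that, on every input $(G,k)$ with $G$ an $sP_2$-free graph, given by its adjacency matrix, and $k$ an integer, given in binary, halts with the correct answer after a number of steps that is bounded by a polynomial in the length of the input. For the connected problem this holds both when the empty set counts as connected and when it does not. -/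

import Mathlib

/-- The graph `sP₂`: the disjoint union of `s` copies of the path `P₂` on two vertices. -/
def sP2 (s : ℕ) : SimpleGraph (Fin s × Fin 2) where
  Adj x y := x.1 = y.1 ∧ x.2 ≠ y.2
  symm.symm _ _ h := ⟨h.1.symm, h.2.symm⟩
  loopless.irrefl _ h := h.2 rfl

/-- `G` is `sP₂`-free: no induced subgraph of `G` is isomorphic to `sP₂`. -/
def IsSP2Free {V : Type*} (s : ℕ) (G : SimpleGraph V) : Prop :=
  ¬ (sP2 s).IsIndContained G

/-- `S` is a feedback vertex set of `G`: the graph `G - S` is a forest. -/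
def IsFeedbackVertexSet {V : Type*} (G : SimpleGraph V) (S : Finset V) : Prop :=
  (G.induce ((S : Set V)ᶜ)).IsAcyclic

/-- The yes-instances of Feedback Vertex Set. -/
def HasFVS {V : Type*} (G : SimpleGraph V) (k : ℤ) : Prop :=
  ∃ S : Finset V, IsFeedbackVertexSet G S ∧ (S.card : ℤ) ≤ k

/-- The yes-instances of Connected Feedback Vertex Set, where the empty set counts as connected:
any two vertices of `S` are joined by a walk inside `S`. -/
def HasConnectedFVS {V : Type*} (G : SimpleGraph V) (k : ℤ) : Prop :=
  ∃ S : Finset V, IsFeedbackVertexSet G S ∧ (G.induce (S : Set V)).Preconnected ∧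
    (S.card : ℤ) ≤ k

/-- The yes-instances of Connected Feedback Vertex Set, where the empty set does not count as
connected (in Mathlib, `SimpleGraph.Connected` includes that there is a vertex). -/
def HasNonemptyConnectedFVS {V : Type*} (G : SimpleGraph V) (k : ℤ) : Prop :=
  ∃ S : Finset V, IsFeedbackVertexSet G S ∧ (G.induce (S : Set V)).Connected ∧
    (S.card : ℤ) ≤ k

/-- The input of a problem on graphs with an integer parameter: a finite simple graph, whose
vertices are numbered, and an integer. -/
structure GraphInstance where
  /-- the number of vertices -/
  n : ℕ
  /-- the graph -/
  graph : SimpleGraph (Fin n)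
  /-- the parameter -/
  k : ℤ

namespace GraphInstance

open Classical in
/-- Row `i` of the adjacency matrix, as bits. -/
noncomputable def row (x : GraphInstance) (i : Fin x.n) : List (Option Bool) :=
  List.ofFn fun j : Fin x.n => some (decide (x.graph.Adj i j))

/-- The input word, over the alphabet `{0, 1, #}` with `none` as the separator `#`: the sign bit of
`k`, the binary digits of `|k|`, a separator, and then the rows of the adjacency matrix, each of
them followed by a separator. -/
noncomputable def encode (x : GraphInstance) : List (Option Bool) :=
  some (decide (x.k < 0)) :: (Computability.encodeNat x.k.natAbs).map some ++
    none :: (List.finRange x.n).flatMap fun i => x.row i ++ [none]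

end GraphInstance

open Classical in
/-- The decision problem `P`, on the instances whose graph belongs to the class `C`, can be solved
in polynomial time: there are a Turing machine (with finitely many stacks as its tapes) and a
polynomial `p` such that on every such instance the machine halts within `p ℓ` steps, where `ℓ` is
the length of the input word, and outputs the bit that tells whether `P` holds. -/
def SolvableInPolyTimeOn (C : ∀ {n : ℕ}, SimpleGraph (Fin n) → Prop)
    (P : ∀ {n : ℕ}, SimpleGraph (Fin n) → ℤ → Prop) : Prop :=
  Nonempty (Turing.TM2ComputableInPolyTime
    (fun x : {x : GraphInstance // C x.graph} => x.1.encode)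
    Computability.encodeBool
    (fun x => decide (P x.1.graph x.1.k)))

/-! Let F be the forest that a solution S₀ leaves. Since G has no induced matching with s edges, F
consists of a core C of at most 4s vertices and of an independent set J₀ whose vertices have at most
one neighbour in C (`Forest.exists_core`). Let W be the set of all vertices outside C with at most
one neighbour in C. Extend J₀ to a maximal independent subset J of W; then C ∪ J still induces a
forest (`Forest.union`), so V \ (C ∪ J) is a feedback vertex set contained in S₀.

The set J is described by boundedly many vertices as well: after the exclusion of certain vertices
that are read off from at most s edges, the greedy algorithm along the vertex order returns exactly
J (`exists_excluded`). For the connected problem, removing T = J \ J₀ from S₀ may destroy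
connectivity. But T is independent, and at most 2s + 1 of its vertices suffice to connect the rest
of S₀ (`exists_linked`); they are put back.

Hence for every solution there is one that is no larger among the candidates given by 4s + 2s + (2s
+ 1) pointers, each of which is a vertex or empty (`exists_candidate`). There are polynomially many
candidates for fixed s. Each of them is tested, so the absence of large induced matchings matters
only for completeness.

The running time is controlled by an intermediate kind of program. The tape holds a binary counter
and the adjacency matrix, and each entry of the matrix carries the values of finitely many unary
relations at its row and at its column. Programs consist of passes of finite transducers over this
tape, and of branches and loops on flags (`SweepProg`); a machine with four stacks runs them
(`Exec.runsIn`). As the length of the tape never changes, time bounds compose (`Realizable`). A loop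
over the vertices multiplies the time by a polynomial, and the search consists of 8s + 1 nested
loops around one polynomial test. -/

/-! ### Sweep programs

A sweep program works on a finite state and a list of cells of fixed length. Its basic instruction
passes a finite transducer over the list. -/

/-- The result of passing a transducer over a list. -/
def transduce {P A B : Type} (δ : P → A → P × B) : P → List A → P × List B
  | p, [] => (p, [])
  | p, a :: l => ((transduce δ (δ p a).1 l).1, (δ p a).2 :: (transduce δ (δ p a).1 l).2)

theorem transduce_append {P A B : Type} (δ : P → A → P × B) (p : P) (l₁ l₂ : List A) :
    transduce δ p (l₁ ++ l₂) =
      ((transduce δ (transduce δ p l₁).1 l₂).1,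
        (transduce δ p l₁).2 ++ (transduce δ (transduce δ p l₁).1 l₂).2) := by
  induction l₁ generalizing p with
  | nil => rfl
  | cons a l ih => simp [transduce, ih]

theorem length_transduce {P A B : Type} (δ : P → A → P × B) (p : P) (l : List A) :
    (transduce δ p l).2.length = l.length := by
  induction l generalizing p with
  | nil => rfl
  | cons a l ih => simp [transduce, ih]

/-- Structured programs whose basic instructions are sweeps. -/
inductive SweepProg (Q A : Type) : Type 1
  | sweep (P : Type) [Fintype P] (init : Q → P) (δ : P → A → P × A) (fin : P → Q) : SweepProg Q A
  | seq (p q : SweepProg Q A) : SweepProg Q A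
  | ite (b : Q → Bool) (p q : SweepProg Q A) : SweepProg Q A
  | loop (b : Q → Bool) (p : SweepProg Q A) : SweepProg Q A

namespace SweepProg

variable {Q A : Type}

/-- `Exec p s s' t`: started in `s`, the program `p` ends in `s'`, and takes `t` steps. -/
inductive Exec : SweepProg Q A → Q × List A → Q × List A → ℕ → Prop
  -- A sweep is run as a pass forward and a pass back. Each takes one step per cell and one more to
  -- find its stack empty.
  | sweep {P : Type} [Fintype P] (init : Q → P) (δ : P → A → P × A) (fin : P → Q) (q : Q)
      (l : List A) :
      Exec (.sweep P init δ fin) (q, l)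
        (fin (transduce δ (init q) l).1, (transduce δ (init q) l).2) (2 * l.length + 2)
  | seq {p p' : SweepProg Q A} {s s' s'' : Q × List A} {t t' : ℕ} :
      Exec p s s' t → Exec p' s' s'' t' → Exec (.seq p p') s s'' (t + t')
  | iteTrue {b : Q → Bool} {p p' : SweepProg Q A} {s s' : Q × List A} {t : ℕ} :
      b s.1 = true → Exec p s s' t → Exec (.ite b p p') s s' t
  | iteFalse {b : Q → Bool} {p p' : SweepProg Q A} {s s' : Q × List A} {t : ℕ} :
      b s.1 = false → Exec p' s s' t → Exec (.ite b p p') s s' t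
  | loopFalse {b : Q → Bool} {p : SweepProg Q A} {s : Q × List A} :
      b s.1 = false → Exec (.loop b p) s s 1
  | loopTrue {b : Q → Bool} {p : SweepProg Q A} {s s' s'' : Q × List A} {t t' : ℕ} :
      b s.1 = true → Exec p s s' t → Exec (.loop b p) s' s'' t' →
      Exec (.loop b p) s s'' (1 + t + t')

/-- The labels of the Turing machine code of a sweep program. -/
def Lbl : SweepProg Q A → Type
  -- The left copy serves the forward pass; the right copy remembers the final state of the
  -- transducer while the cells are moved back.
  | @SweepProg.sweep _ _ P _ _ _ _ => P ⊕ P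
  | .seq p q => Lbl p ⊕ Lbl q
  | .ite _ p q => Lbl p ⊕ Lbl q
  | .loop _ p => Unit ⊕ Lbl p

noncomputable instance fintypeLbl : (p : SweepProg Q A) → Fintype p.Lbl
  | @SweepProg.sweep _ _ P _ _ _ _ => inferInstanceAs (Fintype (P ⊕ P))
  | .seq p q =>
    have := fintypeLbl p
    have := fintypeLbl q
    inferInstanceAs (Fintype (Lbl p ⊕ Lbl q))
  | .ite _ p q =>
    have := fintypeLbl p
    have := fintypeLbl q
    inferInstanceAs (Fintype (Lbl p ⊕ Lbl q))
  | .loop _ p =>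
    have := fintypeLbl p
    inferInstanceAs (Fintype (Unit ⊕ Lbl p))

/-- The label at which the code of a program starts, where `exit` is the continuation. -/
def entry {L : Type} : (p : SweepProg Q A) → (p.Lbl → L) → (Q → L) → Q → L
  | @SweepProg.sweep _ _ _ _ init _ _, emb, _, q => emb (.inl (init q))
  | .seq p p', emb, exit, q => entry p (fun l => emb (.inl l)) (entry p' (fun l => emb (.inr l)) exit) q
  | .ite b p p', emb, exit, q =>
    bif b q then entry p (fun l => emb (.inl l)) exit q
    else entry p' (fun l => emb (.inr l)) exit q
  | .loop _ _, emb, _, _ => emb (.inl ())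

end SweepProg

/-! ### Simulation of sweep programs by machines with four stacks -/

/-- The four stacks of the machines that run sweep programs. -/
inductive SweepStack
  | inp | out | left | right

namespace SweepStack

instance : DecidableEq SweepStack := fun a b => by
  cases a <;> cases b <;> first | exact isTrue rfl | exact isFalse nofun

instance : Fintype SweepStack where
  elems := {.inp, .out, .left, .right}
  complete x := by cases x <;> simp

/-- The alphabets of the stacks. -/
abbrev Alphabet (A : Type) : SweepStack → Type
  | inp => Option Bool
  | out => Bool
  | left => A
  | right => A

/-- The stacks with given contents. -/
def contents {A : Type} (i : List (Option Bool)) (o : List Bool) (l r : List A) :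
    ∀ k, List (Alphabet A k)
  | inp => i
  | out => o
  | left => l
  | right => r

variable {A : Type} (i : List (Option Bool)) (o : List Bool) (l r : List A)

@[simp] theorem contents_inp : contents i o l r inp = i := rfl
@[simp] theorem contents_out : contents i o l r out = o := rfl
@[simp] theorem contents_left : contents i o l r left = l := rfl
@[simp] theorem contents_right : contents i o l r right = r := rfl

@[simp] theorem update_inp (x : List (Option Bool)) :
    Function.update (contents i o l r) inp x = contents x o l r := by
  funext k; cases k <;> rfl

@[simp] theorem update_out (x : List Bool) :
    Function.update (contents i o l r) out x = contents i x l r := by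
  funext k; cases k <;> rfl

@[simp] theorem update_left (x : List A) :
    Function.update (contents i o l r) left x = contents i o x r := by
  funext k; cases k <;> rfl

@[simp] theorem update_right (x : List A) :
    Function.update (contents i o l r) right x = contents i o l x := by
  funext k; cases k <;> rfl

end SweepStack

open SweepStack in
/-- The variables of the machine: the state of the sweep program and the last symbols read. -/
abbrev SweepVar (Q A : Type) : Type := Q × Option A × Option (Option Bool)

/-- The statements of the machines that run sweep programs. -/
abbrev SweepStmt (Q A L : Type) : Type := Turing.TM2.Stmt (SweepStack.Alphabet A) L (SweepVar Q A)

/-- The configurations of the machines that run sweep programs. -/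
abbrev SweepCfg (Q A L : Type) : Type := Turing.TM2.Cfg (SweepStack.Alphabet A) L (SweepVar Q A)

/-- `RunsIn M c c' t`: the machine `M` goes from `c` to `c'` in at most `t` steps. -/
def RunsIn {Q A L : Type} (M : L → SweepStmt Q A L) (c c' : SweepCfg Q A L) (t : ℕ) : Prop :=
  ∃ k ≤ t, (flip bind (Turing.TM2.step M))^[k] (some c) = some c'

namespace RunsIn

variable {Q A L : Type} {M : L → SweepStmt Q A L} {c c' c'' : SweepCfg Q A L} {t t' : ℕ}

theorem trans (h : RunsIn M c c' t) (h' : RunsIn M c' c'' t') : RunsIn M c c'' (t + t') := by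
  obtain ⟨k, hk, e⟩ := h
  obtain ⟨k', hk', e'⟩ := h'
  refine ⟨k' + k, by omega, ?_⟩
  rw [Function.iterate_add_apply, e, e']

theorem step (h : Turing.TM2.step M c = some c') : RunsIn M c c' 1 := ⟨1, le_rfl, h⟩

theorem head (h : Turing.TM2.step M c = some c') (h' : RunsIn M c' c'' t) :
    RunsIn M c c'' (t + 1) := by
  rw [add_comm]; exact (step h).trans h'

theorem mono (h : RunsIn M c c' t) (ht : t ≤ t') : RunsIn M c c' t' :=
  let ⟨k, hk, e⟩ := h; ⟨k, hk.trans ht, e⟩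

end RunsIn

namespace SweepProg

open Turing.TM2.Stmt SweepStack

variable {Q A : Type} [Inhabited A]

/-- The code of a sweep program. -/
def code {L : Type} : (p : SweepProg Q A) → (p.Lbl → L) → (Q → L) → p.Lbl → SweepStmt Q A L
  | @SweepProg.sweep _ _ _ _ _ δ _, emb, _, .inl x =>
    pop right (fun v a => (v.1, a, none)) <|
    branch (fun v => v.2.1.isSome)
      (push left (fun v => (δ x (v.2.1.getD (default : A))).2) <|
        goto fun v => emb (.inl (δ x (v.2.1.getD (default : A))).1))
      (goto fun _ => emb (.inr x))
  | @SweepProg.sweep _ _ _ _ _ _ fin, emb, exit, .inr x =>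
    pop left (fun v a => (v.1, a, none)) <|
    branch (fun v => v.2.1.isSome)
      (push right (fun v => v.2.1.getD (default : A)) <| goto fun _ => emb (.inr x))
      (load (fun _ => (fin x, none, none)) <| goto fun v => exit v.1)
  | .seq p p', emb, exit, .inl x =>
    code p (fun l => emb (.inl l)) (entry p' (fun l => emb (.inr l)) exit) x
  | .seq _ p', emb, exit, .inr x => code p' (fun l => emb (.inr l)) exit x
  | .ite _ p _, emb, exit, .inl x => code p (fun l => emb (.inl l)) exit x
  | .ite _ _ p', emb, exit, .inr x => code p' (fun l => emb (.inr l)) exit x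
  | .loop b p, emb, exit, .inl _ =>
    goto fun v => bif b v.1 then entry p (fun l => emb (.inr l)) (fun _ => emb (.inl ())) v.1
      else exit v.1
  | .loop _ p, emb, _, .inr x => code p (fun l => emb (.inr l)) (fun _ => emb (.inl ())) x

/-- The configuration at label `x`, in state `q` and with the list `l`. -/
def cfg {L : Type} (x : L) (q : Q) (l : List A) : SweepCfg Q A L :=
  ⟨some x, (q, none, none), contents [] [] [] l⟩

/-- The rewritten cells are pushed one after the other, so they arrive on `left` in reverse order.
The arbitrary `a` and `k` are what the induction on `r` needs. -/
theorem runsIn_forward {L P : Type} {M : L → SweepStmt Q A L} {δ : P → A → P × A}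
    {emb : P ⊕ P → L}
    (hM : ∀ x, M (emb (.inl x)) =
      (pop right (fun v a => (v.1, a, none)) <|
        branch (fun v => v.2.1.isSome)
          (push left (fun v => (δ x (v.2.1.getD (default : A))).2) <|
            goto fun v => emb (.inl (δ x (v.2.1.getD (default : A))).1))
          (goto fun _ => emb (.inr x))))
    (q : Q) (a : Option A) (x : P) (k r : List A) :
    RunsIn M ⟨some (emb (.inl x)), (q, a, none), contents [] [] k r⟩
      ⟨some (emb (.inr (transduce δ x r).1)), (q, none, none),
        contents [] [] ((transduce δ x r).2.reverse ++ k) []⟩ (r.length + 1) := by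
  induction r generalizing x k a with
  | nil => exact RunsIn.step (by simp [hM, transduce])
  | cons b r ih =>
    refine RunsIn.head (c' := ⟨some (emb (.inl (δ x b).1)), (q, some b, none),
      contents [] [] ((δ x b).2 :: k) r⟩) (by simp [hM]) ?_
    simpa [transduce] using ih (some b) (δ x b).1 ((δ x b).2 :: k)

/-- Moving the cells back undoes the reversal. The function `f` and the exit are arbitrary because
the parsing phase of a decider ends with code of the same shape. -/
theorem runsIn_backward {L : Type} {M : L → SweepStmt Q A L} {x : L} {f : SweepVar Q A → Q}
    {exit : Q → L} (q' : Q)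
    (hM : M x = (pop left (fun v a => (v.1, a, none)) <|
        branch (fun v => v.2.1.isSome)
          (push right (fun v => v.2.1.getD (default : A)) <| goto fun _ => x)
          (load (fun v => (f v, none, none)) <| goto fun v => exit v.1)))
    (q : Q) (a : Option A) (hq : f (q, none, none) = q') (i : Option (Option Bool))
    (k r : List A) :
    RunsIn M ⟨some x, (q, a, i), contents [] [] k r⟩
      (cfg (exit q') q' (k.reverse ++ r)) (k.length + 1) := by
  induction k generalizing r a i with
  | nil => exact RunsIn.step (by simp [hM, cfg, hq])
  | cons b k ih =>
    refine RunsIn.head (c' := ⟨some x, (q, some b, none), contents [] [] k (b :: r)⟩)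
      (by simp [hM]) ?_
    simpa using ih (some b) none (b :: r)

/-- Induction on the execution. The machine `M` is any one that contains the code of `p` under an
embedding of labels, so the induction hypotheses apply to the parts of a program inside the same
machine, with the continuation as exit. -/
theorem Exec.runsIn {p : SweepProg Q A} {s s' : Q × List A} {t : ℕ} (h : Exec p s s' t) :
    ∀ {L : Type} (M : L → SweepStmt Q A L) (emb : p.Lbl → L) (exit : Q → L),
      (∀ x, M (emb x) = p.code emb exit x) →
      RunsIn M (cfg (p.entry emb exit s.1) s.1 s.2) (cfg (exit s'.1) s'.1 s'.2) t := by
  induction h with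
  | sweep init δ fin q l =>
    intro L M emb exit hM
    have h₁ := runsIn_forward (emb := emb) (δ := δ) (fun x => hM (.inl x)) q none (init q) [] l
    have h₂ := runsIn_backward (x := emb (.inr (transduce δ (init q) l).1))
      (f := fun _ => fin (transduce δ (init q) l).1) (exit := exit)
      (fin (transduce δ (init q) l).1) (hM (.inr _)) q none rfl none
      ((transduce δ (init q) l).2.reverse ++ []) []
    have h₃ := (h₁.trans h₂).mono (t' := 2 * l.length + 2)
      (by simp only [List.append_nil, List.length_reverse, length_transduce]; omega)
    simpa [cfg, entry] using h₃
  | seq _ _ ih₁ ih₂ =>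
    intro L M emb exit hM
    exact (ih₁ M _ _ fun x => hM (.inl x)).trans (ih₂ M _ _ fun x => hM (.inr x))
  | iteTrue hb _ ih =>
    intro L M emb exit hM
    simpa [entry, hb] using ih M _ _ fun x => hM (.inl x)
  | iteFalse hb _ ih =>
    intro L M emb exit hM
    simpa [entry, hb] using ih M _ _ fun x => hM (.inr x)
  | loopFalse hb =>
    intro L M emb exit hM
    have := hM (.inl ())
    exact RunsIn.step (by simp [cfg, entry, code, hb, this])
  | @loopTrue b p s s' s'' t t' hb _ _ ih₁ ih₂ =>
    intro L M emb exit hM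
    have h₁ := ih₁ M (fun l => emb (.inr l)) (fun _ => emb (.inl ())) fun x => hM (.inr x)
    have h₂ := ih₂ M emb exit hM
    refine (RunsIn.trans (RunsIn.trans (RunsIn.step ?_) h₁) h₂)
    have := hM (.inl ())
    simp [cfg, entry, code, hb, this]

end SweepProg

/-! ### Deciders -/

/-- A sweep program together with a transducer that prepares its list of cells from the input
word. -/
structure SweepDecider (Q A : Type) where
  {P : Type}
  [fintypeP : Fintype P]
  start : P
  parse : P → Option Bool → P × Option A
  init : P → Q
  prog : SweepProg Q A
  answer : Q → Bool

namespace SweepDecider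

open Turing.TM2.Stmt SweepStack

attribute [instance] SweepDecider.fintypeP

variable {Q A : Type} [Inhabited A] [Inhabited Q]

/-- The labels of the machine of a decider. -/
abbrev Label (d : SweepDecider Q A) : Type := (d.P ⊕ d.P) ⊕ (d.prog.Lbl ⊕ Unit)

/-- The program of the machine of a decider. -/
def stmt (d : SweepDecider Q A) : d.Label → SweepStmt Q A d.Label
  | .inl (.inl x) =>
    pop inp (fun v a => (v.1, none, a)) <|
    branch (fun v => v.2.2.isSome)
      (branch (fun v => (d.parse x (v.2.2.getD default)).2.isSome)
        (push left (fun v => (d.parse x (v.2.2.getD default)).2.getD default) <|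
          goto fun v => .inl (.inl (d.parse x (v.2.2.getD default)).1))
        (goto fun v => .inl (.inl (d.parse x (v.2.2.getD default)).1)))
      (goto fun _ => .inl (.inr x))
  | .inl (.inr x) =>
    pop left (fun v a => (v.1, a, none)) <|
    branch (fun v => v.2.1.isSome)
      (push right (fun v => v.2.1.getD (default : A)) <| goto fun _ => .inl (.inr x))
      (load (fun _ => (d.init x, none, none)) <|
        goto fun v => d.prog.entry (fun l => .inr (.inl l)) (fun _ => .inr (.inr ())) v.1)
  | .inr (.inl x) => d.prog.code (fun l => .inr (.inl l)) (fun _ => .inr (.inr ())) x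
  -- A halting configuration must have empty stacks apart from the output, and variables with their
  -- initial values. So the cells are discarded and the variables reset.
  | .inr (.inr _) =>
    pop right (fun v a => (v.1, a, none)) <|
    branch (fun v => v.2.1.isSome)
      (goto fun _ => .inr (.inr ()))
      (push out (fun v => d.answer v.1) <| load (fun _ => (default, none, none)) halt)

/-- The machine of a decider. -/
noncomputable def machine [Fintype Q] [Fintype A] (d : SweepDecider Q A) : Turing.FinTM2 where
  K := SweepStack
  k₀ := inp
  k₁ := out
  Γ := Alphabet A
  Λ := d.Label
  main := .inl (.inl d.start)
  σ := SweepVar Q A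
  initialState := (default, none, none)
  Γk₀Fin := inferInstanceAs (Fintype (Option Bool))
  m := d.stmt

/-- The state and the list of cells that are prepared from the input word. -/
def parsed (d : SweepDecider Q A) (w : List (Option Bool)) : Q × List A :=
  (d.init (transduce d.parse d.start w).1, (transduce d.parse d.start w).2.reduceOption)

theorem runsIn_parse (d : SweepDecider Q A) (q : Q) (i : Option (Option Bool)) (x : d.P)
    (w : List (Option Bool)) (k : List A) :
    RunsIn d.stmt ⟨some (.inl (.inl x)), (q, none, i), contents w [] k []⟩
      ⟨some (.inl (.inr (transduce d.parse x w).1)), (q, none, none),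
        contents [] [] ((transduce d.parse x w).2.reduceOption.reverse ++ k) []⟩
      (w.length + 1) := by
  induction w generalizing x k i with
  | nil => exact RunsIn.step (by simp [stmt, transduce])
  | cons b w ih =>
    rcases e : (d.parse x b).2 with _ | c
    · refine RunsIn.head (c' := ⟨some (.inl (.inl (d.parse x b).1)), (q, none, some b),
        contents w [] k []⟩) (by simp [stmt, e]) ?_
      simpa [transduce, e] using ih (some b) (d.parse x b).1 k
    · refine RunsIn.head (c' := ⟨some (.inl (.inl (d.parse x b).1)), (q, none, some b),
        contents w [] (c :: k) []⟩) (by simp [stmt, e]) ?_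
      simpa [transduce, e] using ih (some b) (d.parse x b).1 (c :: k)

theorem runsIn_clear (d : SweepDecider Q A) (q : Q) (a : Option A) (r : List A) :
    RunsIn d.stmt ⟨some (.inr (.inr ())), (q, a, none), contents [] [] [] r⟩
      ⟨none, (default, none, none), contents [] [d.answer q] [] []⟩ (r.length + 1) := by
  induction r generalizing a with
  | nil => exact RunsIn.step (by simp [stmt])
  | cons b r ih =>
    refine RunsIn.head (c' := ⟨some (.inr (.inr ())), (q, some b, none), contents [] [] [] r⟩)
      (by simp [stmt]) (ih (some b))

theorem runsIn_stmt (d : SweepDecider Q A) (w : List (Option Bool)) {s : Q × List A} {t : ℕ}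
    (h : d.prog.Exec (d.parsed w) s t) :
    RunsIn d.stmt ⟨some (.inl (.inl d.start)), (default, none, none), contents w [] [] []⟩
      ⟨none, (default, none, none), contents [] [d.answer s.1] [] []⟩
      (2 * w.length + 2 + t + (s.2.length + 1)) := by
  have h₁ := d.runsIn_parse default none d.start w []
  have h₂ := SweepProg.runsIn_backward (M := d.stmt)
    (x := .inl (.inr (transduce d.parse d.start w).1)) (exit := d.prog.entry
      (fun l => .inr (.inl l)) (fun _ => .inr (.inr ()))) (d.parsed w).1 rfl default none rfl none
      ((transduce d.parse d.start w).2.reduceOption.reverse ++ []) []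
  have h₃ := h.runsIn d.stmt (fun l => .inr (.inl l)) (fun _ => .inr (.inr ())) fun _ => rfl
  have h₄ := d.runsIn_clear s.1 none s.2
  have hl : (transduce d.parse d.start w).2.reduceOption.length ≤ w.length :=
    (List.reduceOption_length_le _).trans (length_transduce _ _ _).le
  simp only [List.append_nil, List.reverse_reverse, List.length_reverse] at h₁ h₂
  exact (((h₁.trans h₂).mono (by omega)).trans h₃).trans h₄

/-- A function to the booleans is computable in polynomial time if a decider computes it in
polynomial time. -/
theorem nonempty_computable [Fintype Q] [Fintype A] {α : Type} (enc : α → List (Option Bool))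
    (f : α → Bool) (d : SweepDecider Q A) (T : Polynomial ℕ)
    (h : ∀ a, ∃ s t, d.prog.Exec (d.parsed (enc a)) s t ∧ d.answer s.1 = f a ∧
      t + s.2.length ≤ T.eval (enc a).length) :
    Nonempty (Turing.TM2ComputableInPolyTime enc Computability.encodeBool f) := by
  choose s t hst using h
  -- Reading the word and turning the list of cells around takes at most `2ℓ + 2` steps, and
  -- clearing takes one step more than there are cells; `T` bounds the program together with the
  -- number of cells.
  refine ⟨{ tm := d.machine, inputAlphabet := Equiv.refl _, outputAlphabet := Equiv.refl _,
            time := 2 * Polynomial.X + 3 + T, outputsFun := fun a => ?_ }⟩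
  have hr : ∃ k ≤ (2 * Polynomial.X + 3 + T : Polynomial ℕ).eval (enc a).length,
      (flip bind d.machine.step)^[k] (some (Turing.initList d.machine (enc a))) =
        some (Turing.haltList d.machine [f a]) := by
    obtain ⟨h₁, h₂, h₃⟩ := hst a
    obtain ⟨k, hk, e⟩ := d.runsIn_stmt (enc a) h₁
    refine ⟨k, hk.trans ?_, ?_⟩
    · simp; omega
    · have e₁ : Turing.initList d.machine (enc a) =
          ⟨some (.inl (.inl d.start)), (default, none, none), contents (enc a) [] [] []⟩ := by
        unfold Turing.initList
        congr 1
        funext k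
        cases k <;> rfl
      have e₂ : Turing.haltList d.machine [f a] =
          ⟨none, (default, none, none), contents [] [d.answer (s a).1] [] []⟩ := by
        rw [h₂]
        unfold Turing.haltList
        congr 1
        funext k
        cases k <;> rfl
      rw [e₁, e₂]
      exact e
  have hm : ∀ l : List (Option Bool),
      List.map (Equiv.refl (d.machine.Γ d.machine.k₀)).invFun l = l := List.map_id
  have hm' : ∀ l : List Bool,
      List.map (Equiv.refl (d.machine.Γ d.machine.k₁)).invFun l = l := List.map_id
  erw [hm, hm']
  exact ⟨⟨hr.choose, hr.choose_spec.2⟩, hr.choose_spec.1⟩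

end SweepDecider

/-! ### Vertex programs

The tape of a sweep program can hold unary relations on the vertices of a graph, together with the
adjacency matrix and a binary counter. -/

theorem transduce_map {P A B : Type} (δ : P → A → P × B) (g : A → B) (p : P)
    (h : ∀ a, δ p a = (p, g a)) (l : List A) : transduce δ p l = (p, l.map g) := by
  induction l with
  | nil => rfl
  | cons a l ih => simp [transduce, h, ih]

/-- A loop invariant for one sweep: `Inv k` is what is known about the state of the transducer once
the blocks of the first `k` indices have been read. -/
theorem transduce_flatMap_finRange {P A B : Type} (δ : P → A → P × B) (n : ℕ)
    (f : Fin n → List A) (g : Fin n → List B) (Inv : ℕ → P → Prop) (p : P) (h₀ : Inv 0 p)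
    (h : ∀ (i : Fin n) p, Inv i p →
      Inv (i + 1) (transduce δ p (f i)).1 ∧ (transduce δ p (f i)).2 = g i) :
    Inv n (transduce δ p ((List.finRange n).flatMap f)).1 ∧
      (transduce δ p ((List.finRange n).flatMap f)).2 = (List.finRange n).flatMap g := by
  induction n generalizing Inv p with
  | zero => exact ⟨h₀, rfl⟩
  | succ n ih =>
    obtain ⟨h₁, h₂⟩ := h 0 p h₀
    obtain ⟨h₃, h₄⟩ := ih (fun i => f i.succ) (fun i => g i.succ) (fun k => Inv (k + 1)) _ h₁
      fun i q hq => h i.succ q hq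
    rw [List.finRange_succ, List.flatMap_cons, List.flatMap_cons, transduce_append,
      List.flatMap_map, List.flatMap_map]
    exact ⟨h₃, by rw [h₂, h₄]⟩

theorem transduce_map_finRange {P A B : Type} (δ : P → A → P × B) (n : ℕ)
    (f : Fin n → A) (g : Fin n → B) (Inv : ℕ → P → Prop) (p : P) (h₀ : Inv 0 p)
    (h : ∀ (i : Fin n) p, Inv i p → Inv (i + 1) (δ p (f i)).1 ∧ (δ p (f i)).2 = g i) :
    Inv n (transduce δ p ((List.finRange n).map f)).1 ∧
      (transduce δ p ((List.finRange n).map f)).2 = (List.finRange n).map g := by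
  have := transduce_flatMap_finRange δ n (fun i => [f i]) (fun i => [g i]) Inv p h₀
    fun i q hq => by simpa [transduce] using h i q hq
  simpa only [← List.map_eq_flatMap] using this

/-- The cells of the tape: a digit of the counter with its initial value, or an entry of the
adjacency matrix with a mark for the first column and the relations at its row and its column. -/
abbrev TapeCell (X : Type) : Type := (Bool × Bool) ⊕ (Bool × Bool × (X → Bool) × (X → Bool))

/-- The state of a vertex program: flags, unary relations on the vertices, and a counter. -/
@[ext]
structure VState (X Fl : Type) (n : ℕ) where
  fl : Fl → Bool
  rel : X → Fin n → Bool
  dig : List (Bool × Bool)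

namespace VState

variable {X Fl : Type} {n : ℕ}

/-- The cells of the adjacency matrix. -/
def cells (adj : Fin n → Fin n → Bool) (rel : X → Fin n → Bool) : List (TapeCell X) :=
  (List.finRange n).flatMap fun i => (List.finRange n).map fun j =>
    .inr (adj i j, decide (j.val = 0), (rel · i), (rel · j))

/-- The tape that represents a state. -/
def tape (adj : Fin n → Fin n → Bool) (h : VState X Fl n) : List (TapeCell X) :=
  h.dig.map .inl ++ cells adj h.rel

theorem length_tape (adj : Fin n → Fin n → Bool) (h : VState X Fl n) :
    (h.tape adj).length = h.dig.length + n * n := by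
  simp [tape, cells, List.length_flatMap]

section
variable [DecidableEq X]

/-- Assign to a relation. -/
def setRel (h : VState X Fl n) (x : X) (r : Fin n → Bool) : VState X Fl n :=
  { h with rel := Function.update h.rel x r }

variable (h : VState X Fl n) (x y : X) (r r' : Fin n → Bool)

@[simp] theorem fl_setRel : (h.setRel x r).fl = h.fl := rfl
@[simp] theorem dig_setRel : (h.setRel x r).dig = h.dig := rfl
@[simp] theorem rel_setRel : (h.setRel x r).rel = Function.update h.rel x r := rfl

end

section
variable [DecidableEq Fl]

/-- Assign to a flag. -/
def setFl (h : VState X Fl n) (b : Fl) (v : Bool) : VState X Fl n :=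
  { h with fl := Function.update h.fl b v }

variable (h : VState X Fl n) (b c : Fl) (v v' : Bool)

@[simp] theorem fl_setFl : (h.setFl b v).fl = Function.update h.fl b v := rfl
@[simp] theorem dig_setFl : (h.setFl b v).dig = h.dig := rfl
@[simp] theorem rel_setFl : (h.setFl b v).rel = h.rel := rfl

theorem setFl_setFl : (h.setFl b v).setFl b v' = h.setFl b v' := by
  simp [setFl]

theorem setFl_eq_self (hb : h.fl b = v) : h.setFl b v = h := by
  subst hb; simp [setFl]

end

end VState

/-! ### Transformations of states in polynomial time -/

/-- The transformations of states that vertex programs perform. -/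
abbrev VFun (X Fl : Type) : Type :=
  ∀ n : ℕ, (Fin n → Fin n → Bool) → VState X Fl n → VState X Fl n

/-- The transformation `F` is performed by a sweep program in polynomial time. -/
def Realizable {X Fl : Type} (F : VFun X Fl) : Prop :=
  ∃ (p : SweepProg (Fl → Bool) (TapeCell X)) (T : Polynomial ℕ), ∀ n adj h,
    -- Since the number of digits is kept, so is the length of the tape, and the time bounds of
    -- successive programs are polynomials in the same quantity.
    (F n adj h).dig.length = h.dig.length ∧
    ∃ t ≤ T.eval (h.tape adj).length,
      p.Exec (h.fl, h.tape adj) ((F n adj h).fl, (F n adj h).tape adj) t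

namespace Realizable

open VState

variable {X Fl : Type} {F G : VFun X Fl}

theorem comp (hF : Realizable F) (hG : Realizable G) :
    Realizable fun n adj h => G n adj (F n adj h) := by
  obtain ⟨p, T, hp⟩ := hF
  obtain ⟨p', T', hp'⟩ := hG
  refine ⟨.seq p p', T + T', fun n adj h => ?_⟩
  obtain ⟨e, t, ht, hx⟩ := hp n adj h
  obtain ⟨e', t', ht', hx'⟩ := hp' n adj (F n adj h)
  refine ⟨e'.trans e, t + t', ?_, .seq hx hx'⟩
  rw [length_tape, e, ← length_tape adj] at ht'
  simpa using Nat.add_le_add ht ht'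

theorem ite (b : (Fl → Bool) → Bool) (hF : Realizable F) (hG : Realizable G) :
    Realizable fun n adj h => if b h.fl then F n adj h else G n adj h := by
  obtain ⟨p, T, hp⟩ := hF
  obtain ⟨p', T', hp'⟩ := hG
  refine ⟨.ite b p p', T + T', fun n adj h => ?_⟩
  rw [Polynomial.eval_add]
  by_cases hb : b h.fl
  · obtain ⟨e, t, ht, hx⟩ := hp n adj h
    simp only [if_pos hb]
    exact ⟨e, t, by omega, .iteTrue hb hx⟩
  · obtain ⟨e, t, ht, hx⟩ := hp' n adj h
    simp only [if_neg hb]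
    exact ⟨e, t, by omega, .iteFalse (by simpa using hb) hx⟩

/-- By `h₁` and `h₂` the loop stops after exactly `n` rounds. As `n ≤ n * n` is at most the length
of the tape, which is the same in all rounds, the total time is polynomial. -/
theorem iterate (b : (Fl → Bool) → Bool) (hF : Realizable F) (hG : Realizable G)
    (h₁ : ∀ n adj h, ∀ i < n, b ((G n adj)^[i] (F n adj h)).fl = true)
    (h₂ : ∀ n adj h, b ((G n adj)^[n] (F n adj h)).fl = false) :
    Realizable fun n adj h => (G n adj)^[n] (F n adj h) := by
  suffices H : ∃ (p : SweepProg (Fl → Bool) (TapeCell X)) (T : Polynomial ℕ), ∀ n adj h,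
      ((G n adj)^[n] (F n adj h)).dig.length = (F n adj h).dig.length ∧
      ∃ t ≤ T.eval ((F n adj h).tape adj).length,
        p.Exec ((F n adj h).fl, (F n adj h).tape adj)
          (((G n adj)^[n] (F n adj h)).fl, ((G n adj)^[n] (F n adj h)).tape adj) t by
    obtain ⟨p, T, hp⟩ := hF
    obtain ⟨p', T', hp'⟩ := H
    refine ⟨.seq p p', T + T', fun n adj h => ?_⟩
    obtain ⟨e, t, ht, hx⟩ := hp n adj h
    obtain ⟨e', t', ht', hx'⟩ := hp' n adj h
    refine ⟨e'.trans e, t + t', ?_, .seq hx hx'⟩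
    rw [length_tape, e, ← length_tape adj] at ht'
    simpa using Nat.add_le_add ht ht'
  obtain ⟨p, T, hp⟩ := hG
  refine ⟨.loop b p, Polynomial.X * (T + 1) + 1, fun n adj h => ?_⟩
  have key : ∀ m (s : VState X Fl n), (∀ i < m, b ((G n adj)^[i] s).fl = true) →
      b ((G n adj)^[m] s).fl = false →
      ((G n adj)^[m] s).dig.length = s.dig.length ∧
      ∃ t ≤ m * (T.eval (s.tape adj).length + 1) + 1,
        (SweepProg.loop b p).Exec (s.fl, s.tape adj)
          (((G n adj)^[m] s).fl, ((G n adj)^[m] s).tape adj) t := by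
    intro m
    induction m with
    | zero => exact fun s _ h₂ => ⟨rfl, 1, by simp, .loopFalse h₂⟩
    | succ m ih =>
      intro s h₁ h₂
      obtain ⟨e, t, ht, hx⟩ := hp n adj s
      obtain ⟨e', t', ht', hx'⟩ := ih (G n adj s) (fun i hi => h₁ (i + 1) (by omega)) h₂
      refine ⟨e'.trans e, 1 + t + t', ?_, .loopTrue (h₁ 0 (by omega)) hx hx'⟩
      rw [length_tape, e, ← length_tape adj] at ht'
      rw [Nat.succ_mul]
      omega
  obtain ⟨e, t, ht, hx⟩ := key n (F n adj h) (h₁ n adj h) (h₂ n adj h)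
  refine ⟨e, t, ht.trans ?_, hx⟩
  simp only [Polynomial.eval_add, Polynomial.eval_mul, Polynomial.eval_X, Polynomial.eval_one]
  have : n ≤ ((F n adj h).tape adj).length := by
    rw [length_tape]
    nlinarith [Nat.le_mul_self n]
  gcongr

theorem of_sweep {P : Type} [Fintype P] (init : (Fl → Bool) → P)
    (δ : P → TapeCell X → P × TapeCell X) (fin : P → Fl → Bool)
    (h : ∀ n adj (h : VState X Fl n), (F n adj h).dig.length = h.dig.length ∧
      fin (transduce δ (init h.fl) (h.tape adj)).1 = (F n adj h).fl ∧
      (transduce δ (init h.fl) (h.tape adj)).2 = (F n adj h).tape adj) : Realizable F := by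
  refine ⟨.sweep P init δ fin, 2 * Polynomial.X + 2, fun n adj s =>
    ⟨(h n adj s).1, 2 * (s.tape adj).length + 2, ?_, ?_⟩⟩
  · simp
  · rw [← (h n adj s).2.1, ← (h n adj s).2.2]
    exact .sweep init δ fin _ _

variable [Fintype Fl] [DecidableEq Fl]

theorem map_tape (f : (Fl → Bool) → Fl → Bool) (d : Bool × Bool → Bool × Bool)
    (g : (Fl → Bool) → (X → Bool) → X → Bool) :
    Realizable (X := X) (Fl := Fl) fun _ _ h =>
      { fl := f h.fl, rel := fun x i => g h.fl (h.rel · i) x, dig := h.dig.map d } := by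
  refine of_sweep (P := Fl → Bool) id (fun q a => (q, Sum.map d
    (fun a => (a.1, a.2.1, g q a.2.2.1, g q a.2.2.2)) a)) f fun n adj h => ?_
  rw [transduce_map _ (Sum.map d fun a => (a.1, a.2.1, g h.fl a.2.2.1, g h.fl a.2.2.2)) (id h.fl)
    fun a => rfl]
  refine ⟨by simp, rfl, ?_⟩
  simp [tape, cells, List.map_flatMap, Function.comp_def]

theorem mapRel (g : (Fl → Bool) → (X → Bool) → X → Bool) :
    Realizable (X := X) (Fl := Fl) fun _ _ h =>
      { h with rel := fun x i => g h.fl (h.rel · i) x } := by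
  simpa using map_tape (X := X) (Fl := Fl) id id g

theorem mapFl (f : (Fl → Bool) → Fl → Bool) :
    Realizable (X := X) (Fl := Fl) fun _ _ h => { h with fl := f h.fl } := by
  simpa using map_tape (X := X) (Fl := Fl) f id fun _ => id

theorem setFl (b : Fl) (f : (Fl → Bool) → Bool) :
    Realizable (X := X) (Fl := Fl) fun _ _ h => h.setFl b (f h.fl) :=
  mapFl fun q => Function.update q b (f q)

theorem setRel [DecidableEq X] (x : X) (g : (X → Bool) → Bool) :
    Realizable (X := X) (Fl := Fl) fun _ _ h => h.setRel x fun i => g (h.rel · i) := by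
  have := mapRel (X := X) (Fl := Fl) fun _ r => Function.update r x (g r)
  convert this using 4 with n adj h
  unfold VState.setRel
  congr 1
  funext y i
  by_cases hy : y = x
  · subst hy; simp
  · simp [hy]

/-- Set the counter to its initial value. -/
theorem resetCounter : Realizable (X := X) (Fl := Fl) fun _ _ h =>
    { h with dig := h.dig.map fun d => (d.1, d.1) } :=
  map_tape (X := X) (Fl := Fl) id (fun d => (d.1, d.1)) fun _ => id

theorem countP_eq_card {A : Type} [Fintype A] (c : A → Bool) (l : List A)
    (hl : l.Nodup) (h : ∀ a, a ∈ l) : l.countP c = (Finset.univ.filter fun a => c a = true).card := by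
  classical
  rw [List.countP_eq_length_filter, ← List.toFinset_card_of_nodup (hl.filter _)]
  congr 1
  ext a
  simp [h]

theorem countP_cells {n : ℕ} (adj : Fin n → Fin n → Bool) (rel : X → Fin n → Bool)
    (c : TapeCell X → Bool) : (cells adj rel).countP c =
      (Finset.univ.filter fun i : Fin n × Fin n => c (.inr (adj i.1 i.2, decide (i.2.val = 0),
        (rel · i.1), (rel · i.2))) = true).card := by
  have : cells adj rel = (List.finRange n ×ˢ List.finRange n).map fun i =>
      .inr (adj i.1 i.2, decide (i.2.val = 0), (rel · i.1), (rel · i.2)) := by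
    simp [cells, SProd.sprod, List.product, List.map_flatMap, Function.comp_def]
  rw [this, List.countP_map, countP_eq_card]
  · rfl
  · exact (List.nodup_finRange n).product (List.nodup_finRange n)
  · rintro ⟨i, j⟩
    simp [List.mem_product]

/-- Test whether at least `t` pairs of vertices satisfy a condition. -/
theorem count (b : Fl) (t : ℕ) (c : (Fl → Bool) → Bool → (X → Bool) → (X → Bool) → Bool) :
    Realizable (X := X) (Fl := Fl) fun n adj h => h.setFl b (decide (t ≤
      (Finset.univ.filter fun i : Fin n × Fin n =>
        c h.fl (adj i.1 i.2) (h.rel · i.1) (h.rel · i.2) = true).card)) := by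
  -- The count is capped at `t`, so finitely many states suffice.
  let δ : ((Fl → Bool) × Fin (t + 1)) → TapeCell X → ((Fl → Bool) × Fin (t + 1)) × TapeCell X :=
    fun p a => ((p.1, bif a.elim (fun _ => false) (fun x => c p.1 x.1 x.2.2.1 x.2.2.2) then
      ⟨min (p.2 + 1) t, by omega⟩ else p.2), a)
  have hδ : ∀ (q : Fl → Bool) (k : ℕ) (hk : k < t + 1) (l : List (TapeCell X)),
      transduce δ (q, ⟨k, hk⟩) l = ((q, ⟨min (k + l.countP fun a =>
        a.elim (fun _ => false) fun x => c q x.1 x.2.2.1 x.2.2.2) t, by omega⟩), l) := by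
    intro q k hk l
    induction l generalizing k with
    | nil => simp [transduce, Nat.le_of_lt_succ hk]
    | cons a l ih =>
      have hd : δ (q, ⟨k, hk⟩) a = ((q, bif a.elim (fun _ => false)
          (fun x => c q x.1 x.2.2.1 x.2.2.2) then ⟨min (k + 1) t, by omega⟩ else ⟨k, hk⟩), a) := rfl
      simp only [transduce, List.countP_cons, hd]
      by_cases hc : a.elim (fun _ => false) (fun x => c q x.1 x.2.2.1 x.2.2.2) = true
      · simp only [hc, cond_true, ih, if_true, Prod.mk.injEq, Fin.mk.injEq, and_true, true_and]
        omega
      · simp only [Bool.not_eq_true] at hc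
        simp [hc, ih]
  refine of_sweep (P := (Fl → Bool) × Fin (t + 1)) (fun q => (q, ⟨0, by omega⟩)) δ
    (fun p => Function.update p.1 b (decide (p.2.val = t))) fun n adj h => ?_
  rw [hδ]
  refine ⟨rfl, ?_, rfl⟩
  simp only [VState.fl_setFl]
  congr 1
  simp only [tape, List.countP_append, countP_cells, List.countP_map]
  rw [List.countP_eq_zero.2 (by simp)]
  simp only [Sum.elim_inr, zero_add]
  rw [decide_eq_decide, min_eq_right_iff]
  exact Iff.of_eq (congrArg (t ≤ ·) (congrArg Finset.card (Finset.filter_congr_decidable ..)))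

/-- The first element of a relation, as a relation. -/
def _root_.firstOf {n : ℕ} (r : Fin n → Bool) : Fin n → Bool := fun i =>
  decide (r i = true ∧ ∀ j < i, r j = false)

/-- Assign to `y` the first element of `x`. -/
theorem pick [DecidableEq X] (x y : X) : Realizable (X := X) (Fl := Fl) fun _ _ h =>
    h.setRel y (firstOf (h.rel x)) := by
  -- Three bits accompany the flags: whether some row up to the current one lies in `x`, whether the
  -- current row is the first element of `x`, and whether an earlier column lies in `x`. The mark of
  -- the first column signals a new row, where the bits are brought up to date.
  let δ : ((Fl → Bool) × Bool × Bool × Bool) → TapeCell X →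
      ((Fl → Bool) × Bool × Bool × Bool) × TapeCell X := fun p a =>
    a.elim (fun d => (p, .inl d)) fun a =>
      let inside := bif a.2.1 then a.2.2.1 x && !p.2.1 else p.2.2.1
      let seen := bif a.2.1 then p.2.1 || a.2.2.1 x else p.2.1
      let before := bif a.2.1 then false else p.2.2.2
      ((p.1, seen, inside, before || a.2.2.2 x), .inr (a.1, a.2.1,
        Function.update a.2.2.1 y inside, Function.update a.2.2.2 y (a.2.2.2 x && !before)))
  refine of_sweep (P := (Fl → Bool) × Bool × Bool × Bool) (fun q => (q, false, false, false)) δ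
    (fun p => p.1) fun n adj h => ⟨rfl, ?_⟩
  let D := h.rel x
  let m : Fin n → Bool := firstOf D
  have hd : transduce δ (h.fl, false, false, false) (h.dig.map .inl) =
      ((h.fl, false, false, false), h.dig.map .inl) := by
    induction h.dig with
    | nil => rfl
    | cons d l ih =>
      have : ∀ p, δ p (.inl d) = (p, .inl d) := fun p => rfl
      simp [transduce, this, ih]
  have hc := transduce_flatMap_finRange δ n
    (fun i => (List.finRange n).map fun j =>
      .inr (adj i j, decide (j.val = 0), (h.rel · i), (h.rel · j)))
    (fun i => (List.finRange n).map fun j =>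
      .inr (adj i j, decide (j.val = 0), ((h.setRel y m).rel · i), ((h.setRel y m).rel · j)))
    (fun k p => p.1 = h.fl ∧ p.2.1 = decide (∃ i : Fin n, i.val < k ∧ D i = true))
    (h.fl, false, false, false) (by simp) (by
      intro i p hp
      have := transduce_map_finRange δ n
        (fun j => .inr (adj i j, decide (j.val = 0), (h.rel · i), (h.rel · j)))
        (fun j => .inr (adj i j, decide (j.val = 0), ((h.setRel y m).rel · i),
          ((h.setRel y m).rel · j)))
        -- Before the first column of a row, only the bit about earlier rows is meaningful; the
        -- other two are set when that column is read. This is why the invariant separates `k = 0`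
        -- from `0 < k`.
        (fun k p => p.1 = h.fl ∧
          (k = 0 → p.2.1 = decide (∃ i' : Fin n, i'.val < i.val ∧ D i' = true)) ∧
          (0 < k → p.2.1 = decide (∃ i' : Fin n, i'.val < i.val + 1 ∧ D i' = true) ∧
            p.2.2.1 = m i ∧ p.2.2.2 = decide (∃ j : Fin n, j.val < k ∧ D j = true)))
        p ⟨hp.1, fun _ => hp.2, by simp⟩ (by
          rintro j p ⟨h₁, h₂, h₃⟩
          have hu : ∀ i : Fin n, (fun z => (h.setRel y m).rel z i) =
              Function.update (fun z => h.rel z i) y (m i) := by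
            intro i
            funext z
            by_cases hz : z = y
            · subst hz; simp
            · simp [hz]
          have hex : ∀ k : Fin n, decide (∃ j : Fin n, j.val < k.val + 1 ∧ D j = true) =
              (decide (∃ j : Fin n, j.val < k.val ∧ D j = true) || D k) := by
            intro k
            rw [Bool.eq_iff_iff]
            simp only [decide_eq_true_eq, Bool.or_eq_true]
            constructor
            · rintro ⟨j, hj, hD⟩
              rcases Nat.lt_succ_iff_lt_or_eq.1 hj with hj | hj
              · exact Or.inl ⟨j, hj, hD⟩
              · exact Or.inr (Fin.ext hj ▸ hD)
            · rintro (⟨j, hj, hD⟩ | hD)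
              · exact ⟨j, by omega, hD⟩
              · exact ⟨k, by omega, hD⟩
          have hm : ∀ k : Fin n,
              m k = (D k && !decide (∃ j : Fin n, j.val < k.val ∧ D j = true)) := by
            intro k
            rw [Bool.eq_iff_iff]
            simp only [m, firstOf, decide_eq_true_eq, Bool.and_eq_true, Bool.not_eq_true',
              decide_eq_false_iff_not, not_exists, not_and, Bool.not_eq_true]
            exact Iff.rfl
          rw [hu, hu]
          rcases Nat.eq_zero_or_pos j.val with hj | hj
          · have h₂ := h₂ hj
            simp only [δ, Sum.elim_inr, hj, decide_true, cond_true, h₁, h₂, true_and]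
            have h0 : decide (∃ j : Fin n, j.val < 0 ∧ D j = true) = false := by simp
            refine ⟨⟨by simp, fun _ => ⟨(hex i).symm, (hm i).symm, ?_⟩⟩, ?_⟩
            · have := hex j
              rw [hj] at this
              rw [this, h0]
            · rw [hm i, hm j, hj, h0]
          · obtain ⟨h₄, h₅, h₆⟩ := h₃ hj
            have hj' : decide (j.val = 0) = false := by simpa using hj.ne'
            simp only [δ, Sum.elim_inr, hj', cond_false, h₁, h₄, h₅, h₆, true_and]
            exact ⟨⟨by simp, fun _ => (hex j).symm⟩, by rw [hm j]⟩)
      refine ⟨⟨this.1.1, ?_⟩, this.2⟩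
      exact (this.1.2.2 (i.pos)).1)
  have ht : h.tape adj = h.dig.map .inl ++ cells adj h.rel := rfl
  rw [ht, transduce_append, hd]
  exact ⟨hc.1.1, congrArg _ hc.2⟩

/-- Decrement a binary number that is not zero, given by its digits, the least significant one
first. -/
def _root_.decrementDigits (l : List (Bool × Bool)) : List (Bool × Bool) :=
  (transduce (fun (borrow : Bool) (d : Bool × Bool) => (borrow && !d.2, (d.1, xor d.2 borrow)))
    true l).2

/-- Decrement the counter. -/
theorem decrement : Realizable (X := X) (Fl := Fl) fun _ _ h =>
    { h with dig := decrementDigits h.dig } := by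
  let δ : ((Fl → Bool) × Bool) → TapeCell X → ((Fl → Bool) × Bool) × TapeCell X := fun p a =>
    a.elim (fun d => ((p.1, p.2 && !d.2), .inl (d.1, xor d.2 p.2))) fun a => (p, .inr a)
  have hd : ∀ (q : Fl → Bool) (l : List (Bool × Bool)) (b : Bool),
      transduce δ (q, b) (l.map .inl) =
      ((q, (transduce (fun (borrow : Bool) (d : Bool × Bool) =>
        (borrow && !d.2, (d.1, xor d.2 borrow))) b l).1),
        (transduce (fun (borrow : Bool) (d : Bool × Bool) =>
        (borrow && !d.2, (d.1, xor d.2 borrow))) b l).2.map .inl) := by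
    intro q l b
    induction l generalizing b with
    | nil => rfl
    | cons a l ih => simp only [List.map_cons, transduce]; simp [δ, ih]
  have hc : ∀ (n : ℕ) adj (rel : X → Fin n → Bool) p,
      transduce δ p (cells adj rel) = (p, cells adj rel) := by
    intro n adj rel p
    have : ∀ l : List (Bool × Bool × (X → Bool) × (X → Bool)),
        transduce δ p (l.map .inr) = (p, l.map .inr) := by
      intro l
      induction l with
      | nil => rfl
      | cons a l ih => simp only [List.map_cons, transduce]; simp [δ, ih]
    have e : cells adj rel = ((List.finRange n).flatMap fun i => (List.finRange n).map fun j =>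
        (adj i j, decide (j.val = 0), (rel · i), (rel · j))).map .inr := by
      simp [cells, List.map_flatMap, Function.comp_def]
    rw [e, this]
  refine of_sweep (P := (Fl → Bool) × Bool) (fun q => (q, true)) δ (fun p => p.1)
    fun n adj h => ⟨length_transduce _ _ _, ?_⟩
  have ht : h.tape adj = h.dig.map .inl ++ cells adj h.rel := rfl
  rw [ht, transduce_append, hd, hc]
  exact ⟨rfl, rfl⟩

/-- Test whether the counter is positive. -/
theorem testCounter (b : Fl) : Realizable (X := X) (Fl := Fl) fun _ _ h =>
    h.setFl b (h.dig.any fun d => d.2) := by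
  let δ : ((Fl → Bool) × Bool) → TapeCell X → ((Fl → Bool) × Bool) × TapeCell X := fun p a =>
    ((p.1, p.2 || a.elim (fun d => d.2) fun _ => false), a)
  have hd : ∀ (q : Fl → Bool) (l : List (TapeCell X)) (b : Bool), transduce δ (q, b) l =
      ((q, b || l.any fun a => a.elim (fun d => d.2) fun _ => false), l) := by
    intro q l b
    induction l generalizing b with
    | nil => simp [transduce]
    | cons a l ih => simp only [transduce]; simp [δ, ih, Bool.or_assoc]
  refine of_sweep (P := (Fl → Bool) × Bool) (fun q => (q, false)) δ
    (fun p => Function.update p.1 b p.2) fun n adj h => ⟨rfl, ?_⟩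
  rw [hd]
  refine ⟨?_, rfl⟩
  simp only [VState.fl_setFl]
  congr 1
  rw [tape, List.any_append, List.any_map, Bool.false_or]
  have : (cells adj h.rel).any (fun a => a.elim (fun d => d.2) fun _ => false) = false := by
    rw [List.any_eq_false]
    intro a ha
    simp only [cells, List.mem_flatMap, List.mem_map] at ha
    obtain ⟨i, -, j, -, rfl⟩ := ha
    simp
  rw [this, Bool.or_false]
  rfl

end Realizable

/-! ### Loops over the vertices -/

section

open VState

variable {X Fl : Type} [DecidableEq X] [DecidableEq Fl]

/-- Run `F` for every vertex, in increasing order: in every run, `p` holds the current vertex and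
`D` the vertices still to come. The flag `lp` controls the loop. -/
def forEach (lp : Fl) (p D : X) (F : VFun X Fl) : VFun X Fl := fun n adj h =>
  -- Every run of `F` starts with the flag cleared and is followed by clearing it, so nested loops
  -- can share a single flag.
  (List.finRange n).foldl (fun h i => (F n adj
      ((h.setRel p fun j => decide (j = i)).setRel D fun j => decide (i < j))).setFl lp false)
    ((h.setFl lp false).setRel D fun _ => true)

/-- Run `F` once where `p` is empty, and then for every vertex. -/
def forEachOption (lp : Fl) (p D : X) (F : VFun X Fl) : VFun X Fl := fun n adj h =>
  forEach lp p D F n adj (F n adj ((h.setRel p fun _ => false).setRel D fun _ => true))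

/-- A property that is kept by the body of a loop holds at the end. -/
theorem forEach_induction {lp : Fl} {p D : X} {F : VFun X Fl} {n : ℕ} {adj : Fin n → Fin n → Bool}
    {h : VState X Fl n} (I : ℕ → VState X Fl n → Prop)
    (h₀ : I 0 ((h.setFl lp false).setRel D fun _ => true))
    (hI : ∀ (i : Fin n) s, I i s → I (i + 1) ((F n adj
      ((s.setRel p fun j => decide (j = i)).setRel D fun j => decide (i < j))).setFl lp false)) :
    I n (forEach lp p D F n adj h) := by
  unfold forEach
  generalize (h.setFl lp false).setRel D (fun _ => true) = s at h₀
  have key : ∀ k (hk : k ≤ n) s, I (n - k) s → I n (((List.finRange n).drop (n - k)).foldl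
      (fun h i => (F n adj ((h.setRel p fun j => decide (j = i)).setRel D
        fun j => decide (i < j))).setFl lp false) s) := by
    intro k
    induction k with
    | zero =>
      intro _ s hs
      rw [List.drop_eq_nil_of_le (by simp)]
      exact hs
    | succ k ih =>
      intro hk s hs
      have hlt : n - (k + 1) < (List.finRange n).length := by simp; omega
      rw [List.drop_eq_getElem_cons hlt, List.foldl_cons]
      have e : n - (k + 1) + 1 = n - k := by omega
      rw [e]
      apply ih (by omega)
      have := hI ⟨n - (k + 1), by omega⟩ s hs
      simpa only [e, List.getElem_finRange, Fin.cast_mk] using this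
  simpa only [Nat.sub_self, List.drop_zero] using key n le_rfl s (by simpa using h₀)

/-- The relation `D` drives the loop: each round moves the first element of `D` to `p`, and then
`lp` records whether `D` is still nonempty. As `F` leaves `D` alone, the `k`-th round meets the
`k`-th vertex. -/
theorem Realizable.forEach [Fintype Fl] (lp : Fl) (p D : X) (hpD : p ≠ D) {F : VFun X Fl}
    (hF : Realizable F) (hD : ∀ n adj h, (F n adj h).rel D = h.rel D) :
    Realizable (_root_.forEach lp p D F) := by
  let test : VFun X Fl := fun n adj h => h.setFl lp (decide (1 ≤
    (Finset.univ.filter fun i : Fin n × Fin n => h.rel D i.1 = true).card))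
  have htest : Realizable test := Realizable.count lp 1 fun _ _ r _ => r D
  let body : VFun X Fl := fun n adj h => test n adj (F n adj
    (((h.setFl lp false).setRel p (firstOf (h.rel D))).setRel D fun i =>
      (h.rel D i && !firstOf (h.rel D) i)))
  have hbody : Realizable body := by
    have := ((((Realizable.setFl (X := X) lp fun _ => false).comp (Realizable.pick D p)).comp
      (Realizable.setRel D fun r => r D && !r p)).comp hF).comp htest
    simpa [body, hpD.symm] using this
  let start : VFun X Fl := fun n adj h =>
    test n adj ((h.setFl lp false).setRel D fun _ => true)
  have hstart : Realizable start :=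
    ((Realizable.setFl lp fun _ => false).comp (Realizable.setRel D fun _ => true)).comp htest
  have test_eq : ∀ (n : ℕ) adj (h : VState X Fl n) (k : ℕ), k ≤ n →
      h.rel D = (fun j => decide (k ≤ j.val)) → test n adj h = h.setFl lp (decide (k < n)) := by
    intro n adj h k hk hr
    simp only [test, hr]
    congr 1
    rw [decide_eq_decide, Nat.one_le_iff_ne_zero, Finset.card_ne_zero]
    constructor
    · rintro ⟨⟨i, j⟩, hi⟩
      have : k ≤ i.val := by simpa using hi
      omega
    · intro hk
      exact ⟨(⟨k, hk⟩, ⟨k, hk⟩), by simp⟩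
  -- After `k` rounds, the program is in the specified state except for the flag `lp`, which the
  -- body clears before it does anything else.
  have key : ∀ n adj (h : VState X Fl n), ∀ k ≤ n, ∃ s : VState X Fl n,
      s = ((List.finRange n).take k).foldl (fun h i => (F n adj
        ((h.setRel p fun j => decide (j = i)).setRel D fun j => decide (i < j))).setFl lp false)
          ((h.setFl lp false).setRel D fun _ => true) ∧
      s.fl lp = false ∧ s.rel D = (fun j => decide (k ≤ j.val)) ∧
      (body n adj)^[k] (start n adj h) = s.setFl lp (decide (k < n)) := by
    intro n adj h k
    induction k with
    | zero =>
      intro _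
      exact ⟨_, rfl, by simp, by simp, test_eq n adj _ 0 (by omega) (by simp)⟩
    | succ k ih =>
      intro hk
      obtain ⟨s, hs, hfl, hrel, hb⟩ := ih (by omega)
      refine ⟨_, rfl, ?_⟩
      have hlt : k < (List.finRange n).length := by simp; omega
      rw [List.take_succ_eq_append_getElem hlt, List.foldl_append, ← hs, List.getElem_finRange]
      simp only [List.foldl_cons, List.foldl_nil, Fin.cast_mk]
      have hD' : ∀ (h : VState X Fl n), ((F n adj h).setFl lp false).rel D = h.rel D := by
        intro h; simp [hD]
      have e : (fun j : Fin n => decide ((⟨k, by omega⟩ : Fin n) < j)) =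
          fun j => decide (k + 1 ≤ j.val) := by
        funext j; simp [Fin.lt_def]
      refine ⟨by simp, by rw [hD', rel_setRel, Function.update_self, e], ?_⟩
      rw [Function.iterate_succ_apply', hb]
      have e₁ : (s.setFl lp (decide (k < n))).setFl lp false = s := by
        rw [setFl_setFl, setFl_eq_self _ _ _ hfl]
      have e₂ : firstOf (s.rel D) =
          fun j => decide (j = ⟨k, by omega⟩) := by
        funext i
        unfold firstOf
        rw [decide_eq_decide, hrel]
        simp only [decide_eq_true_eq, decide_eq_false_iff_not, not_le, Fin.ext_iff]
        constructor
        · rintro ⟨h₁, h₂⟩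
          by_contra hne
          have := h₂ ⟨k, by omega⟩ (Fin.lt_def.2 (by simp; omega))
          simp at this
        · rintro h₁
          exact ⟨by omega, fun j hj => by have := Fin.lt_def.1 hj; omega⟩
      have e₃ : (fun i : Fin n => (s.rel D i && !decide (i = (⟨k, by omega⟩ : Fin n)))) =
          fun j => decide ((⟨k, by omega⟩ : Fin n) < j) := by
        funext i
        rw [hrel, Bool.eq_iff_iff]
        simp [Fin.ext_iff, Fin.lt_def]
        omega
      simp only [body, e₁, e₂, rel_setFl, e₃]
      rw [test_eq n adj _ (k + 1) hk (by rw [hD, rel_setRel, Function.update_self, e]), setFl_setFl]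
  have := Realizable.iterate (fun q => q lp) hstart hbody
    (fun n adj h i hi => by
      obtain ⟨s, -, -, -, hb⟩ := key n adj h i hi.le
      simp [hb, hi])
    (fun n adj h => by
      obtain ⟨s, -, -, -, hb⟩ := key n adj h n le_rfl
      simp [hb])
  convert this using 4 with n adj h
  obtain ⟨s, hs, hfl, -, hb⟩ := key n adj h n le_rfl
  rw [hb, decide_eq_false (lt_irrefl n), setFl_eq_self _ _ _ hfl, hs, List.take_of_length_le (by simp)]
  rfl

theorem Realizable.forEachOption [Fintype Fl] (lp : Fl) (p D : X) (hpD : p ≠ D) {F : VFun X Fl}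
    (hF : Realizable F) (hD : ∀ n adj h, (F n adj h).rel D = h.rel D) :
    Realizable (_root_.forEachOption lp p D F) :=
  (((Realizable.setRel p fun _ => false).comp (Realizable.setRel D fun _ => true)).comp hF).comp
    (Realizable.forEach lp p D hpD hF hD)

end

/-! ### Induced forests and independent sets in graphs without large induced matchings -/

namespace SimpleGraph

open Finset

open scoped Classical

variable {V : Type*} (G : SimpleGraph V)

/-- `w` has at most one neighbour in `U`. -/
def LeafIn (w : V) (U : Finset V) : Prop :=
  ∀ a ∈ U, ∀ b ∈ U, G.Adj w a → G.Adj w b → a = b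

/-- Every nonempty subset of `U` contains a vertex with at most one neighbour in it. -/
def Forest (U : Finset V) : Prop :=
  ∀ U' ⊆ U, U'.Nonempty → ∃ w ∈ U', G.LeafIn w U'

/-- No two vertices of `U` are adjacent. -/
def Indep (U : Finset V) : Prop := ∀ a ∈ U, ∀ b ∈ U, ¬G.Adj a b

/-- The vertices of `U` that are neither equal nor adjacent to `a` or `b`. -/
noncomputable def away (a b : V) (U : Finset V) : Finset V :=
  U.filter fun x => x ≠ a ∧ x ≠ b ∧ ¬G.Adj a x ∧ ¬G.Adj b x

/-- `U` contains an induced matching with `r` edges. -/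
def HasMatching : ℕ → Finset V → Prop
  | 0, _ => True
  | r + 1, U => ∃ a ∈ U, ∃ b ∈ U, G.Adj a b ∧ HasMatching r (G.away a b U)

variable {G}

theorem mem_away {a b x : V} {U : Finset V} :
    x ∈ G.away a b U ↔ x ∈ U ∧ x ≠ a ∧ x ≠ b ∧ ¬G.Adj a x ∧ ¬G.Adj b x := by
  simp [away]

theorem LeafIn.mono {w : V} {U U' : Finset V} (h : G.LeafIn w U) (hU : U' ⊆ U) : G.LeafIn w U' :=
  fun a ha b hb => h a (hU ha) b (hU hb)

theorem Forest.mono {U U' : Finset V} (h : G.Forest U) (hU : U' ⊆ U) : G.Forest U' :=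
  fun U'' hs hn => h U'' (hs.trans hU) hn

theorem Indep.mono {U U' : Finset V} (h : G.Indep U) (hU : U' ⊆ U) : G.Indep U' :=
  fun a ha b hb => h a (hU ha) b (hU hb)

/-! ### Induced matchings -/

theorem HasMatching.mono {r : ℕ} {U U' : Finset V} (h : G.HasMatching r U) (hU : U ⊆ U') :
    G.HasMatching r U' := by
  induction r generalizing U U' with
  | zero => trivial
  | succ r ih =>
    obtain ⟨a, ha, b, hb, hab, h⟩ := h
    refine ⟨a, hU ha, b, hU hb, hab, ih h fun x hx => ?_⟩
    rw [mem_away] at hx ⊢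
    exact ⟨hU hx.1, hx.2⟩

theorem HasMatching.of_le {r r' : ℕ} {U : Finset V} (h : G.HasMatching r U) (hr : r' ≤ r) :
    G.HasMatching r' U := by
  induction r' generalizing r U with
  | zero => trivial
  | succ r' ih =>
    obtain ⟨r, rfl⟩ : ∃ k, r = k + 1 := ⟨r - 1, by omega⟩
    obtain ⟨a, ha, b, hb, hab, h⟩ := h
    exact ⟨a, ha, b, hb, hab, ih h (by omega)⟩

theorem HasMatching.exists_embedding {r : ℕ} {U : Finset V} (h : G.HasMatching r U) :
    ∃ f : Fin r × Fin 2 → V, (∀ x, f x ∈ U) ∧ Function.Injective f ∧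
      ∀ x y, G.Adj (f x) (f y) ↔ x.1 = y.1 ∧ x.2 ≠ y.2 := by
  induction r generalizing U with
  | zero => exact ⟨fun x => x.1.elim0, fun x => x.1.elim0, fun x => x.1.elim0, fun x => x.1.elim0⟩
  | succ r ih =>
    obtain ⟨a, ha, b, hb, hab, h⟩ := h
    obtain ⟨f, hf, hinj, hadj⟩ := ih h
    have hf' := fun x => mem_away.1 (hf x)
    let e : Fin 2 → V := fun c => if c = 0 then a else b
    have he : ∀ c x, e c ≠ f x ∧ ¬G.Adj (e c) (f x) := by
      intro c x
      obtain ⟨-, h₁, h₂, h₃, h₄⟩ := hf' x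
      fin_cases c
      · exact ⟨h₁.symm, h₃⟩
      · exact ⟨h₂.symm, h₄⟩
    let g : Fin (r + 1) × Fin 2 → V := fun x => Fin.cases (e x.2) (fun i => f (i, x.2)) x.1
    have hg₀ : ∀ c, g (0, c) = e c := fun c => rfl
    have hgs : ∀ i c, g (Fin.succ i, c) = f (i, c) := fun i c => rfl
    have hab' := hab.ne
    have hba := hab.symm
    refine ⟨g, ?_, ?_, ?_⟩
    · rintro ⟨i, c⟩
      refine Fin.cases ?_ (fun i => ?_) i
      · rw [hg₀]; fin_cases c
        · exact ha
        · exact hb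
      · rw [hgs]; exact (hf' _).1
    · rintro ⟨i, c⟩ ⟨j, d⟩
      refine Fin.cases ?_ (fun i => ?_) i <;> refine Fin.cases ?_ (fun j => ?_) j
      · rw [hg₀, hg₀]
        fin_cases c <;> fin_cases d <;> simp [e, hab', hab'.symm]
      · rw [hg₀, hgs]; exact fun h => absurd h (he c _).1
      · rw [hg₀, hgs]; exact fun h => absurd h.symm (he d _).1
      · rw [hgs, hgs]
        intro h
        have := hinj h
        simp only [Prod.mk.injEq] at this
        simp [this]
    · rintro ⟨i, c⟩ ⟨j, d⟩
      refine Fin.cases ?_ (fun i => ?_) i <;> refine Fin.cases ?_ (fun j => ?_) j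
      · rw [hg₀, hg₀]
        fin_cases c <;> fin_cases d <;> simp [e, hab, hba]
      · rw [hg₀, hgs]
        simpa [Fin.succ_ne_zero, (Fin.succ_ne_zero _).symm] using (he c (j, d)).2
      · rw [hg₀, hgs, G.adj_comm]
        simpa [Fin.succ_ne_zero] using (he d (i, c)).2
      · rw [hgs, hgs, hadj]
        simp

theorem not_hasMatching_of_isSP2Free {s : ℕ} (h : IsSP2Free s G) (U : Finset V) :
    ¬G.HasMatching s U := fun hm => by
  obtain ⟨f, -, hinj, hadj⟩ := hm.exists_embedding
  exact h ⟨⟨⟨f, hinj⟩, fun {x y} => hadj x y⟩⟩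

/-- The edges are split off one by one. Injectivity of `x` on `T` need not be assumed: if `x t = x
t'`, then `t` would be adjacent to `x t'`. The condition on pairs is used in both orders. -/
theorem hasMatching_of_family {T U : Finset V} (x : V → V)
    (h₁ : ∀ t ∈ T, t ∈ U ∧ x t ∈ U ∧ G.Adj t (x t))
    (h₂ : ∀ t ∈ T, ∀ t' ∈ T, t ≠ t' → ¬G.Adj t t' ∧ ¬G.Adj t (x t') ∧ ¬G.Adj (x t) (x t')) :
    G.HasMatching T.card U := by
  induction T using Finset.induction_on generalizing U with
  | empty => trivial
  | insert t T ht ih =>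
    rw [card_insert_of_notMem ht]
    obtain ⟨ht₁, ht₂, ht₃⟩ := h₁ t (mem_insert_self _ _)
    refine ⟨t, ht₁, x t, ht₂, ht₃, ih (fun t' ht' => ?_) fun a ha b hb =>
      h₂ a (mem_insert_of_mem ha) b (mem_insert_of_mem hb)⟩
    have hne : t ≠ t' := fun h => ht (h ▸ ht')
    obtain ⟨h₃, h₄, h₅⟩ := h₁ t' (mem_insert_of_mem ht')
    obtain ⟨h₆, h₇, h₈⟩ := h₂ t (mem_insert_self _ _) t' (mem_insert_of_mem ht') hne
    obtain ⟨h₆', h₇', h₈'⟩ := h₂ t' (mem_insert_of_mem ht') t (mem_insert_self _ _) hne.symm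
    refine ⟨mem_away.2 ⟨h₃, hne.symm, ?_, h₆, fun h => h₇' h.symm⟩,
      mem_away.2 ⟨h₄, ?_, ?_, h₇, h₈⟩, h₅⟩
    · rintro rfl; exact h₆ ht₃
    · rintro rfl; exact h₆' h₅
    · intro h; exact h₇ (h ▸ ht₃)

/-! #### Forests -/

/-- A component is a tree, so it is a single vertex or has a vertex of degree one; all neighbours of
its vertices lie in it. -/
theorem IsAcyclic.exists_leaf [Finite V] [Nonempty V] (h : G.IsAcyclic) :
    ∃ v, ∀ a b, G.Adj v a → G.Adj v b → a = b := by
  have := Fintype.ofFinite V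
  obtain ⟨v₀⟩ := ‹Nonempty V›
  let c := G.connectedComponentMk v₀
  have ht := h.isTree_connectedComponent c
  have hc : ∀ v ∈ c.supp, ∀ a, G.Adj v a → a ∈ c.supp := by
    intro v hv a ha
    rw [ConnectedComponent.mem_supp_iff] at hv ⊢
    rw [← hv, ConnectedComponent.eq]
    exact ha.symm.reachable
  have hv₀ : v₀ ∈ c.supp := rfl
  rcases subsingleton_or_nontrivial c.supp with hs | hs
  · refine ⟨v₀, fun a b ha hb => ?_⟩
    exact congrArg Subtype.val (Subsingleton.elim (⟨a, hc _ hv₀ a ha⟩ : c.supp)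
      ⟨b, hc _ hv₀ b hb⟩)
  · obtain ⟨⟨v, hv⟩, hd⟩ := ht.exists_vert_degree_one_of_nontrivial
    obtain ⟨u, -, hu⟩ := degree_eq_one_iff_existsUnique_adj.1 hd
    refine ⟨v, fun a b ha hb => ?_⟩
    have h₁ := hu ⟨a, hc v hv a ha⟩ ha
    have h₂ := hu ⟨b, hc v hv b hb⟩ hb
    exact congrArg Subtype.val (h₁.trans h₂.symm)

/-- Acyclicity passes to induced subgraphs, which then have leaves. Conversely, every vertex of a
cycle has two neighbours on it, so the vertices of a cycle form a subset without a leaf. -/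
theorem isAcyclic_induce_iff_forest (U : Finset V) :
    (G.induce (U : Set V)).IsAcyclic ↔ G.Forest U := by
  constructor
  · intro h U' hU' hne
    have h' : (G.induce (U' : Set V)).IsAcyclic :=
      h.embedding (G.induceHomOfLE (by exact_mod_cast hU'))
    have : Nonempty (U' : Set V) := hne.coe_sort
    obtain ⟨⟨v, hv⟩, hl⟩ := h'.exists_leaf
    exact ⟨v, hv, fun a ha b hb h₁ h₂ => congrArg Subtype.val (hl ⟨a, ha⟩ ⟨b, hb⟩ h₁ h₂)⟩
  · intro h v c hc
    let U' : Finset V := c.support.toFinset.map ⟨Subtype.val, Subtype.val_injective⟩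
    have hmem : ∀ x : (U : Set V), x.val ∈ U' ↔ x ∈ c.support := by
      intro x; simp [U']
    obtain ⟨w, hw, hl⟩ := h U' (fun x hx => by
      simp only [U', Finset.mem_map] at hx
      obtain ⟨y, -, rfl⟩ := hx
      exact y.2) ⟨v, (hmem v).2 c.start_mem_support⟩
    obtain ⟨y, hy, rfl⟩ := Finset.mem_map.1 hw
    have h2 := hc.ncard_neighborSet_toSubgraph_eq_two (List.mem_toFinset.1 hy)
    obtain ⟨a, b, hab, he⟩ := Set.ncard_eq_two.1 h2
    have ha : a ∈ c.toSubgraph.neighborSet y := he ▸ Set.mem_insert _ _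
    have hb : b ∈ c.toSubgraph.neighborSet y := he ▸ Set.mem_insert_of_mem _ rfl
    refine hab (Subtype.ext (hl a ((hmem a).2 ?_) b ((hmem b).2 ?_) ?_ ?_))
    · exact (c.mem_verts_toSubgraph).1 (c.toSubgraph.edge_vert ha.symm)
    · exact (c.mem_verts_toSubgraph).1 (c.toSubgraph.edge_vert hb.symm)
    · exact c.toSubgraph.adj_sub ha
    · exact c.toSubgraph.adj_sub hb

/-- A forest without induced matchings with `s` edges has a small vertex cover. -/
theorem Forest.exists_cover {s : ℕ} {U : Finset V} (hU : G.Forest U) (hs : ¬G.HasMatching s U) :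
    ∃ C ⊆ U, C.card ≤ 2 * s ∧ G.Indep (U \ C) := by
  induction s generalizing U with
  | zero => exact absurd trivial hs
  | succ s ih =>
    by_cases hind : G.Indep U
    · exact ⟨∅, by simp, by simp, by simpa using hind⟩
    let U₁ := U.filter fun w => ¬G.LeafIn w U
    have hU₁ : ∀ w, w ∈ U₁ ↔ w ∈ U ∧ ¬G.LeafIn w U := fun w => by simp [U₁]
    -- If `U` consists of leaves, any edge will do. Otherwise let `p` be a leaf of the forest `U₁`
    -- of the other vertices: it has two neighbours in `U` but at most one in `U₁`, so some
    -- neighbour `l` is a leaf of `U`.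
    obtain ⟨p, hp, l, hl, hpl, hleaf, hp₁⟩ : ∃ p ∈ U, ∃ l ∈ U, G.Adj p l ∧ G.LeafIn l U ∧
        G.LeafIn p U₁ := by
      rcases U₁.eq_empty_or_nonempty with he | hne
      · simp only [Indep, not_forall, not_not] at hind
        obtain ⟨p, hp, l, hl, hpl⟩ := hind
        have hle : l ∉ U₁ := by simp [he]
        rw [hU₁] at hle
        refine ⟨p, hp, l, hl, hpl, by tauto, by simp [he, LeafIn]⟩
      · obtain ⟨p, hp, hp₁⟩ := hU U₁ (filter_subset _ _) hne
        have hp' := (hU₁ p).1 hp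
        by_contra! hcon
        refine hp'.2 fun a ha b hb hpa hpb => ?_
        have key : ∀ a ∈ U, G.Adj p a → a ∈ U₁ := fun a ha hpa =>
          (hU₁ a).2 ⟨ha, fun hla => hcon p hp'.1 a ha hpa hla hp₁⟩
        exact hp₁ a (key a ha hpa) b (key b hb hpb) hpa hpb
    have hm : ¬G.HasMatching s (G.away p l U) := fun h => hs ⟨p, hp, l, hl, hpl, h⟩
    obtain ⟨C, hCU, hC, hI⟩ := ih (hU.mono (filter_subset _ _)) hm
    have hsub : ∀ x ∈ G.away p l U, x ∈ U := fun x hx => (mem_away.1 hx).1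
    -- The set `X` meets all edges that are not inside `away p l U`: the neighbours of `p` outside
    -- `X`, and `l`, are leaves whose only neighbour is `p`. So each edge of the matching costs at
    -- most two vertices of the cover.
    let X := insert p (U₁.filter fun a => G.Adj p a)
    have hX : X.card ≤ 2 := by
      refine (card_insert_le _ _).trans (Nat.succ_le_succ (card_le_one.2 ?_))
      intro a ha b hb
      rw [mem_filter] at ha hb
      exact hp₁ a ha.1 b hb.1 ha.2 hb.2
    refine ⟨C ∪ X, ?_, ?_, ?_⟩
    · refine union_subset (fun x hx => hsub x (hCU hx)) (insert_subset hp ?_)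
      exact (filter_subset _ _).trans (filter_subset _ _)
    · have := card_union_le C X
      omega
    · have key : ∀ a ∈ U \ (C ∪ X), ∀ b ∈ U \ (C ∪ X), G.Adj a b → a ∈ G.away p l U := by
        intro a ha b hb hab
        simp only [mem_sdiff, mem_union, X, mem_insert, mem_filter, not_or, not_and, hU₁] at ha hb
        refine mem_away.2 ⟨ha.1, ha.2.2.1, ?_, fun hpa => ?_, fun hla => ?_⟩
        · rintro rfl
          exact hb.2.2.1 (hleaf b hb.1 p hp hab hpl.symm)
        · have hleafa : G.LeafIn a U := by
            by_contra hcon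
            exact ha.2.2.2 ⟨ha.1, hcon⟩ hpa
          exact hb.2.2.1 (hleafa b hb.1 p hp hab hpa.symm)
        · exact ha.2.2.1 (hleaf a ha.1 p hp hla hpl.symm)
      intro a ha b hb hab
      have ha' := key a ha b hb hab
      have hb' := key b hb a ha hab.symm
      simp only [mem_sdiff, mem_union, not_or] at ha hb
      exact hI a (mem_sdiff.2 ⟨ha', ha.2.1⟩) b (mem_sdiff.2 ⟨hb', hb.2.1⟩) hab

/-- A leaf `v` of `C ∪ W` lies in `C`, because the vertices of `W` have two neighbours in `C`.
Delete `v`, together with its at most one neighbour in `W`: the remaining vertices of `W` keep their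
neighbours in `C`, and both bounds drop by one. -/
theorem Forest.card_le {C W : Finset V} (h : G.Forest (C ∪ W))
    (hW : ∀ w ∈ W, ¬G.LeafIn w C) : W.card ≤ C.card := by
  induction hn : C.card generalizing C W with
  | zero =>
    rw [card_eq_zero] at hn
    subst hn
    rcases W.eq_empty_or_nonempty with rfl | ⟨w, hw⟩
    · simp
    · exact absurd (by simp [LeafIn]) (hW w hw)
  | succ k ih =>
    have hne : C.Nonempty := card_pos.1 (by omega)
    obtain ⟨v, hv, hl⟩ := h _ subset_rfl (hne.mono subset_union_left)
    have hvW : v ∉ W := fun hvW => hW v hvW (hl.mono subset_union_left)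
    have hvC : v ∈ C := (mem_union.1 hv).resolve_right hvW
    have h₁ : (W.filter fun w => G.Adj v w).card ≤ 1 := by
      refine card_le_one.2 fun a ha b hb => ?_
      rw [mem_filter] at ha hb
      exact hl a (mem_union_right _ ha.1) b (mem_union_right _ hb.1) ha.2 hb.2
    have h₂ : (W.filter fun w => ¬G.Adj v w).card ≤ k := by
      refine ih (C := C.erase v) (h.mono (union_subset_union (erase_subset _ _)
        (filter_subset _ _))) ?_ (by rw [card_erase_of_mem hvC]; omega)
      intro w hw hlw
      rw [mem_filter] at hw
      refine hW w hw.1 fun a ha b hb hwa hwb => hlw a ?_ b ?_ hwa hwb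
      · exact mem_erase.2 ⟨by rintro rfl; exact hw.2 hwa.symm, ha⟩
      · exact mem_erase.2 ⟨by rintro rfl; exact hw.2 hwb.symm, hb⟩
    have h₃ := card_filter_add_card_filter_not (s := W) fun w => G.Adj v w
    omega

/-- A forest without induced matchings with `s` edges consists of boundedly many vertices and an
independent set of vertices that have at most one neighbour among them. -/
theorem Forest.exists_core {s : ℕ} {U : Finset V} (hU : G.Forest U) (hs : ¬G.HasMatching s U) :
    ∃ C ⊆ U, C.card ≤ 4 * s ∧ G.Indep (U \ C) ∧ ∀ w ∈ U \ C, G.LeafIn w C := by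
  obtain ⟨C, hCU, hC, hI⟩ := hU.exists_cover hs
  -- The vertices with two neighbours in the cover join the core. They are no more than the vertices
  -- of the cover, whence `4 * s`; and since `U \ C` is independent, they add no neighbours to the
  -- remaining vertices.
  let W := (U \ C).filter fun w => ¬G.LeafIn w C
  have hW : W ⊆ U \ C := filter_subset _ _
  have hcard : W.card ≤ C.card := (hU.mono (union_subset hCU (hW.trans sdiff_subset))).card_le
    fun w hw => (mem_filter.1 hw).2
  refine ⟨C ∪ W, union_subset hCU (hW.trans sdiff_subset), ?_, ?_, ?_⟩
  · have := card_union_le C W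
    omega
  · exact hI.mono (sdiff_subset_sdiff subset_rfl subset_union_left)
  · intro w hw a ha b hb hwa hwb
    simp only [mem_sdiff, mem_union, not_or] at hw
    have hw' : w ∈ U \ C := mem_sdiff.2 ⟨hw.1, hw.2.1⟩
    have hleaf : G.LeafIn w C := by
      by_contra hcon
      exact hw.2.2 (mem_filter.2 ⟨hw', hcon⟩)
    have key : ∀ a ∈ C ∪ W, G.Adj w a → a ∈ C := fun a ha hwa =>
      (mem_union.1 ha).resolve_right fun haW => hI w hw' a (hW haW) hwa
    exact hleaf a (key a ha hwa) b (key b hb hwb) hwa hwb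

/-- A vertex of `J` has all its neighbours in `C ∪ J` inside `C`, so it is a leaf of every subset
that contains it. A subset that avoids `J` is covered by `hC`. -/
theorem Forest.union {C J : Finset V} (hC : G.Forest C) (hJ : G.Indep J)
    (h : ∀ w ∈ J, G.LeafIn w C) : G.Forest (C ∪ J) := by
  intro U hU hne
  by_cases hUJ : ∃ w ∈ U, w ∈ J
  · obtain ⟨w, hw, hwJ⟩ := hUJ
    have key : ∀ a ∈ U, G.Adj w a → a ∈ C := fun a ha hwa =>
      (mem_union.1 (hU ha)).resolve_right fun haJ => hJ w hwJ a haJ hwa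
    exact ⟨w, hw, fun a ha b hb hwa hwb => h w hwJ a (key a ha hwa) b (key b hb hwb) hwa hwb⟩
  · push Not at hUJ
    exact hC U (fun x hx => (mem_union.1 (hU hx)).resolve_right (hUJ x hx)) hne

/-! #### Maximal independent sets -/

section

variable [LinearOrder V]

/-- The vertices that are excluded by a list of edges. -/
def Excluded (G : SimpleGraph V) (P : List (V × V)) (w : V) : Prop :=
  ∃ e ∈ P, w < e.2 ∧ (w = e.1 ∨ G.Adj w e.1 ∨ G.Adj w e.2)

/-- In a graph without large induced matchings, every maximal independent set is obtained by the
greedy algorithm after boundedly many edges and their neighbourhoods are excluded from an initial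
segment of the vertices. -/
theorem exists_excluded {s : ℕ} {U J : Finset V} (hs : ¬G.HasMatching s U) (hJU : J ⊆ U)
    (hJ : G.Indep J) (hmax : ∀ w ∈ U, w ∉ J → ∃ z ∈ J, G.Adj w z) :
    ∃ P : List (V × V), P.length ≤ s ∧ (∀ e ∈ P, e.2 ∈ U) ∧
      ∀ w, w ∈ J ↔ w ∈ U ∧ ¬G.Excluded P w ∧ ∀ z ∈ J, z < w → ¬G.Adj w z := by
  induction s generalizing U J with
  | zero => exact absurd trivial hs
  | succ s ih =>
    -- The mistakes of the plain greedy algorithm: `u` is outside `J`, yet all its neighbours in `J`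
    -- come later, and `v` is the first of them.
    let B := (U ×ˢ J).filter fun e => e.1 ∉ J ∧ G.Adj e.1 e.2 ∧ ∀ z ∈ J, G.Adj e.1 z → e.2 ≤ z ∧ e.1 < z
    have hB : ∀ u v, (u, v) ∈ B ↔ (u ∈ U ∧ v ∈ J) ∧ u ∉ J ∧ G.Adj u v ∧
        ∀ z ∈ J, G.Adj u z → v ≤ z ∧ u < z := fun u v => by simp [B]
    have hbad : ∀ u ∈ U, u ∉ J → (∀ z ∈ J, z < u → ¬G.Adj u z) → ∃ v, (u, v) ∈ B := by
      intro u hu huJ hz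
      have hne : (J.filter fun z => G.Adj u z).Nonempty := by
        obtain ⟨z, hz, hadj⟩ := hmax u hu huJ
        exact ⟨z, mem_filter.2 ⟨hz, hadj⟩⟩
      have hmin := min'_mem _ hne
      rw [mem_filter] at hmin
      refine ⟨_, (hB u _).2 ⟨⟨hu, hmin.1⟩, huJ, hmin.2, fun z hzJ hadj => ⟨?_, ?_⟩⟩⟩
      · exact min'_le _ _ (mem_filter.2 ⟨hzJ, hadj⟩)
      · rcases lt_trichotomy u z with h | h | h
        · exact h
        · exact absurd (h ▸ hzJ) huJ
        · exact absurd hadj (hz z hzJ h)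
    rcases B.eq_empty_or_nonempty with he | hne
    · refine ⟨[], by simp, by simp, fun w => ⟨fun hw => ⟨hJU hw, by simp [Excluded],
        fun z hz _ => hJ w hw z hz⟩, fun ⟨hw, _, hz⟩ => ?_⟩⟩
      by_contra hwJ
      obtain ⟨v, hv⟩ := hbad w hw hwJ hz
      simp [he] at hv
    -- Take a mistake with `v` as late as possible, and exclude `u` and the neighbours of `u` and
    -- `v` before `v`. No vertex of `J` is lost, since `J` is independent and `v` is the first
    -- neighbour of `u` in it. What remains before `v` lies away from the edge `uv`, so its induced
    -- matchings are smaller.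
    · obtain ⟨⟨u, v⟩, huv, hlast⟩ := exists_max_image B (fun e => e.2) hne
      obtain ⟨⟨huU, hvJ⟩, huJ, hadj, hfirst⟩ := (hB u v).1 huv
      let U' := (G.away u v U).filter fun w => w < v
      let J' := J.filter fun w => w < v
      have hU' : ∀ w, w ∈ U' ↔ (w ∈ U ∧ w ≠ u ∧ w ≠ v ∧ ¬G.Adj u w ∧ ¬G.Adj v w) ∧ w < v :=
        fun w => by simp [U', mem_away]
      have hJ' : ∀ w, w ∈ J' ↔ w ∈ J ∧ w < v := fun w => by simp [J']
      obtain ⟨P, hP, hPU, hchar⟩ := ih (U := U') (J := J')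
        (fun hm => hs ⟨u, huU, v, hJU hvJ, hadj, hm.mono (filter_subset _ _)⟩)
        (fun w hw => by
          obtain ⟨hw, hwv⟩ := (hJ' w).1 hw
          refine (hU' w).2 ⟨⟨hJU hw, ?_, hwv.ne, fun h => ?_, hJ v hvJ w hw⟩, hwv⟩
          · rintro rfl; exact huJ hw
          · exact absurd (hfirst w hw h).1 (not_le.2 hwv))
        (hJ.mono (filter_subset _ _))
        -- Maximality of `J'` in `U'`: if no neighbour of `w` in `J` precedes `w`, then `w` is a
        -- mistake, so its first neighbour in `J` is at most `v`; it is not `v`, whose neighbours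
        -- are outside `U'`.
        (fun w hw hwJ => by
          obtain ⟨⟨hwU, -, -, -, hvw⟩, hwv⟩ := (hU' w).1 hw
          have hwJ' : w ∉ J := fun h => hwJ ((hJ' w).2 ⟨h, hwv⟩)
          by_cases hz : ∀ z ∈ J, z < w → ¬G.Adj w z
          · obtain ⟨z, hz⟩ := hbad w hwU hwJ' hz
            have hzv : z ≤ v := hlast _ hz
            obtain ⟨⟨-, hzJ⟩, -, hwz, -⟩ := (hB w z).1 hz
            refine ⟨z, (hJ' z).2 ⟨hzJ, lt_of_le_of_ne hzv ?_⟩, hwz⟩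
            rintro rfl
            exact hvw hwz.symm
          · push Not at hz
            obtain ⟨z, hzJ, hzw, hwz⟩ := hz
            exact ⟨z, (hJ' z).2 ⟨hzJ, hzw.trans hwv⟩, hwz⟩)
      have hPv : ∀ e ∈ P, e.2 < v := fun e he => ((hU' _).1 (hPU e he)).2
      refine ⟨(u, v) :: P, by simpa using hP, ?_, fun w => ?_⟩
      · intro e he
        rcases List.mem_cons.1 he with rfl | he
        · exact hJU hvJ
        · exact ((hU' _).1 (hPU e he)).1.1
      · have hex : G.Excluded ((u, v) :: P) w ↔
            (w < v ∧ (w = u ∨ G.Adj w u ∨ G.Adj w v)) ∨ G.Excluded P w := by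
          simp [Excluded]
        -- A pair excludes only vertices before its second end, so `P` has no effect from `v` on.
        -- After `v` there is no mistake either, because its first neighbour in `J` would come after
        -- `v`.
        have hPw : v ≤ w → ¬G.Excluded P w := by
          rintro h ⟨e, he, hw, -⟩
          exact absurd (hw.trans (hPv e he)) (not_lt.2 h)
        rcases lt_trichotomy w v with hwv | rfl | hwv
        · have h₁ := hchar w
          rw [hJ', hU'] at h₁
          rw [hex]
          have h₂ : (∀ z ∈ J', z < w → ¬G.Adj w z) ↔ ∀ z ∈ J, z < w → ¬G.Adj w z :=
            ⟨fun h z hz hzw => h z ((hJ' z).2 ⟨hz, hzw.trans hwv⟩) hzw,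
              fun h z hz hzw => h z ((hJ' z).1 hz).1 hzw⟩
          rw [h₂, G.adj_comm u w, G.adj_comm v w] at h₁
          simp only [hwv, hwv.ne, and_true, true_and, ne_eq, not_false_eq_true] at h₁ ⊢
          rw [h₁]
          simp only [not_or, and_assoc]
        · exact ⟨fun _ => ⟨hJU hvJ, by simp [hex, hPw le_rfl], fun z hz _ => hJ w hvJ z hz⟩,
            fun _ => hvJ⟩
        · refine ⟨fun hw => ⟨hJU hw, by simp [hex, hPw hwv.le, hwv.not_gt],
            fun z hz _ => hJ w hw z hz⟩, fun ⟨hw, _, hz⟩ => ?_⟩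
          by_contra hwJ
          obtain ⟨v', hv'⟩ := hbad w hw hwJ hz
          obtain ⟨⟨-, hJv'⟩, -, hwv', hlt⟩ := (hB w v').1 hv'
          have h₁ : v' ≤ v := hlast _ hv'
          have h₂ := (hlt v' hJv' hwv').2
          exact absurd (h₂.trans_le h₁) (not_lt.2 hwv.le)

end

end SimpleGraph

namespace SimpleGraph

open Finset

open scoped Classical

variable {V : Type*} {G : SimpleGraph V}

/-! #### Connected sets -/

/-- Every proper nonempty subset of `A` is joined by an edge to the rest of `A`. -/
def Linked (G : SimpleGraph V) (A : Finset V) : Prop :=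
  ∀ X ⊆ A, X.Nonempty → X ≠ A → ∃ x ∈ X, ∃ y ∈ A \ X, G.Adj x y

/-- No edge joins `B` to the rest of `A`. -/
def ClosedIn (G : SimpleGraph V) (A B : Finset V) : Prop := ∀ x ∈ B, ∀ y ∈ A \ B, ¬G.Adj x y

/-- A walk from `X` to its complement uses an edge between them. Conversely, no edge leaves the set
of vertices that are reachable from `u`. -/
theorem preconnected_induce_iff_linked (A : Finset V) :
    (G.induce (A : Set V)).Preconnected ↔ G.Linked A := by
  constructor
  · intro h X hXA hX hne
    obtain ⟨x, hx⟩ := hX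
    obtain ⟨y, hy⟩ : (A \ X).Nonempty := sdiff_nonempty.2 fun h => hne (hXA.antisymm h)
    by_contra! hcon
    have key : ∀ u v : (A : Set V), (G.induce (A : Set V)).Walk u v → u.1 ∈ X → v.1 ∈ X := by
      intro u v w
      induction w with
      | nil => exact id
      | @cons a b c hadj _ ih =>
        intro ha
        refine ih ?_
        by_contra hb
        exact hcon a ha b (mem_sdiff.2 ⟨b.2, hb⟩) hadj
    obtain ⟨w⟩ := h ⟨x, hXA hx⟩ ⟨y, (mem_sdiff.1 hy).1⟩
    exact (mem_sdiff.1 hy).2 (key _ _ w hx)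
  · intro h u v
    let X : Finset V := A.filter fun x => ∃ hx : x ∈ A,
      (G.induce (A : Set V)).Reachable u ⟨x, hx⟩
    have hX : ∀ x, x ∈ X ↔ ∃ hx : x ∈ (A : Set V), (G.induce (A : Set V)).Reachable u ⟨x, hx⟩ := by
      intro x
      simp only [X, mem_filter, mem_coe]
      exact ⟨fun h => h.2, fun h => ⟨h.1, h⟩⟩
    by_cases he : X = A
    · obtain ⟨_, hr⟩ := (hX v).1 (by rw [he]; exact v.2)
      exact hr
    · obtain ⟨x, hx, y, hy, hadj⟩ :=
        h X (filter_subset _ _) ⟨u.1, (hX u.1).2 ⟨u.2, Reachable.rfl⟩⟩ he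
      obtain ⟨hxA, hr⟩ := (hX x).1 hx
      obtain ⟨hyA, hyX⟩ := mem_sdiff.1 hy
      refine absurd ((hX y).2 ⟨hyA, hr.trans (Adj.reachable ?_)⟩) hyX
      exact hadj

theorem linked_singleton (x : V) : G.Linked {x} := by
  intro X hX hne h
  exact absurd ((subset_singleton_iff.1 hX).resolve_left hne.ne_empty) h

theorem Linked.insert {B : Finset V} (hB : G.Linked B) {x z : V} (hx : x ∈ B) (hxz : G.Adj x z) :
    G.Linked (insert z B) := by
  intro X hX hne h
  by_cases hzX : z ∈ X
  · by_cases hxX : x ∈ X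
    · have h₁ : X ∩ B ≠ B := by
        intro he
        refine h (hX.antisymm (insert_subset hzX ?_))
        exact inter_eq_right.1 he
      obtain ⟨a, ha, b, hb, hab⟩ := hB (X ∩ B) inter_subset_right ⟨x, mem_inter.2 ⟨hxX, hx⟩⟩ h₁
      refine ⟨a, (mem_inter.1 ha).1, b, ?_, hab⟩
      simp only [mem_sdiff, mem_inter, not_and, mem_insert] at hb ⊢
      exact ⟨Or.inr hb.1, fun hbX => hb.2 hbX hb.1⟩
    · exact ⟨z, hzX, x, mem_sdiff.2 ⟨mem_insert_of_mem hx, hxX⟩, hxz.symm⟩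
  · have hXB : X ⊆ B := fun a ha => (mem_insert.1 (hX ha)).resolve_left (by rintro rfl; exact hzX ha)
    by_cases he : X = B
    · exact ⟨x, he ▸ hx, z, mem_sdiff.2 ⟨mem_insert_self _ _, hzX⟩, hxz⟩
    · obtain ⟨a, ha, b, hb, hab⟩ := hB X hXB hne he
      obtain ⟨hb₁, hb₂⟩ := mem_sdiff.1 hb
      exact ⟨a, ha, b, mem_sdiff.2 ⟨mem_insert_of_mem hb₁, hb₂⟩, hab⟩

/-- A largest linked set between `B` and `A` is closed, as `Linked.insert` would enlarge it along
any edge that leaves it. -/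
theorem Linked.exists_closedIn {A B : Finset V} (hB : G.Linked B) (hBA : B ⊆ A) :
    ∃ B', B ⊆ B' ∧ B' ⊆ A ∧ G.Linked B' ∧ G.ClosedIn A B' := by
  obtain ⟨B', hB', hmax⟩ := exists_max_image (A.powerset.filter fun B' => B ⊆ B' ∧ G.Linked B')
    card ⟨B, by simp [hBA, hB]⟩
  simp only [mem_filter, mem_powerset] at hB' hmax
  refine ⟨B', hB'.2.1, hB'.1, hB'.2.2, fun x hx y hy hadj => ?_⟩
  obtain ⟨hyA, hyB⟩ := mem_sdiff.1 hy
  have := hmax (Insert.insert y B') ⟨insert_subset hyA hB'.1,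
    hB'.2.1.trans (subset_insert _ _), hB'.2.2.insert hx hadj⟩
  rw [card_insert_of_notMem hyB] at this
  omega

/-- `T` meets the neighbourhoods of all unions of components of `S`. -/
def Touches (G : SimpleGraph V) (S T : Finset V) : Prop :=
  ∀ X ⊆ S, X.Nonempty → X ≠ S → G.ClosedIn S X → ∃ t ∈ T, ∃ x ∈ X, G.Adj t x

/-- Since `S ∪ T` is linked, `T` itself touches every proper union of components of `S`. In a
minimal `T'` with this property, every `t` has a private union `X` of components that no other
element of `T'` touches. Choose a neighbour `x t` of `t` in `X`: the edges from `t` to `x t` form an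
induced matching, so there are at most `s` of them. -/
theorem exists_touches {s : ℕ} {S T : Finset V} (hl : G.Linked (S ∪ T)) (hT : G.Indep T)
    (hs : ¬G.HasMatching s (S ∪ T)) : ∃ T' ⊆ T, T'.card ≤ s ∧ G.Touches S T' := by
  have hTT : G.Touches S T := by
    intro X hXS hX hne hcl
    obtain ⟨x, hx, y, hy, hadj⟩ := hl X (hXS.trans subset_union_left) hX
      (fun he => hne (hXS.antisymm (he ▸ subset_union_left)))
    obtain ⟨hyST, hyX⟩ := mem_sdiff.1 hy
    refine ⟨y, (mem_union.1 hyST).resolve_left fun hyS => ?_, x, hx, hadj.symm⟩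
    exact hcl x hx y (mem_sdiff.2 ⟨hyS, hyX⟩) hadj
  obtain ⟨T', hT', hmin⟩ := exists_min_image (T.powerset.filter fun T' => G.Touches S T')
    card ⟨T, by simp [hTT]⟩
  simp only [mem_filter, mem_powerset] at hT' hmin
  refine ⟨T', hT'.1, ?_, hT'.2⟩
  have key : ∀ t ∈ T', ∃ x ∈ S, ∃ X ⊆ S, G.ClosedIn S X ∧ x ∈ X ∧ G.Adj t x ∧
      ∀ t' ∈ T', t' ≠ t → ∀ x ∈ X, ¬G.Adj t' x := by
    intro t ht
    have : ¬G.Touches S (T'.erase t) := by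
      intro h
      have := hmin (T'.erase t) ⟨(erase_subset _ _).trans hT'.1, h⟩
      rw [card_erase_of_mem ht] at this
      have := card_pos.2 ⟨t, ht⟩
      omega
    simp only [Touches, not_forall, not_exists, not_and] at this
    obtain ⟨X, hXS, hX, hne, hcl, hno⟩ := this
    obtain ⟨t', ht', x, hx, hadj⟩ := hT'.2 X hXS hX hne hcl
    have htt : t' = t := by
      by_contra htt
      exact hno t' (mem_erase.2 ⟨htt, ht'⟩) x hx hadj
    subst htt
    exact ⟨x, hXS hx, X, hXS, hcl, hx, hadj,
      fun t'' ht'' hne'' x hx => hno t'' (mem_erase.2 ⟨hne'', ht''⟩) x hx⟩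
  have key' : ∀ t, ∃ x, t ∈ T' → x ∈ S ∧ ∃ X ⊆ S, G.ClosedIn S X ∧ x ∈ X ∧ G.Adj t x ∧
      ∀ t' ∈ T', t' ≠ t → ∀ x ∈ X, ¬G.Adj t' x := fun t => by
    by_cases ht : t ∈ T'
    · obtain ⟨x, hx⟩ := key t ht
      exact ⟨x, fun _ => hx⟩
    · exact ⟨t, fun h => absurd h ht⟩
  choose x hx using key'
  have hm : G.HasMatching T'.card (S ∪ T) := by
    refine hasMatching_of_family x (fun t ht => ?_) fun t ht t' ht' hne => ?_
    · obtain ⟨h₁, X, -, -, -, h₂, -⟩ := hx t ht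
      exact ⟨mem_union_right _ (hT'.1 ht), mem_union_left _ h₁, h₂⟩
    · obtain ⟨h₁, X, hXS, hcl, hxX, hadj, hno⟩ := hx t ht
      obtain ⟨h₁', X', hXS', hcl', hxX', hadj', hno'⟩ := hx t' ht'
      refine ⟨hT t (hT'.1 ht) t' (hT'.1 ht'), hno' t ht hne _ hxX', fun h => ?_⟩
      by_cases hX : x t' ∈ X
      · exact hno t' ht' hne.symm _ hX hadj'
      · exact hcl _ hxX _ (mem_sdiff.2 ⟨h₁', hX⟩) h
  by_contra! hlt
  exact hs (hm.of_le hlt.le)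

/-- The set `B` is a component of `S ∪ T'`. As long as it is not everything, one more vertex of `T`
merges it with another component, and the larger component absorbs a further vertex of `T₂`. So the
number of elements of `T₂` outside `B` bounds the number of vertices to add. -/
theorem exists_linked_of_touches {S T T₂ : Finset V} (hl : G.Linked (S ∪ T)) (hT : G.Indep T)
    (ht : G.Touches S T₂) (m : ℕ) {T' B : Finset V} (h₂ : T₂ ⊆ T') (hT' : T' ⊆ T)
    (hBA : B ⊆ S ∪ T') (hBne : B.Nonempty) (hB : G.Linked B) (hcl : G.ClosedIn (S ∪ T') B)
    (hm : (T₂ \ B).card ≤ m) :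
    ∃ T'' ⊆ T, T''.card ≤ T'.card + m ∧ G.Linked (S ∪ T'') := by
  induction m using Nat.strong_induction_on generalizing T' B with
  | _ m ih =>
  by_cases hBe : B = S ∪ T'
  · exact ⟨T', hT', by omega, hBe ▸ hB⟩
  have hAS : S ∪ T' ⊆ S ∪ T := union_subset_union subset_rfl hT'
  let Y := T.filter fun y => ∃ b ∈ B, G.Adj b y
  have hY : ∀ y, y ∈ Y ↔ y ∈ T ∧ ∃ b ∈ B, G.Adj b y := fun y => by simp [Y]
  have hcl' : ∀ x ∈ B, ∀ y ∈ S ∪ T', G.Adj x y → y ∈ B := fun x hx y hy hadj => by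
    by_contra hyB
    exact hcl x hx y (mem_sdiff.2 ⟨hy, hyB⟩) hadj
  obtain ⟨z₀, hz₀⟩ : ((S ∪ T') \ B).Nonempty := sdiff_nonempty.2 fun h => hBe (hBA.antisymm h)
  obtain ⟨hz₀A, hz₀B⟩ := mem_sdiff.1 hz₀
  -- Every edge from `B` to the rest of `S ∪ T` ends in `Y`, so the edge that leaves `B ∪ Y` starts
  -- at some `y` in `Y`. As `T` is independent, it ends in `S`, outside `B`.
  obtain ⟨y, hy, z, hz, hyz⟩ := hl (B ∪ Y)
    (union_subset (hBA.trans hAS) ((filter_subset _ _).trans subset_union_right))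
    (hBne.mono subset_union_left) (by
      intro he
      have : z₀ ∈ B ∪ Y := he ▸ hAS hz₀A
      rcases mem_union.1 this with h | h
      · exact hz₀B h
      · obtain ⟨-, b, hb, hadj⟩ := (hY _).1 h
        exact hz₀B (hcl' b hb _ hz₀A hadj))
  obtain ⟨hzST, hzBY⟩ := mem_sdiff.1 hz
  have hzB : z ∉ B := fun h => hzBY (mem_union_left _ h)
  have hyB : y ∉ B := by
    intro hyB
    rcases mem_union.1 hzST with h | h
    · exact hzB (hcl' y hyB z (mem_union_left _ h) hyz)
    · exact hzBY (mem_union_right _ ((hY z).2 ⟨h, y, hyB, hyz⟩))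
  obtain ⟨hyT, b, hb, hby⟩ := (hY y).1 ((mem_union.1 hy).resolve_left hyB)
  have hzS : z ∈ S := (mem_union.1 hzST).resolve_right fun h => hT y hyT z h hyz
  have hyT' : y ∉ T' := fun h => hyB (hcl' b hb y (mem_union_right _ h) hby)
  have hbS : b ∈ S := (mem_union.1 (hBA hb)).resolve_right fun h => hT b (hT' h) y hyT hby
  have hAA : S ∪ T' ⊆ S ∪ Insert.insert y T' := union_subset_union subset_rfl (subset_insert _ _)
  obtain ⟨B', hBB', hB'A, hB', hclB'⟩ := ((hB.insert hb hby).insert (mem_insert_self y B)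
    hyz).exists_closedIn (A := S ∪ Insert.insert y T') (insert_subset (mem_union_left _ hzS)
      (insert_subset (mem_union_right _ (mem_insert_self _ _)) (hBA.trans hAA)))
  have hBsub : B ⊆ B' := fun a ha => hBB' (mem_insert_of_mem (mem_insert_of_mem ha))
  have hclB'' : ∀ x ∈ B', ∀ y' ∈ S ∪ Insert.insert y T', G.Adj x y' → y' ∈ B' :=
    fun x hx y' hy' hadj => by
      by_contra hyB'
      exact hclB' x hx y' (mem_sdiff.2 ⟨hy', hyB'⟩) hadj
  -- The newly reached part of `S` is a union of components of `S`. It contains `z` and omits `b`,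
  -- so some `t` in `T₂` touches it; this `t` lies in `B'` but not in `B`.
  obtain ⟨t, htT, x, hx, htx⟩ := ht ((S ∩ B') \ B) (sdiff_subset.trans inter_subset_left)
    ⟨z, mem_sdiff.2 ⟨mem_inter.2 ⟨hzS, hBB' (mem_insert_self _ _)⟩, hzB⟩⟩
    (fun he => by
      have hb' : b ∈ (S ∩ B') \ B := by rw [he]; exact hbS
      exact (mem_sdiff.1 hb').2 hb) (by
      intro a ha c hc hac
      simp only [mem_sdiff, mem_inter] at ha hc
      have hcB' : c ∈ B' := hclB'' a ha.1.2 c (mem_union_left _ hc.1) hac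
      have hcB : c ∈ B := by
        by_contra h
        exact hc.2 ⟨⟨hc.1, hcB'⟩, h⟩
      exact ha.2 (hcl' c hcB a (mem_union_left _ ha.1.1) hac.symm))
  simp only [mem_sdiff, mem_inter] at hx
  have htB' : t ∈ B' := hclB'' x hx.1.2 t
    (mem_union_right _ (mem_insert_of_mem (h₂ htT))) htx.symm
  have htB : t ∉ B := fun h => hx.2 (hcl' t h x (mem_union_left _ hx.1.1) htx)
  have hlt : (T₂ \ B').card < (T₂ \ B).card := card_lt_card <| by
    refine ⟨sdiff_subset_sdiff subset_rfl hBsub, fun h => ?_⟩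
    exact (mem_sdiff.1 (h (mem_sdiff.2 ⟨htT, htB⟩))).2 htB'
  obtain ⟨T'', hT'', hcard, hlink⟩ := ih (m - 1) (by omega)
    (h₂.trans (subset_insert _ _)) (insert_subset hyT hT') hB'A (hBne.mono hBsub) hB' hclB'
    (by omega)
  refine ⟨T'', hT'', ?_, hlink⟩
  rw [card_insert_of_notMem hyT'] at hcard
  omega

/-- In a connected graph without large induced matchings, boundedly many vertices of an independent
set suffice to connect the other vertices. -/
theorem exists_linked {s : ℕ} {S T : Finset V} (hl : G.Linked (S ∪ T)) (hT : G.Indep T)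
    (hs : ¬G.HasMatching s (S ∪ T)) :
    ∃ T' ⊆ T, T'.card ≤ 2 * s + 1 ∧ G.Linked (S ∪ T') ∧ ((S ∪ T).Nonempty → (S ∪ T').Nonempty) := by
  rcases S.eq_empty_or_nonempty with rfl | ⟨x₀, hx₀⟩
  · refine ⟨T, subset_rfl, ?_, hl, id⟩
    have : T.card ≤ 1 := by
      refine card_le_one.2 fun a ha b hb => ?_
      by_contra hab
      obtain ⟨x, hx, y, hy, hadj⟩ := hl {a} (by simpa using ha) ⟨a, by simp⟩ (by
        intro h
        have : b ∈ ({a} : Finset V) := h ▸ mem_union_right _ hb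
        exact hab (mem_singleton.1 this).symm)
      rw [mem_singleton] at hx
      subst hx
      simp only [empty_union] at hy
      exact hT x ha y (mem_sdiff.1 hy).1 hadj
    omega
  · obtain ⟨T₂, hT₂, hcard, ht⟩ := exists_touches hl hT hs
    obtain ⟨B, hxB, hBA, hB, hcl⟩ := (linked_singleton (G := G) x₀).exists_closedIn
      (A := S ∪ T₂) (singleton_subset_iff.2 (mem_union_left _ hx₀))
    -- At most `s` vertices touch all unions of components, and at most as many again are added to
    -- join the components.
    obtain ⟨T', hT', hc, hlink⟩ := exists_linked_of_touches hl hT ht T₂.card subset_rfl hT₂ hBA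
      ⟨x₀, hxB (mem_singleton_self _)⟩ hB hcl (card_le_card sdiff_subset)
    exact ⟨T', hT', by omega, hlink, fun _ => ⟨x₀, mem_union_left _ hx₀⟩⟩

end SimpleGraph

/-! ### Registers and loops of the algorithm -/

/-- The names of the relations that the algorithm uses, apart from its pointers. -/
inductive Reg
  | core | light | indep | sol | closed | cur | todo | round | rounds
  deriving DecidableEq

instance : Fintype Reg where
  elems := {.core, .light, .indep, .sol, .closed, .cur, .todo, .round, .rounds}
  complete x := by cases x <;> simp

/-- The names of the flags that the algorithm uses. -/
inductive AlgFlag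
  | loop | test | ok | found | neg
  deriving DecidableEq

instance : Fintype AlgFlag where
  elems := {.loop, .test, .ok, .found, .neg}
  complete x := by cases x <;> simp

/-- The relations of the algorithm: those with a name, and for every pointer the vertex to which it
points and the later vertices. -/
abbrev RelName (ι : Type) : Type := Reg ⊕ (ι × Bool)

namespace VState

variable {ι : Type} [DecidableEq ι] {n : ℕ}

/-- The states agree, except for the relations in a list. -/
def Agree (xs : List Reg) (h s : VState (RelName ι) AlgFlag n) : Prop :=
  s.fl = h.fl ∧ s.dig = h.dig ∧ (∀ i, s.rel (.inr i) = h.rel (.inr i)) ∧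
    ∀ x ∉ xs, s.rel (.inl x) = h.rel (.inl x)

end VState

section

variable {ι : Type} [DecidableEq ι]

/-- Conditions on the adjacency and on the relations at two vertices. -/
abbrev PairCond (ι : Type) : Type := Bool → (RelName ι → Bool) → (RelName ι → Bool) → Bool

/-- A condition that does not depend on the relations that control loops. -/
def PairCond.Steady (c : PairCond ι) : Prop :=
  ∀ a r r' u u', (∀ x, x ≠ .inl .cur → x ≠ .inl .todo → r x = u x) →
    (∀ x, x ≠ .inl .cur → x ≠ .inl .todo → r' x = u' x) → c a r r' = c a u u'

/-- Whether at least `t` vertices satisfy a condition together with `i`. -/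
def holdsAt {n : ℕ} (t : ℕ) (c : PairCond ι) (adj : Fin n → Fin n → Bool)
    (rel : RelName ι → Fin n → Bool) (i : Fin n) : Bool :=
  decide (t ≤ (Finset.univ.filter fun j => c (adj i j) (rel · i) (rel · j) = true).card)

omit [DecidableEq ι] in
theorem holdsAt_congr {n : ℕ} (t : ℕ) {c : PairCond ι} (hc : c.Steady) (adj : Fin n → Fin n → Bool)
    {rel rel' : RelName ι → Fin n → Bool}
    (h : ∀ x, x ≠ .inl .cur → x ≠ .inl .todo → rel x = rel' x) (i : Fin n) :
    holdsAt t c adj rel i = holdsAt t c adj rel' i := by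
  unfold holdsAt
  congr! 5 with j
  exact hc _ _ _ _ _ (fun x h₁ h₂ => congrFun (h x h₁ h₂) i) (fun x h₁ h₂ => congrFun (h x h₁ h₂) j)

omit [DecidableEq ι] in
theorem card_filter_eq_holdsAt {n : ℕ} (t : ℕ) (c : PairCond ι) (adj : Fin n → Fin n → Bool)
    (rel : RelName ι → Fin n → Bool) (i : Fin n) (hi : rel (.inl .cur) = fun j => decide (j = i)) :
    decide (t ≤ (Finset.univ.filter fun p : Fin n × Fin n =>
      (rel (.inl .cur) p.1 && c (adj p.1 p.2) (rel · p.1) (rel · p.2)) = true).card) =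
      holdsAt t c adj rel i := by
  unfold holdsAt
  congr 2
  rw [hi]
  refine Finset.card_bij' (fun p _ => p.2) (fun j _ => (i, j)) ?_ ?_ ?_ ?_
  · rintro ⟨a, b⟩ h
    simp only [Finset.mem_filter, Finset.mem_univ, true_and, Bool.and_eq_true,
      decide_eq_true_eq] at h ⊢
    obtain ⟨rfl, h⟩ := h
    exact h
  · intro j h
    simpa using h
  · rintro ⟨a, b⟩ h
    simp only [Finset.mem_filter, Finset.mem_univ, true_and, Bool.and_eq_true,
      decide_eq_true_eq] at h
    simp [h.1]
  · intro j _
    rfl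

/-! ### Greedy scans through the vertices -/

/-- The body of `scan`. -/
def scanBody (B : Reg) (t : ℕ) (neg : Bool) (c : PairCond ι) : VFun (RelName ι) AlgFlag :=
  fun n adj h =>
    let h₁ := h.setFl .test (decide (t ≤ (Finset.univ.filter fun p : Fin n × Fin n =>
      (h.rel (.inl .cur) p.1 && c (adj p.1 p.2) (h.rel · p.1) (h.rel · p.2)) = true).card))
    (if xor (h₁.fl .test) neg then
      h₁.setRel (.inl B) fun j => h₁.rel (.inl B) j || h₁.rel (.inl .cur) j else h₁).setFl .test false

/-- Go through all vertices, and add those to `B` that satisfy the condition. -/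
def scan (B : Reg) (t : ℕ) (neg : Bool) (c : PairCond ι) : VFun (RelName ι) AlgFlag :=
  forEach .loop (.inl .cur) (.inl .todo) (scanBody B t neg c)

theorem scanBody_rel {B : Reg} {t : ℕ} {neg : Bool} {c : PairCond ι} {n : ℕ}
    {adj : Fin n → Fin n → Bool} (h : VState (RelName ι) AlgFlag n) {x : RelName ι} (hx : x ≠ .inl B) :
    (scanBody B t neg c n adj h).rel x = h.rel x := by
  unfold scanBody
  dsimp only
  split
  · simp [hx]
  · rfl

theorem forEach_rel {X Fl : Type} [DecidableEq X] [DecidableEq Fl] {lp : Fl} {p D x : X}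
    {F : VFun X Fl} {n : ℕ} {adj : Fin n → Fin n → Bool} (h : VState X Fl n)
    (hF : ∀ h, (F n adj h).rel x = h.rel x) (hp : x ≠ p) (hD : x ≠ D) :
    (forEach lp p D F n adj h).rel x = h.rel x := by
  refine forEach_induction (fun _ s => s.rel x = h.rel x) (by simp [hD]) fun i s hs => ?_
  simp [hF, hp, hD, hs]

theorem forEachOption_rel {X Fl : Type} [DecidableEq X] [DecidableEq Fl] {lp : Fl} {p D x : X}
    {F : VFun X Fl} {n : ℕ} {adj : Fin n → Fin n → Bool} (h : VState X Fl n)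
    (hF : ∀ h, (F n adj h).rel x = h.rel x) (hp : x ≠ p) (hD : x ≠ D) :
    (forEachOption lp p D F n adj h).rel x = h.rel x := by
  unfold forEachOption
  rw [forEach_rel _ hF hp hD, hF]
  simp [hp, hD]

theorem Realizable.id {X Fl : Type} [Fintype Fl] [DecidableEq Fl] :
    Realizable (X := X) (Fl := Fl) fun _ _ h => h :=
  Realizable.mapFl _root_.id

theorem Realizable.scanBody (B : Reg) (t : ℕ) (neg : Bool) (c : PairCond ι) :
    Realizable (_root_.scanBody B t neg c) := by
  have h₁ : Realizable fun n adj (h : VState (RelName ι) AlgFlag n) =>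
      h.setFl .test (decide (t ≤ (Finset.univ.filter fun p : Fin n × Fin n =>
        (h.rel (.inl .cur) p.1 && c (adj p.1 p.2) (h.rel · p.1) (h.rel · p.2)) = true).card)) :=
    Realizable.count AlgFlag.test t fun _ a r r' => r (.inl .cur) && c a r r'
  have h₂ : Realizable fun n adj (h : VState (RelName ι) AlgFlag n) => if xor (h.fl .test) neg then
      h.setRel (.inl B) fun j => h.rel (.inl B) j || h.rel (.inl .cur) j else h :=
    (Realizable.setRel (X := RelName ι) (Fl := AlgFlag) (.inl B)
      fun r => r (.inl B) || r (.inl .cur)).ite (fun q : AlgFlag → Bool => xor (q .test) neg) Realizable.id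
  have h₃ : Realizable fun n adj (h : VState (RelName ι) AlgFlag n) => h.setFl .test false :=
    Realizable.setFl AlgFlag.test fun _ => false
  exact (h₁.comp h₂).comp h₃

theorem Realizable.scan {B : Reg} (t : ℕ) (neg : Bool) (c : PairCond ι) (hB : B ≠ .todo) :
    Realizable (_root_.scan B t neg c) :=
  Realizable.forEach _ _ _ (by simp) (Realizable.scanBody B t neg c)
    fun _ _ h => scanBody_rel h (by simpa using hB.symm)

/-- The value of `B` when a scan reaches the vertex `i`. -/
def stage {n : ℕ} (B₀ B : Fin n → Bool) (i : Fin n) : Fin n → Bool :=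
  fun j => B₀ j || (decide (j < i) && B j)

/-- When the loop reaches `i`, the relation `B` holds its old elements and the new ones before `i`;
in terms of the final value this is `stage`. So the final value satisfies a recursion along the
vertex order, as a greedy construction does. -/
theorem scan_spec {B : Reg} {t : ℕ} {neg : Bool} {c : PairCond ι} (hc : c.Steady) {n : ℕ}
    {adj : Fin n → Fin n → Bool} {h : VState (RelName ι) AlgFlag n} (hl : h.fl .loop = false)
    (ht : h.fl .test = false) (hB₁ : B ≠ .cur) (hB₂ : B ≠ .todo) :
    VState.Agree [B, .cur, .todo] h (scan B t neg c n adj h) ∧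
      ∀ i, (scan B t neg c n adj h).rel (.inl B) i = (h.rel (.inl B) i ||
        xor (holdsAt t c adj (Function.update h.rel (.inl B)
          (stage (h.rel (.inl B)) ((scan B t neg c n adj h).rel (.inl B)) i)) i) neg) := by
  have := forEach_induction (lp := AlgFlag.loop) (p := .inl .cur) (D := .inl .todo)
    (F := scanBody B t neg c) (n := n) (adj := adj) (h := h)
    (fun k s => VState.Agree [B, .cur, .todo] h s ∧
      (∀ i : Fin n, i.val < k → s.rel (.inl B) i = (h.rel (.inl B) i ||
        xor (holdsAt t c adj (Function.update h.rel (.inl B)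
          (stage (h.rel (.inl B)) (s.rel (.inl B)) i)) i) neg)) ∧
      ∀ i : Fin n, k ≤ i.val → s.rel (.inl B) i = h.rel (.inl B) i) ?_ ?_
  · exact ⟨this.1, fun i => this.2.1 i i.2⟩
  · refine ⟨⟨?_, rfl, ?_, ?_⟩, by simp, ?_⟩
    · rw [VState.fl_setRel, VState.setFl_eq_self _ _ _ hl]
    · simp
    · intro x hx
      simp only [List.mem_cons, not_or] at hx
      simp [hx]
    · simp [hB₂]
  · rintro i s ⟨⟨hfl, hdig, hr, hx⟩, h₁, h₂⟩
    let s₁ := (s.setRel (.inl .cur) fun j => decide (j = i)).setRel (.inl .todo) fun j => decide (i < j)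
    have hs₁B : s₁.rel (.inl B) = s.rel (.inl B) := by simp [s₁, hB₁, hB₂]
    have hcur : s₁.rel (.inl .cur) = fun j => decide (j = i) := by simp [s₁]
    have hupd : ∀ x, x ≠ .inl .cur → x ≠ .inl .todo →
        s₁.rel x = Function.update h.rel (.inl B) (s.rel (.inl B)) x := by
      intro x hx₁ hx₂
      by_cases hxB : x = .inl B
      · subst hxB; simp [hs₁B]
      · rcases x with x | x
        · simp only [ne_eq, Sum.inl.injEq] at hx₁ hx₂ hxB
          simp [s₁, hx₁, hx₂, hxB, hx x (by simp [hx₁, hx₂, hxB])]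
        · simp [s₁, hr]
    let v := holdsAt t c adj (Function.update h.rel (.inl B) (s.rel (.inl B))) i
    have hv : decide (t ≤ (Finset.univ.filter fun p : Fin n × Fin n =>
        (s₁.rel (.inl .cur) p.1 && c (adj p.1 p.2) (s₁.rel · p.1) (s₁.rel · p.2)) = true).card) =
          v := by
      rw [card_filter_eq_holdsAt t c adj _ i hcur, holdsAt_congr t hc adj hupd]
    change VState.Agree _ h ((scanBody B t neg c n adj s₁).setFl .loop false) ∧ _
    have hb : (scanBody B t neg c n adj s₁).setFl .loop false =
        if xor v neg then (s₁.setRel (.inl B) fun j => s.rel (.inl B) j || decide (j = i)) else s₁ := by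
      have e₁ : s₁.fl .loop = false := (congrFun hfl _).trans hl
      have e₂ : s₁.fl .test = false := (congrFun hfl _).trans ht
      unfold scanBody
      dsimp only
      rw [hv]
      simp only [VState.fl_setFl, Function.update_self, VState.rel_setFl, hs₁B, hcur]
      split
      · ext x
        · by_cases hx : x = .loop
          · subst hx; simp [e₁]
          · by_cases hx' : x = .test
            · subst hx'; simp [e₂]
            · simp [hx, hx']
        · rfl
        · rfl
      · rw [VState.setFl_setFl, VState.setFl_eq_self _ _ _ e₂, VState.setFl_eq_self _ _ _ e₁]
    have hBi : ∀ j, ((scanBody B t neg c n adj s₁).setFl .loop false).rel (.inl B) j =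
        (s.rel (.inl B) j || (decide (j = i) && xor v neg)) := by
      intro j
      rw [hb]
      split
      · rename_i hx
        simp [hx]
      · rename_i hx
        rw [Bool.not_eq_true] at hx
        simp [hx, hs₁B]
    have hle : ∀ j, h.rel (.inl B) j = true → s.rel (.inl B) j = true := by
      intro j hj
      rcases lt_or_ge j.val i.val with hji | hji
      · rw [h₁ j hji, hj]; rfl
      · rw [h₂ j hji, hj]
    refine ⟨⟨?_, ?_, ?_, ?_⟩, ?_, ?_⟩
    · rw [hb]; split <;> exact hfl
    · rw [hb]; split <;> exact hdig
    · intro j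
      rw [hb]; split <;> simp [s₁, hr]
    · intro x hx'
      have hx'' := hx'
      simp only [List.mem_cons, not_or] at hx''
      rw [hb]; split <;> simp [s₁, hx'', hx x hx']
    · intro j hj
      have hst : stage (h.rel (.inl B)) (((scanBody B t neg c n adj s₁).setFl .loop false).rel (.inl B)) j
          = stage (h.rel (.inl B)) (s.rel (.inl B)) j := by
        funext k
        unfold stage
        by_cases hkj : k < j
        · have : k ≠ i := by
            rintro rfl
            have := Fin.lt_def.1 hkj
            omega
          rw [hBi]
          simp [this]
        · simp [hkj]
      rw [hst, hBi]
      rcases Nat.lt_succ_iff_lt_or_eq.1 hj with hji | hji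
      · have : j ≠ i := by rintro rfl; omega
        rw [h₁ j hji]
        simp [this]
      · obtain rfl : j = i := Fin.ext hji
        have hsj : stage (h.rel (.inl B)) (s.rel (.inl B)) j = s.rel (.inl B) := by
          funext k
          unfold stage
          rcases lt_or_ge k.val j.val with hkj | hkj
          · have := hle k
            rw [show decide (k < j) = true from decide_eq_true hkj]
            revert this
            cases h.rel (.inl B) k <;> cases s.rel (.inl B) k <;> simp
          · rw [h₂ k hkj, show decide (k < j) = false from decide_eq_false (by simpa using hkj)]
            simp
        rw [hsj, h₂ j le_rfl]
        simp [v]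
    · intro j hj
      have : j ≠ i := by rintro rfl; omega
      rw [hBi, h₂ j (by omega)]
      simp [this]

/-! ### Closure under a condition -/

/-- Repeat a scan as often as there are vertices. -/
def saturate (B : Reg) (t : ℕ) (neg : Bool) (c : PairCond ι) : VFun (RelName ι) AlgFlag :=
  forEach .loop (.inl .round) (.inl .rounds) (scan B t neg c)

theorem scan_rel {B : Reg} {t : ℕ} {neg : Bool} {c : PairCond ι} {n : ℕ}
    {adj : Fin n → Fin n → Bool} (h : VState (RelName ι) AlgFlag n) {x : RelName ι} (hx : x ≠ .inl B)
    (hx₁ : x ≠ .inl .cur) (hx₂ : x ≠ .inl .todo) : (scan B t neg c n adj h).rel x = h.rel x :=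
  forEach_rel h (fun h => scanBody_rel h hx) hx₁ hx₂

theorem Realizable.saturate {B : Reg} (t : ℕ) (neg : Bool) (c : PairCond ι) (hB : B ≠ .todo)
    (hB' : B ≠ .rounds) : Realizable (_root_.saturate B t neg c) :=
  Realizable.forEach _ _ _ (by simp) (Realizable.scan t neg c hB)
    fun _ _ h => scan_rel h (by simpa using hB'.symm) (by simp) (by simp)

/-- A condition that does not depend on any of the relations that control loops. -/
def PairCond.Constant (c : PairCond ι) : Prop :=
  ∀ a r r' u u', (∀ x, x ≠ .inl .cur → x ≠ .inl .todo → x ≠ .inl .round → x ≠ .inl .rounds →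
    r x = u x) → (∀ x, x ≠ .inl .cur → x ≠ .inl .todo → x ≠ .inl .round → x ≠ .inl .rounds →
    r' x = u' x) → c a r r' = c a u u'

omit [DecidableEq ι] in
theorem PairCond.Constant.steady {c : PairCond ι} (hc : c.Constant) : c.Steady :=
  fun a r r' u u' h h' => hc a r r' u u' (fun x h₁ h₂ _ _ => h x h₁ h₂) fun x h₁ h₂ _ _ => h' x h₁ h₂

/-- The predicate `K r i` says that `i` may be added when `B` equals `r`. A scan that changes
nothing shows that `B` is closed under `K`, and a scan that adds a vertex cannot occur more than `n`
times. The last clause is an induction principle: `B` arises by adding single vertices, each of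
which satisfies `K` at its time. -/
theorem saturate_spec {B : Reg} {t : ℕ} {neg : Bool} {c : PairCond ι} (hc : c.Constant) {n : ℕ}
    {adj : Fin n → Fin n → Bool} {h : VState (RelName ι) AlgFlag n} (hl : h.fl .loop = false)
    (ht : h.fl .test = false) (hB₁ : B ≠ .cur) (hB₂ : B ≠ .todo) (hB₃ : B ≠ .round)
    (hB₄ : B ≠ .rounds) (K : (Fin n → Bool) → Fin n → Prop)
    (hK : ∀ r i, K r i ↔ xor (holdsAt t c adj (Function.update h.rel (.inl B) r) i) neg = true) :
    VState.Agree [B, .cur, .todo, .round, .rounds] h (saturate B t neg c n adj h) ∧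
    (∀ i, h.rel (.inl B) i = true → (saturate B t neg c n adj h).rel (.inl B) i = true) ∧
    (∀ i, K ((saturate B t neg c n adj h).rel (.inl B)) i →
      (saturate B t neg c n adj h).rel (.inl B) i = true) ∧
    ∀ P : (Fin n → Bool) → Prop, P (h.rel (.inl B)) →
      (∀ r i, P r → K r i → P fun j => r j || decide (j = i)) →
        P ((saturate B t neg c n adj h).rel (.inl B)) := by
  let Cl : (Fin n → Bool) → Prop := fun r => ∀ i, K r i → r i = true
  let crd : (Fin n → Bool) → ℕ := fun r => (Finset.univ.filter fun i => r i = true).card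
  have := forEach_induction (lp := AlgFlag.loop) (p := .inl .round) (D := .inl .rounds)
    (F := scan B t neg c) (n := n) (adj := adj) (h := h)
    (fun k s => VState.Agree [B, .cur, .todo, .round, .rounds] h s ∧
      (∀ i, h.rel (.inl B) i = true → s.rel (.inl B) i = true) ∧
      -- After `k` rounds, `B` is closed or has at least `k` elements; with `n` elements it is
      -- closed trivially.
      (Cl (s.rel (.inl B)) ∨ k ≤ crd (s.rel (.inl B))) ∧
      ∀ P : (Fin n → Bool) → Prop, P (h.rel (.inl B)) →
        (∀ r i, P r → K r i → P fun j => r j || decide (j = i)) → P (s.rel (.inl B))) ?_ ?_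
  · obtain ⟨h₁, h₂, h₃, h₄⟩ := this
    refine ⟨h₁, h₂, ?_, h₄⟩
    rcases h₃ with h₃ | h₃
    · exact h₃
    · intro i _
      have : (Finset.univ.filter fun i => (saturate B t neg c n adj h).rel (.inl B) i = true) =
          Finset.univ := by
        rw [← Finset.card_eq_iff_eq_univ, Fintype.card_fin]
        refine le_antisymm ?_ h₃
        simpa using Finset.card_le_univ (Finset.univ.filter fun i =>
          (saturate B t neg c n adj h).rel (.inl B) i = true)
      simpa using (Finset.ext_iff.1 this i)
  · refine ⟨⟨?_, rfl, ?_, ?_⟩, ?_, Or.inr (Nat.zero_le _), ?_⟩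
    · rw [VState.fl_setRel, VState.setFl_eq_self _ _ _ hl]
    · simp
    · intro x hx
      simp only [List.mem_cons, not_or] at hx
      simp [hx]
    · simp [hB₄]
    · simp only [VState.rel_setRel, VState.rel_setFl]
      rw [Function.update_of_ne (by simpa using hB₄)]
      exact fun P hP _ => hP
  · rintro i s ⟨⟨hfl, hdig, hr, hx⟩, h₁, h₂, h₃⟩
    let s₁ := (s.setRel (.inl .round) fun j => decide (j = i)).setRel (.inl .rounds)
      fun j => decide (i < j)
    have hs₁B : s₁.rel (.inl B) = s.rel (.inl B) := by simp [s₁, hB₃, hB₄]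
    obtain ⟨⟨hfl', hdig', hr', hx'⟩, hsp⟩ := scan_spec (t := t) (neg := neg) hc.steady (adj := adj)
      (h := s₁) ((congrFun hfl _).trans hl) ((congrFun hfl _).trans ht) hB₁ hB₂
    have hset : (scan B t neg c n adj s₁).setFl .loop false = scan B t neg c n adj s₁ :=
      VState.setFl_eq_self _ _ _ (((congrFun hfl' _).trans (congrFun hfl _)).trans hl)
    change VState.Agree _ h ((scan B t neg c n adj s₁).setFl .loop false) ∧ _
    rw [hset]
    let B₀ := s.rel (.inl B)
    let B₁ := (scan B t neg c n adj s₁).rel (.inl B)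
    have hstep : ∀ j, B₁ j = true ↔ B₀ j = true ∨ K (stage B₀ B₁ j) j := by
      intro j
      have e : ∀ r, holdsAt t c adj (Function.update s₁.rel (.inl B) r) j =
          holdsAt t c adj (Function.update h.rel (.inl B) r) j := by
        intro r
        unfold holdsAt
        have hu : ∀ x, x ≠ .inl .cur → x ≠ .inl .todo → x ≠ .inl .round → x ≠ .inl .rounds →
            Function.update s₁.rel (.inl B) r x = Function.update h.rel (.inl B) r x := by
          intro x hx₁ hx₂ hx₃ hx₄
          by_cases hxB : x = .inl B
          · subst hxB; simp
          · rcases x with x | x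
            · simp only [ne_eq, Sum.inl.injEq] at hx₁ hx₂ hx₃ hx₄ hxB
              simp [s₁, hx₃, hx₄, hxB, hx x (by simp [hx₁, hx₂, hx₃, hx₄, hxB])]
            · simp [s₁, hr]
        congr! 5 with k
        exact hc _ _ _ _ _ (fun x a b c d => congrFun (hu x a b c d) j)
          (fun x a b c d => congrFun (hu x a b c d) k)
      rw [hK, ← e, ← Bool.or_eq_true]
      have := hsp j
      rw [hs₁B] at this
      rw [show B₁ j = _ from this]
    -- The values of `B` during one scan, which differ by at most one vertex from each to the next.
    have hst : ∀ k ≤ n, ∀ P : (Fin n → Bool) → Prop, P B₀ →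
        (∀ r i, P r → K r i → P fun j => r j || decide (j = i)) →
        P fun j => B₀ j || (decide (j.val < k) && B₁ j) := by
      intro k hk P hP hPK
      induction k with
      | zero => simpa using hP
      | succ k ih =>
        have ih := ih (by omega)
        let i : Fin n := ⟨k, by omega⟩
        have hi := hstep i
        by_cases hBi : B₁ i = B₀ i
        · convert ih using 2 with j
          by_cases hj : j = i
          · rw [hj, hBi]
            cases B₀ i <;> simp
          · have : j.val < k + 1 ↔ j.val < k := by
              have : j.val ≠ k := fun h => hj (Fin.ext h)
              omega
            simp [this]
        · have hKi : K (stage B₀ B₁ i) i := by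
            rcases h₀ : B₀ i with _ | _
            · have : B₁ i = true := by
                rcases h₁ : B₁ i with _ | _
                · exact absurd (h₁.trans h₀.symm) hBi
                · rfl
              exact (hi.1 this).resolve_left (by simp [h₀])
            · exact absurd ((hi.2 (Or.inl h₀)).trans h₀.symm) hBi
          have := hPK _ i ih hKi
          convert this using 2 with j
          by_cases hj : j = i
          · subst hj
            have : B₁ i = true := hi.2 (Or.inr hKi)
            simp [this, i]
          · have : j.val < k + 1 ↔ j.val < k := by
              have : j.val ≠ k := fun h => hj (Fin.ext h)
              omega
            simp [this, hj]
    have hle : ∀ j, B₀ j = true → B₁ j = true := fun j hj => (hstep j).2 (Or.inl hj)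
    have hB₁eq : (fun j : Fin n => B₀ j || (decide (j.val < n) && B₁ j)) = B₁ := by
      funext j
      have := hle j
      cases h₀ : B₀ j <;> simp_all
    have hcl : Cl B₀ → B₁ = B₀ := by
      intro hcl
      have : ∀ k (j : Fin n), j.val = k → B₁ j = B₀ j := by
        intro k
        induction k using Nat.strong_induction_on with
        | _ k ih =>
        rintro j rfl
        have hst : stage B₀ B₁ j = B₀ := by
          funext l
          unfold stage
          by_cases hl : l < j
          · rw [ih l.val hl l rfl]; simp
          · simp [hl]
        have := hstep j
        rw [hst] at this
        rw [Bool.eq_iff_iff, this]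
        exact ⟨fun h => h.elim id (hcl j), Or.inl⟩
      funext j
      exact this _ j rfl
    refine ⟨⟨hfl'.trans hfl, hdig'.trans hdig, fun j => ?_, fun x hxx => ?_⟩,
      fun j hj => hle j (h₁ j hj), ?_, fun P hP hPK => ?_⟩
    · rw [hr']
      simp [s₁, hr]
    · have hxx' := hxx
      simp only [List.mem_cons, not_or] at hxx'
      rw [hx' x (by simp [hxx'])]
      simp [s₁, hxx', hx x hxx]
    · change Cl B₁ ∨ _ ≤ crd B₁
      by_cases he : B₁ = B₀
      · left
        intro j hj
        have hst : stage B₀ B₁ j = B₁ := by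
          funext l
          unfold stage
          rw [he]
          cases B₀ l <;> simp
        exact (hstep j).2 (Or.inr (by rw [hst]; exact hj))
      · right
        rcases h₂ with h₂ | h₂
        · exact absurd (hcl h₂) he
        · refine Nat.succ_le_of_lt (lt_of_le_of_lt h₂ (Finset.card_lt_card ?_))
          refine ⟨fun j => by simpa using hle j, fun hsub => he ?_⟩
          funext j
          rw [Bool.eq_iff_iff]
          refine ⟨fun hj => ?_, hle j⟩
          have := hsub (show j ∈ _ by simpa using hj)
          simpa using this
    · have := hst n le_rfl P (h₃ P hP hPK) hPK
      rw [hB₁eq] at this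
      exact this

/-! ### Comparison of the size of a set with a binary number -/

/-- The value of a binary number, given by its digits, the least significant one first. -/
def digitsValue : List Bool → ℕ
  | [] => 0
  | d :: l => d.toNat + 2 * digitsValue l

theorem digitsValue_eq_zero (l : List Bool) : digitsValue l = 0 ↔ l.any id = false := by
  induction l with
  | nil => simp [digitsValue]
  | cons d l ih => cases d <;> simp [digitsValue, ih]

theorem digitsValue_decrementDigits (l : List (Bool × Bool)) (h : (l.any fun d => d.2) = true) :
    digitsValue ((decrementDigits l).map Prod.snd) + 1 = digitsValue (l.map Prod.snd) := by
  -- Once the borrow is paid, the remaining digits are copied.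
  have hf : ∀ l : List (Bool × Bool), (transduce (fun (borrow : Bool) (d : Bool × Bool) =>
      (borrow && !d.2, (d.1, xor d.2 borrow))) false l).2 = l := by
    intro l
    induction l with
    | nil => rfl
    | cons d l ih => simp [transduce, ih]
  induction l with
  | nil => simp at h
  | cons d l ih =>
    obtain ⟨a, b⟩ := d
    cases b
    · have ih := ih (by simpa using h)
      simp only [decrementDigits, transduce, Bool.true_and, Bool.not_false] at ih ⊢
      simp only [List.map_cons, digitsValue] at ih ⊢
      simp
      omega
    · simp [decrementDigits, transduce, hf, digitsValue]
      omega

theorem map_fst_decrementDigits (l : List (Bool × Bool)) :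
    (decrementDigits l).map Prod.fst = l.map Prod.fst := by
  have : ∀ b (l : List (Bool × Bool)), (transduce (fun (borrow : Bool) (d : Bool × Bool) =>
      (borrow && !d.2, (d.1, xor d.2 borrow))) b l).2.map Prod.fst = l.map Prod.fst := by
    intro b l
    induction l generalizing b with
    | nil => rfl
    | cons d l ih => simp [transduce, ih]
  exact this true l

/-- The body of `countDown`. -/
def countDownBody (B : Reg) : VFun (RelName ι) AlgFlag := fun n _ h =>
  let h₁ := h.setFl .test (decide (1 ≤ (Finset.univ.filter fun p : Fin n × Fin n =>
    (h.rel (.inl .cur) p.1 && h.rel (.inl B) p.1) = true).card))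
  (if h₁.fl .test then
    let h₂ := h₁.setFl .test (h₁.dig.any fun d => d.2)
    if h₂.fl .test then { h₂ with dig := decrementDigits h₂.dig } else h₂.setFl .ok false
  else h₁).setFl .test false

/-- Clear the flag `ok` if `B` has more elements than the initial value of the counter. -/
def countDown (B : Reg) : VFun (RelName ι) AlgFlag := fun n adj h =>
  forEach .loop (.inl .cur) (.inl .todo) (countDownBody B) n adj
    { h with dig := h.dig.map fun d => (d.1, d.1) }

omit [DecidableEq ι] in
theorem countDownBody_rel {B : Reg} {n : ℕ} {adj : Fin n → Fin n → Bool}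
    (h : VState (RelName ι) AlgFlag n) : (countDownBody B n adj h).rel = h.rel := by
  unfold countDownBody
  dsimp only
  split
  · split <;> rfl
  · rfl

omit [DecidableEq ι] in
theorem countDownBody_eq {B : Reg} {n : ℕ} {adj : Fin n → Fin n → Bool} {i : Fin n}
    (h : VState (RelName ι) AlgFlag n) (ht : h.fl .test = false)
    (hi : h.rel (.inl .cur) = fun j => decide (j = i)) : countDownBody B n adj h =
      if h.rel (.inl B) i then
        if h.dig.any fun d => d.2 then { h with dig := decrementDigits h.dig }
        else h.setFl .ok false
      else h := by
  have hv : decide (1 ≤ (Finset.univ.filter fun p : Fin n × Fin n =>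
      (h.rel (.inl .cur) p.1 && h.rel (.inl B) p.1) = true).card) = h.rel (.inl B) i := by
    rw [hi]
    rcases hB : h.rel (.inl B) i with _ | _
    · rw [decide_eq_false_iff_not, Nat.one_le_iff_ne_zero, not_not, Finset.card_eq_zero,
        Finset.filter_eq_empty_iff]
      rintro ⟨a, b⟩ _
      simp only [Bool.and_eq_true, decide_eq_true_eq, not_and]
      rintro rfl
      simp [hB]
    · rw [decide_eq_true_eq, Nat.one_le_iff_ne_zero, Finset.card_ne_zero]
      exact ⟨(i, i), by simp [hB]⟩
  unfold countDownBody
  dsimp only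
  rw [hv]
  rcases h.rel (.inl B) i with _ | _
  · rw [VState.setFl_eq_self h _ _ ht]
    simp [ht, VState.setFl_eq_self _ _ _ ht]
  · simp only [VState.fl_setFl, Function.update_self, if_true, VState.dig_setFl]
    rcases h.dig.any fun d => d.2 with _ | _
    · simp only [Bool.false_eq_true, if_false]
      ext x
      · by_cases hx : x = .test
        · subst hx; simp [ht]
        · by_cases hx' : x = .ok
          · subst hx'; simp
          · simp [hx, hx']
      · rfl
      · rfl
    · simp only [if_true]
      ext x
      · by_cases hx : x = .test
        · subst hx; simp [ht]
        · simp [hx]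
      · rfl
      · rfl

/-- While the number of elements met so far is at most the initial value, the counter holds the
difference. The first element in excess meets the counter at zero and clears `ok`. This works for
parameters of any size, without writing the size of `B` in binary. -/
theorem countDown_spec {B : Reg} {n : ℕ} {adj : Fin n → Fin n → Bool}
    {h : VState (RelName ι) AlgFlag n} (hl : h.fl .loop = false) (ht : h.fl .test = false)
    (hB₁ : B ≠ .cur) (hB₂ : B ≠ .todo) :
    (countDown B n adj h).fl = Function.update h.fl .ok (h.fl .ok &&
      decide ((Finset.univ.filter fun i => h.rel (.inl B) i = true).card ≤
        digitsValue (h.dig.map Prod.fst))) ∧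
    (countDown B n adj h).dig.map Prod.fst = h.dig.map Prod.fst ∧
    ∀ x, x ≠ .inl .cur → x ≠ .inl .todo → (countDown B n adj h).rel x = h.rel x := by
  let K := digitsValue (h.dig.map Prod.fst)
  let crd : ℕ → ℕ := fun k => (Finset.univ.filter fun i : Fin n =>
    i.val < k ∧ h.rel (.inl B) i = true).card
  have hcrd : ∀ i : Fin n, crd (i + 1) = crd i + (h.rel (.inl B) i).toNat := by
    intro i
    rcases hi : h.rel (.inl B) i with _ | _
    · refine congrArg Finset.card (Finset.filter_congr fun j _ => ?_)
      refine and_congr_left fun hj => ?_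
      have : j ≠ i := by rintro rfl; simp [hi] at hj
      have : j.val ≠ i.val := fun h => this (Fin.ext h)
      omega
    · have : (Finset.univ.filter fun j : Fin n => j.val < i.val + 1 ∧ h.rel (.inl B) j = true) =
          insert i (Finset.univ.filter fun j : Fin n => j.val < i.val ∧ h.rel (.inl B) j = true) := by
        ext j
        simp only [Finset.mem_filter, Finset.mem_univ, true_and, Finset.mem_insert, Fin.ext_iff]
        constructor
        · rintro ⟨h₁, h₂⟩
          rcases Nat.lt_succ_iff_lt_or_eq.1 h₁ with h | h
          · exact Or.inr ⟨h, h₂⟩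
          · exact Or.inl h
        · rintro (h' | ⟨h₁, h₂⟩)
          · obtain rfl : j = i := Fin.ext h'
            exact ⟨by omega, hi⟩
          · exact ⟨by omega, h₂⟩
      simp only [crd, this]
      rw [Finset.card_insert_of_notMem (by simp)]
      rfl
  have := forEach_induction (lp := AlgFlag.loop) (p := .inl .cur) (D := .inl .todo)
    (F := countDownBody B) (n := n) (adj := adj) (h := { h with dig := h.dig.map fun d => (d.1, d.1) })
    (fun k s => s.fl = Function.update h.fl .ok (h.fl .ok && decide (crd k ≤ K)) ∧
      s.dig.map Prod.fst = h.dig.map Prod.fst ∧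
      (∀ x, x ≠ .inl .cur → x ≠ .inl .todo → s.rel x = h.rel x) ∧
      (crd k ≤ K → digitsValue (s.dig.map Prod.snd) + crd k = K)) ?_ ?_
  · refine ⟨?_, this.2.1, this.2.2.1⟩
    have e : crd n = (Finset.univ.filter fun i => h.rel (.inl B) i = true).card :=
      congrArg Finset.card (Finset.filter_congr fun j _ => by simp [j.2])
    rw [← e]
    exact this.1
  · have e : crd 0 = 0 := by simp [crd]
    refine ⟨?_, ?_, ?_, fun _ => ?_⟩
    · rw [e]
      funext x
      by_cases hx : x = .ok
      · subst hx; simp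
      · by_cases hx' : x = .loop
        · subst hx'; simp [hl]
        · simp [hx, hx']
    · simp [Function.comp_def]
    · intro x hx₁ hx₂
      simp [hx₂]
    · rw [e]
      simp [Function.comp_def, K]
  · rintro i s ⟨hfl, hdig, hr, hv⟩
    let s₁ := (s.setRel (.inl .cur) fun j => decide (j = i)).setRel (.inl .todo) fun j => decide (i < j)
    have htst : s.fl .test = false := by rw [hfl]; simpa using ht
    have hlp : s₁.fl .loop = false := by
      change s.fl .loop = false
      rw [hfl]
      simpa using hl
    have hB : s₁.rel (.inl B) i = h.rel (.inl B) i := by simp [s₁, hB₁, hB₂, hr]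
    have hbody := countDownBody_eq (B := B) (adj := adj) (i := i) s₁ htst (by simp [s₁])
    have hrel : ∀ x, x ≠ .inl .cur → x ≠ .inl .todo → s₁.rel x = h.rel x := by
      intro x hx₁ hx₂
      simp [s₁, hx₁, hx₂, hr]
    change ((countDownBody B n adj s₁).setFl .loop false).fl = _ ∧
      (countDownBody B n adj s₁).dig.map Prod.fst = _ ∧
      (∀ x, x ≠ .inl .cur → x ≠ .inl .todo → (countDownBody B n adj s₁).rel x = h.rel x) ∧
      (_ → digitsValue ((countDownBody B n adj s₁).dig.map Prod.snd) + _ = _)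
    rw [countDownBody_rel, hbody, hB, hcrd]
    rcases h.rel (.inl B) i with _ | _
    · simp only [Bool.false_eq_true, if_false, Bool.toNat_false, add_zero]
      rw [VState.setFl_eq_self _ _ _ hlp]
      exact ⟨hfl, hdig, hrel, hv⟩
    · simp only [if_true, Bool.toNat_true]
      rcases hany : s₁.dig.any fun d => d.2 with _ | _
      · simp only [Bool.false_eq_true, if_false]
        have h0 : digitsValue (s.dig.map Prod.snd) = 0 := by
          rw [digitsValue_eq_zero]
          simpa [s₁, List.any_map, Function.comp_def] using hany
        have hlt : ¬crd i + 1 ≤ K := by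
          intro hle
          have := hv (by omega)
          omega
        refine ⟨?_, hdig, hrel, fun h => absurd h hlt⟩
        rw [VState.setFl_eq_self _ _ _ (by simpa using hlp)]
        change Function.update s.fl _ _ = _
        rw [hfl]
        simp [hlt]
      · simp only [if_true]
        have hd := digitsValue_decrementDigits s.dig hany
        refine ⟨?_, (map_fst_decrementDigits s.dig).trans hdig, hrel, fun hle => ?_⟩
        · change (s₁.setFl .loop false).fl = _
          rw [VState.setFl_eq_self _ _ _ hlp]
          change s.fl = _
          rw [hfl]
          have : crd i ≤ K ↔ crd i + 1 ≤ K :=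
            ⟨fun h => by have := hv h; omega, fun h => by omega⟩
          rw [decide_eq_decide.2 this]
        · have := hv (by omega)
          change digitsValue ((decrementDigits s.dig).map Prod.snd) + _ = _
          omega

theorem Realizable.countDown (B : Reg) : Realizable (_root_.countDown (ι := ι) B) := by
  refine Realizable.resetCounter.comp (Realizable.forEach _ _ _ (by simp) ?_
    fun _ _ h => by rw [countDownBody_rel])
  have h₁ := (Realizable.count (X := RelName ι) AlgFlag.test 1
    fun _ _ r _ => r (.inl .cur) && r (.inl B))
  have h₂ := (Realizable.testCounter (X := RelName ι) AlgFlag.test).comp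
    (Realizable.decrement.ite (fun q => q .test) (Realizable.setFl AlgFlag.ok fun _ => false))
  exact (h₁.comp (h₂.ite (fun q => q .test) Realizable.id)).comp
    (Realizable.setFl .test fun _ => false)

end

/-! ### Tests of candidate solutions -/

/-- The set with a given characteristic function. -/
def vset {n : ℕ} (r : Fin n → Bool) : Finset (Fin n) := Finset.univ.filter fun i => r i = true

@[simp] theorem mem_vset {n : ℕ} {r : Fin n → Bool} {i : Fin n} : i ∈ vset r ↔ r i = true := by
  simp [vset]

section

variable {ι : Type} [DecidableEq ι]

omit [DecidableEq ι] in
theorem VState.Agree.trans {n : ℕ} {xs ys : List Reg} {h s u : VState (RelName ι) AlgFlag n}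
    (h₁ : Agree xs h s) (h₂ : Agree ys s u) : Agree (xs ++ ys) h u := by
  refine ⟨h₂.1.trans h₁.1, h₂.2.1.trans h₁.2.1, fun i => (h₂.2.2.1 i).trans (h₁.2.2.1 i),
    fun x hx => ?_⟩
  rw [List.mem_append, not_or] at hx
  exact (h₂.2.2.2 x hx.2).trans (h₁.2.2.2 x hx.1)

omit [DecidableEq ι] in
theorem VState.Agree.setFl {n : ℕ} {xs : List Reg} {h s : VState (RelName ι) AlgFlag n}
    (h₁ : Agree xs h s) (b : AlgFlag) (v : Bool) : Agree xs (h.setFl b v) (s.setFl b v) :=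
  ⟨by rw [fl_setFl, fl_setFl, h₁.1], h₁.2⟩

theorem VState.Agree.setRel {n : ℕ} {xs : List Reg} {h s : VState (RelName ι) AlgFlag n}
    (h₁ : Agree xs h s) (x : Reg) (r : Fin n → Bool) : Agree (x :: xs) h (s.setRel (.inl x) r) := by
  refine ⟨h₁.1, h₁.2.1, fun i => ?_, fun y hy => ?_⟩
  · simpa using h₁.2.2.1 i
  · rw [List.mem_cons, not_or] at hy
    simpa [hy.1] using h₁.2.2.2 y hy.2

omit [DecidableEq ι] in
theorem VState.Agree.refl {n : ℕ} (h : VState (RelName ι) AlgFlag n) : Agree [] h h :=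
  ⟨rfl, rfl, fun _ => rfl, fun _ _ => rfl⟩

/-- The flags that control loops and branches are cleared. -/
def VState.Idle {n : ℕ} (h : VState (RelName ι) AlgFlag n) : Prop :=
  h.fl .loop = false ∧ h.fl .test = false

omit [DecidableEq ι] in
theorem VState.Agree.idle {n : ℕ} {xs : List Reg} {h s : VState (RelName ι) AlgFlag n}
    (h₁ : Agree xs h s) (hh : h.Idle) : s.Idle := by
  rw [Idle, h₁.1]
  exact hh

/-- Clear the flag `ok` unless all vertices satisfy a condition. -/
def checkAll (c : (RelName ι → Bool) → Bool) : VFun (RelName ι) AlgFlag := fun _ _ h =>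
  (h.setFl .ok (h.fl .ok && decide (∀ i, c (h.rel · i) = true))).setFl .test false

omit [DecidableEq ι] in
theorem Realizable.checkAll (c : (RelName ι → Bool) → Bool) : Realizable (_root_.checkAll c) := by
  have h₁ : Realizable fun n adj (h : VState (RelName ι) AlgFlag n) =>
      h.setFl .test (decide (1 ≤ (Finset.univ.filter fun p : Fin n × Fin n =>
        (!c (h.rel · p.1)) = true).card)) :=
    Realizable.count AlgFlag.test 1 fun _ _ r _ => !c r
  have h₂ : Realizable fun n adj (h : VState (RelName ι) AlgFlag n) =>
      h.setFl .ok (h.fl .ok && !h.fl .test) :=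
    Realizable.setFl AlgFlag.ok fun q => q .ok && !q .test
  have h₃ : Realizable fun n adj (h : VState (RelName ι) AlgFlag n) => h.setFl .test false :=
    Realizable.setFl AlgFlag.test fun _ => false
  convert (h₁.comp h₂).comp h₃ using 4 with n adj h
  have : decide (1 ≤ (Finset.univ.filter fun p : Fin n × Fin n =>
      (!c (h.rel · p.1)) = true).card) = !decide (∀ i, c (h.rel · i) = true) := by
    rw [← decide_not, decide_eq_decide, Nat.one_le_iff_ne_zero, Finset.card_ne_zero, not_forall]
    constructor
    · rintro ⟨p, hp⟩
      exact ⟨p.1, by simpa using hp⟩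
    · rintro ⟨i, hi⟩
      exact ⟨(i, i), by simpa using hi⟩
  rw [this]
  unfold _root_.checkAll
  ext x
  · by_cases hx : x = .test
    · subst hx; simp
    · by_cases hx' : x = .ok
      · subst hx'; simp
      · simp [hx, hx']
  · rfl
  · rfl

omit [DecidableEq ι] in
theorem checkAll_spec (c : (RelName ι → Bool) → Bool) {n : ℕ} {adj : Fin n → Fin n → Bool}
    {h : VState (RelName ι) AlgFlag n} (hh : h.Idle) :
    checkAll c n adj h = h.setFl .ok (h.fl .ok && decide (∀ i, c (h.rel · i) = true)) :=
  VState.setFl_eq_self _ _ _ (by simpa using hh.2)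

/-- Clear the flag `ok` unless `b` is false or some vertex satisfies a condition. -/
def checkAny (b : Bool) (c : (RelName ι → Bool) → Bool) : VFun (RelName ι) AlgFlag := fun _ _ h =>
  (h.setFl .ok (h.fl .ok && (!b || decide (∃ i, c (h.rel · i) = true)))).setFl .test false

omit [DecidableEq ι] in
theorem Realizable.checkAny (b : Bool) (c : (RelName ι → Bool) → Bool) :
    Realizable (_root_.checkAny b c) := by
  have h₁ : Realizable fun n adj (h : VState (RelName ι) AlgFlag n) =>
      h.setFl .test (decide (1 ≤ (Finset.univ.filter fun p : Fin n × Fin n =>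
        c (h.rel · p.1) = true).card)) :=
    Realizable.count AlgFlag.test 1 fun _ _ r _ => c r
  have h₂ : Realizable fun n adj (h : VState (RelName ι) AlgFlag n) =>
      h.setFl .ok (h.fl .ok && (!b || h.fl .test)) :=
    Realizable.setFl AlgFlag.ok fun q => q .ok && (!b || q .test)
  have h₃ : Realizable fun n adj (h : VState (RelName ι) AlgFlag n) => h.setFl .test false :=
    Realizable.setFl AlgFlag.test fun _ => false
  convert (h₁.comp h₂).comp h₃ using 4 with n adj h
  have : decide (1 ≤ (Finset.univ.filter fun p : Fin n × Fin n =>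
      c (h.rel · p.1) = true).card) = decide (∃ i, c (h.rel · i) = true) := by
    rw [decide_eq_decide, Nat.one_le_iff_ne_zero, Finset.card_ne_zero]
    constructor
    · rintro ⟨p, hp⟩
      exact ⟨p.1, by simpa using hp⟩
    · rintro ⟨i, hi⟩
      exact ⟨(i, i), by simpa using hi⟩
  rw [this]
  unfold _root_.checkAny
  ext x
  · by_cases hx : x = .test
    · subst hx; simp
    · by_cases hx' : x = .ok
      · subst hx'; simp
      · simp [hx, hx']
  · rfl
  · rfl

omit [DecidableEq ι] in
theorem checkAny_spec (b : Bool) (c : (RelName ι → Bool) → Bool) {n : ℕ}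
    {adj : Fin n → Fin n → Bool} {h : VState (RelName ι) AlgFlag n} (hh : h.Idle) :
    checkAny b c n adj h =
      h.setFl .ok (h.fl .ok && (!b || decide (∃ i, c (h.rel · i) = true))) :=
  VState.setFl_eq_self _ _ _ (by simpa using hh.2)

open scoped Classical in
/-- The adjacency matrix of a graph. -/
noncomputable def adjBool {n : ℕ} (G : SimpleGraph (Fin n)) (i j : Fin n) : Bool :=
  decide (G.Adj i j)

@[simp] theorem adjBool_eq_true {n : ℕ} {G : SimpleGraph (Fin n)} {i j : Fin n} :
    adjBool G i j = true ↔ G.Adj i j := by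
  simp [adjBool]

/-! ### Test for a forest -/

/-- Set the flag `ok` to whether the complement of `sol` is a forest, by removing leaves. -/
def testForest : VFun (RelName ι) AlgFlag := fun n adj h =>
  checkAll (fun r => r (.inl .closed)) n adj
    (saturate .closed 2 true (fun a _ r' => a && !r' (.inl .closed)) n adj
      ((h.setFl .ok true).setRel (.inl .closed) fun i => h.rel (.inl .sol) i))

theorem Realizable.testForest : Realizable (_root_.testForest (ι := ι)) := by
  have h₁ : Realizable fun n adj (h : VState (RelName ι) AlgFlag n) => h.setFl .ok true :=
    Realizable.setFl AlgFlag.ok fun _ => true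
  have h₂ : Realizable fun n adj (h : VState (RelName ι) AlgFlag n) =>
      h.setRel (.inl .closed) fun i => h.rel (.inl .sol) i :=
    Realizable.setRel (X := RelName ι) (.inl .closed) fun r => r (.inl .sol)
  exact ((h₁.comp h₂).comp (Realizable.saturate 2 true _ (by simp) (by simp))).comp
    (Realizable.checkAll _)

omit [DecidableEq ι] in
theorem holdsAt_two_eq_false {n : ℕ} {c : PairCond ι} {adj : Fin n → Fin n → Bool}
    {rel : RelName ι → Fin n → Bool} {i : Fin n} : holdsAt 2 c adj rel i = false ↔
      ∀ j k, c (adj i j) (rel · i) (rel · j) = true → c (adj i k) (rel · i) (rel · k) = true →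
        j = k := by
  unfold holdsAt
  rw [decide_eq_false_iff_not, not_le, Nat.lt_succ_iff, Finset.card_le_one]
  simp only [Finset.mem_filter, Finset.mem_univ, true_and]
  exact ⟨fun h j k hj hk => h j hj k hk, fun h j hj k hk => h j k hj hk⟩

omit [DecidableEq ι] in
theorem holdsAt_one {n : ℕ} {c : PairCond ι} {adj : Fin n → Fin n → Bool}
    {rel : RelName ι → Fin n → Bool} {i : Fin n} : holdsAt 1 c adj rel i = true ↔
      ∃ j, c (adj i j) (rel · i) (rel · j) = true := by
  unfold holdsAt
  rw [decide_eq_true_eq, Nat.one_le_iff_ne_zero, Finset.card_ne_zero]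
  simp [Finset.Nonempty]

theorem SimpleGraph.Forest.of_leafIn {V : Type*} {G : SimpleGraph V} {U U' : Finset V} {w : V}
    (hU : G.Forest U) (hU' : ∀ x ∈ U', x = w ∨ x ∈ U) (hw : G.LeafIn w U') : G.Forest U' := by
  intro X hX hne
  by_cases hwX : w ∈ X
  · exact ⟨w, hwX, hw.mono hX⟩
  · exact hU X (fun x hx => (hU' x (hX hx)).resolve_left fun h => hwX (h ▸ hx)) hne

open scoped Classical in
-- If a leaf is removed and a forest remains, there was a forest before (`Forest.of_leafIn`); so
-- when everything can be removed, the start is a forest. Conversely, a nonempty remainder of a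
-- forest would contain a leaf, which saturation would have removed.
theorem testForest_spec {n : ℕ} (G : SimpleGraph (Fin n)) {h : VState (RelName ι) AlgFlag n}
    (hh : h.Idle) : VState.Agree [.closed, .cur, .todo, .round, .rounds]
      (h.setFl .ok (decide (G.Forest (vset fun i => !h.rel (.inl .sol) i))))
      (testForest n (adjBool G) h) := by
  let h₁ := (h.setFl .ok true).setRel (.inl .closed) fun i => h.rel (.inl .sol) i
  have hh₁ : h₁.Idle := by simpa [h₁, VState.Idle] using hh
  have hc : PairCond.Constant (ι := ι) fun a _ r' => a && !r' (.inl .closed) := by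
    intro a r r' u u' _ h'
    simp [h' (.inl .closed)]
  obtain ⟨hA, hsub, hcl, hind⟩ := saturate_spec (B := .closed) (t := 2) (neg := true) hc
    (adj := adjBool G) (h := h₁) hh₁.1 hh₁.2 (by simp) (by simp) (by simp) (by simp)
    (fun r i => G.LeafIn i (vset fun j => !r j)) (by
      intro r i
      rw [Bool.xor_true, Bool.not_eq_true', holdsAt_two_eq_false]
      simp only [SimpleGraph.LeafIn, mem_vset, Function.update_self, Bool.and_eq_true,
        adjBool_eq_true]
      exact ⟨fun H j k hj hk => H j hj.2 k hk.2 hj.1 hk.1,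
        fun H j hj k hk hj' hk' => H j k ⟨hj', hj⟩ ⟨hk', hk⟩⟩)
  let s := saturate .closed 2 true (fun a _ r' => a && !r' (.inl .closed)) n (adjBool G) h₁
  have hs : s.Idle := hA.idle hh₁
  have hrel : h₁.rel (.inl .closed) = h.rel (.inl .sol) := by simp [h₁]
  have key : (∀ i, s.rel (.inl .closed) i = true) ↔
      G.Forest (vset fun i => !h.rel (.inl .sol) i) := by
    constructor
    · intro hall
      refine hind (fun r => G.Forest (vset fun j => !r j) →
        G.Forest (vset fun i => !h.rel (.inl .sol) i)) ?_ ?_ ?_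
      · rw [hrel]
        exact id
      · intro r i hr hi hF
        refine hr (hF.of_leafIn (w := i) (fun x hx => ?_) hi)
        by_cases hxi : x = i
        · exact Or.inl hxi
        · right
          simpa [hxi] using hx
      · intro X hX hne
        obtain ⟨x, hx⟩ := hne
        have := hX hx
        simp [s, hall] at this
    · intro hF i
      by_contra hi
      obtain ⟨w, hw, hl⟩ := hF (vset fun j => !s.rel (.inl .closed) j) (fun x hx => by
        have := hsub x
        rw [hrel] at this
        simp only [mem_vset, Bool.not_eq_true'] at hx ⊢
        by_contra hne
        have := this (by simpa using hne)
        simp [s] at hx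
        simp [hx] at this) ⟨i, by simpa using hi⟩
      have := hcl w hl
      simp only [mem_vset, Bool.not_eq_true'] at hw
      simp [s] at hw
      simp [hw] at this
  have hok : s.fl .ok = true := by
    rw [hA.1]
    simp [h₁]
  change VState.Agree _ _ (checkAll _ n (adjBool G) s)
  rw [checkAll_spec _ hs, hok, Bool.true_and, decide_eq_decide.2 key]
  have := ((VState.Agree.refl (h.setFl .ok true)).setRel .closed fun i => h.rel (.inl .sol) i).trans hA
  have := this.setFl .ok (decide (G.Forest (vset fun i => !h.rel (.inl .sol) i)))
  rw [VState.setFl_setFl] at this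
  refine ⟨this.1, this.2.1, this.2.2.1, fun x hx => this.2.2.2 x ?_⟩
  simpa using hx

/-! ### Test for connectivity -/

/-- Clear the flag `ok` if `b` is true and `sol` is not connected, by exploring from one vertex. -/
def testLinked (b : Bool) : VFun (RelName ι) AlgFlag := fun n adj h =>
  checkAll (fun r => !b || !r (.inl .sol) || r (.inl .closed)) n adj
    (saturate .closed 1 false (fun a r r' => r (.inl .sol) && a && r' (.inl .closed)) n adj
      (h.setRel (.inl .closed) (firstOf (h.rel (.inl .sol)))))

theorem Realizable.testLinked (b : Bool) : Realizable (_root_.testLinked (ι := ι) b) := by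
  have h₁ : Realizable fun n adj (h : VState (RelName ι) AlgFlag n) =>
      h.setRel (.inl .closed) (firstOf (h.rel (.inl .sol))) := Realizable.pick _ _
  exact (h₁.comp (Realizable.saturate 1 false _ (by simp) (by simp))).comp
    (Realizable.checkAll _)

open scoped Classical in
-- Saturation produces a linked subset of `sol` that no edge joins to the rest of `sol`; it is
-- nonempty if `sol` is. So it is all of `sol` exactly when `sol` is linked. The empty set passes
-- the test, in accordance with `Linked`.
theorem testLinked_spec {n : ℕ} (G : SimpleGraph (Fin n)) (b : Bool)
    {h : VState (RelName ι) AlgFlag n} (hh : h.Idle) :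
    VState.Agree [.closed, .cur, .todo, .round, .rounds]
      (h.setFl .ok (h.fl .ok && decide (b = true → G.Linked (vset (h.rel (.inl .sol))))))
      (testLinked b n (adjBool G) h) := by
  let h₁ := h.setRel (.inl .closed) (firstOf (h.rel (.inl .sol)))
  have hh₁ : h₁.Idle := hh
  have hc : PairCond.Constant (ι := ι) fun a r r' => r (.inl .sol) && a && r' (.inl .closed) := by
    intro a r r' u u' h h'
    simp [h (.inl .sol), h' (.inl .closed)]
  obtain ⟨hA, hsub, hcl, hind⟩ := saturate_spec (B := .closed) (t := 1) (neg := false) hc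
    (adj := adjBool G) (h := h₁) hh₁.1 hh₁.2 (by simp) (by simp) (by simp) (by simp)
    (fun r i => h.rel (.inl .sol) i = true ∧ ∃ j, G.Adj i j ∧ r j = true) (by
      intro r i
      rw [Bool.xor_false, holdsAt_one]
      simp [h₁, and_assoc])
  let s := saturate .closed 1 false (fun a r r' => r (.inl .sol) && a && r' (.inl .closed)) n
    (adjBool G) h₁
  have hs : s.Idle := hA.idle hh₁
  have hrel : h₁.rel (.inl .closed) = firstOf (h.rel (.inl .sol)) := by simp [h₁]
  have hsol : s.rel (.inl .sol) = h.rel (.inl .sol) := by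
    rw [hA.2.2.2 .sol (by simp)]
    simp [h₁]
  have hP : G.Linked (vset (s.rel (.inl .closed))) ∧
      vset (s.rel (.inl .closed)) ⊆ vset (h.rel (.inl .sol)) := by
    refine hind (fun r => G.Linked (vset r) ∧ vset r ⊆ vset (h.rel (.inl .sol))) ?_ ?_
    · rw [hrel]
      refine ⟨?_, fun i hi => ?_⟩
      · intro X hX hne hXne
        obtain ⟨x, hx⟩ := hne
        refine absurd (hX.antisymm fun y hy => ?_) hXne
        have hx' := hX hx
        simp only [mem_vset, firstOf, decide_eq_true_eq] at hx' hy
        rcases lt_trichotomy x y with hxy | hxy | hxy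
        · simp [hy.2 x hxy] at hx'
        · exact hxy ▸ hx
        · simp [hx'.2 y hxy] at hy
      · simp only [mem_vset, firstOf, decide_eq_true_eq] at hi
        simpa using hi.1
    · rintro r i ⟨hr, hrS⟩ ⟨hiS, j, hij, hj⟩
      have e : vset (fun k => r k || decide (k = i)) = insert i (vset r) := by
        ext k
        simp [or_comm]
      rw [e]
      refine ⟨?_, fun x hx => ?_⟩
      · convert hr.insert (mem_vset.2 hj) hij.symm
      · rcases Finset.mem_insert.1 hx with rfl | hx
        · simpa using hiS
        · exact hrS hx
  have key : (∀ i, (!b || !s.rel (.inl .sol) i || s.rel (.inl .closed) i) = true) ↔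
      (b = true → G.Linked (vset (h.rel (.inl .sol)))) := by
    rw [hsol]
    constructor
    · rintro hall rfl
      have : vset (s.rel (.inl .closed)) = vset (h.rel (.inl .sol)) := by
        refine hP.2.antisymm fun x hx => ?_
        have := hall x
        rw [mem_vset] at hx
        simpa [hx] using this
      rw [← this]
      exact hP.1
    · intro hL i
      cases b
      · rfl
      have hL := hL rfl
      rcases hi : h.rel (.inl .sol) i with _ | _
      · rfl
      by_contra hne
      have hfirst : (vset (s.rel (.inl .closed))).Nonempty := by
        obtain ⟨m, hm, hmin⟩ := (vset (h.rel (.inl .sol))).exists_min_image id ⟨i, by simpa using hi⟩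
        refine ⟨m, mem_vset.2 (hsub m ?_)⟩
        rw [hrel]
        simp only [firstOf, decide_eq_true_eq]
        refine ⟨mem_vset.1 hm, fun j hj => ?_⟩
        by_contra hjS
        exact absurd (hmin j (by simpa using hjS)) (not_le.2 hj)
      obtain ⟨x, hx, y, hy, hxy⟩ := hL _ hP.2 hfirst (fun he => by
        have : i ∈ vset (s.rel (.inl .closed)) := by
          rw [he]
          simpa using hi
        simp [mem_vset.1 this] at hne)
      have hy := (@Finset.mem_sdiff _ (_) _ _ _).1 hy
      exact hy.2 (mem_vset.2 (hcl y ⟨mem_vset.1 hy.1, x, hxy.symm, mem_vset.1 hx⟩))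
  have hok : s.fl .ok = h.fl .ok := by
    rw [hA.1]
    simp [h₁]
  change VState.Agree _ _ (checkAll _ n (adjBool G) s)
  rw [checkAll_spec _ hs, hok, decide_eq_decide.2 key]
  have := ((VState.Agree.refl h).setRel .closed (firstOf (h.rel (.inl .sol)))).trans hA
  have := this.setFl .ok (h.fl .ok && decide (b = true → G.Linked (vset (h.rel (.inl .sol)))))
  refine ⟨this.1, this.2.1, this.2.2.1, fun x hx => this.2.2.2 x ?_⟩
  simpa using hx

end

/-! ### The candidates -/

/-- The pointers of the algorithm: to the vertices of the core of the forest, to the ends of the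
edges that exclude vertices, and to the vertices that are added to connect the solution. -/
abbrev Pointer (s : ℕ) : Type := Fin (4 * s) ⊕ (Fin s × Bool) ⊕ Fin (2 * s + 1)

section

variable {s n : ℕ} (G : SimpleGraph (Fin n)) (z : Pointer s → Option (Fin n))

/-- The core of a candidate. -/
def candidateCore : Finset (Fin n) := Finset.univ.filter fun j => ∃ i, z (.inl i) = some j

@[simp] theorem mem_candidateCore {j : Fin n} :
    j ∈ candidateCore z ↔ ∃ i, z (.inl i) = some j := by
  simp [candidateCore]

/-- The vertices that are excluded from the independent set of a candidate. -/
def CandidateExcluded (w : Fin n) : Prop :=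
  ∃ (m : Fin s) (v : Fin n), z (.inr (.inl (m, true))) = some v ∧ w < v ∧
    (G.Adj w v ∨ ∃ u, z (.inr (.inl (m, false))) = some u ∧ (w = u ∨ G.Adj w u))

/-- The independent set of a candidate, which is obtained greedily. -/
def IsGreedy (J : Finset (Fin n)) : Prop :=
  ∀ w, w ∈ J ↔ w ∉ candidateCore z ∧ G.LeafIn w (candidateCore z) ∧ ¬CandidateExcluded G z w ∧
    ∀ x ∈ J, x < w → ¬G.Adj w x

/-- The candidate for a solution that is given by the pointers. -/
def IsCandidate (S : Finset (Fin n)) : Prop :=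
  ∃ J, IsGreedy G z J ∧
    ∀ w, w ∈ S ↔ (w ∉ candidateCore z ∧ w ∉ J) ∨ ∃ i, z (.inr (.inr i)) = some w

variable {G z}

/-- Membership of `w` is determined by the elements smaller than `w`. -/
theorem IsGreedy.unique {J J' : Finset (Fin n)} (h : IsGreedy G z J) (h' : IsGreedy G z J') :
    J = J' := by
  have : ∀ k (w : Fin n), w.val = k → (w ∈ J ↔ w ∈ J') := by
    intro k
    induction k using Nat.strong_induction_on with
    | _ k ih =>
    rintro w rfl
    rw [h w, h' w]
    refine and_congr_right fun _ => and_congr_right fun _ => and_congr_right fun _ => ?_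
    exact ⟨fun H x hx hxw => H x ((ih x.val hxw x rfl).2 hx) hxw,
      fun H x hx hxw => H x ((ih x.val hxw x rfl).1 hx) hxw⟩
  ext w
  exact this _ w rfl

theorem IsCandidate.unique {S S' : Finset (Fin n)} (h : IsCandidate G z S)
    (h' : IsCandidate G z S') : S = S' := by
  obtain ⟨J, hJ, hS⟩ := h
  obtain ⟨J', hJ', hS'⟩ := h'
  obtain rfl := hJ.unique hJ'
  ext w
  rw [hS, hS']

variable (G) (z)

/-- The solutions of the problem: feedback vertex sets that are connected if `conn` is true, and
nonempty if `ne` is true. -/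
def IsSolution (conn ne : Bool) (S : Finset (Fin n)) : Prop :=
  G.Forest (Finset.univ.filter fun i => i ∉ S) ∧ (conn = true → G.Linked S) ∧
    (ne = true → S.Nonempty)

/-- The candidate is a solution of size at most `K`. -/
def Succeeds (conn ne : Bool) (K : ℕ) : Prop :=
  ∃ S, IsCandidate G z S ∧ IsSolution G conn ne S ∧ S.card ≤ K

/-- The pointers in a list point to the vertices given by `z`. -/
def VState.Points {ι : Type} (xs : ι → Prop) (h : VState (RelName ι) AlgFlag n)
    (z : ι → Option (Fin n)) : Prop :=
  ∀ i, xs i → (h.rel (.inr (i, false)) = fun j => decide (z i = some j)) ∧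
    h.rel (.inr (i, true)) = fun j => decide (∀ k, z i = some k → k < j)

end

/-! ### Computation and test of one candidate -/

section

variable (s : ℕ)

/-- Whether a vertex belongs to the core. -/
def coreBit (r : RelName (Pointer s) → Bool) : Bool :=
  decide (∃ i, r (.inr (.inl i, false)) = true)

/-- The conditions that keep a vertex from being added to the independent set. -/
def blockBit (a : Bool) (r r' : RelName (Pointer s) → Bool) : Bool :=
  r (.inl .core) || !r (.inl .light) || (r' (.inl .indep) && a) ||
    -- If the pointer to `v` is set, the first two conditions say that `w` is neither after `v` nor
    -- equal to `v`, hence before `v`. If it is empty, all vertices count as later than it, and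
    -- nothing is excluded. The second vertex of the pair plays the role of an end of the edge.
    decide (∃ m : Fin s, r (.inr (.inr (.inl (m, true)), true)) = false ∧
      r (.inr (.inr (.inl (m, true)), false)) = false ∧
      ((r' (.inr (.inr (.inl (m, true)), false)) = true ∧ a = true) ∨
        (r' (.inr (.inr (.inl (m, false)), false)) = true ∧
          (r (.inr (.inr (.inl (m, false)), false)) = true ∨ a = true))))

/-- Whether a vertex belongs to the candidate. -/
def solBit (r : RelName (Pointer s) → Bool) : Bool :=
  (!r (.inl .core) && !r (.inl .indep)) ||
    decide (∃ i, r (.inr (.inr (.inr i), false)) = true)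

/-- Compute the candidate given by the pointers. -/
def construct : VFun (RelName (Pointer s)) AlgFlag := fun n adj h =>
  let h₁ := h.setRel (.inl .core) fun i => coreBit s (h.rel · i)
  let h₂ := scan .light 2 true (fun a _ r' => a && r' (.inl .core)) n adj
    (h₁.setRel (.inl .light) fun _ => false)
  let h₃ := scan .indep 1 true (blockBit s) n adj (h₂.setRel (.inl .indep) fun _ => false)
  h₃.setRel (.inl .sol) fun i => solBit s (h₃.rel · i)

theorem Realizable.construct : Realizable (_root_.construct s) := by
  have h₁ : Realizable fun n adj (h : VState (RelName (Pointer s)) AlgFlag n) =>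
      h.setRel (.inl .core) fun i => coreBit s (h.rel · i) :=
    Realizable.setRel (X := RelName (Pointer s)) (.inl .core) (coreBit s)
  have h₂ : Realizable fun n adj (h : VState (RelName (Pointer s)) AlgFlag n) =>
      h.setRel (.inl .light) fun _ => false :=
    Realizable.setRel (X := RelName (Pointer s)) (.inl .light) fun _ => false
  have h₃ : Realizable fun n adj (h : VState (RelName (Pointer s)) AlgFlag n) =>
      h.setRel (.inl .indep) fun _ => false :=
    Realizable.setRel (X := RelName (Pointer s)) (.inl .indep) fun _ => false
  have h₄ : Realizable fun n adj (h : VState (RelName (Pointer s)) AlgFlag n) =>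
      h.setRel (.inl .sol) fun i => solBit s (h.rel · i) :=
    Realizable.setRel (X := RelName (Pointer s)) (.inl .sol) (solBit s)
  have k₁ := Realizable.scan (B := .light) 2 true
    (fun a (_ r' : RelName (Pointer s) → Bool) => a && r' (.inl .core)) (by simp)
  have k₂ := Realizable.scan (B := .indep) 1 true (blockBit s) (by simp)
  exact ((((h₁.comp h₂).comp k₁).comp h₃).comp k₂).comp h₄

theorem blockBit_steady : PairCond.Steady (blockBit s) := by
  intro a r r' u u' h h'
  simp [blockBit, h, h']

variable {s}

/-- The recursion that `scan_spec` provides for `indep` is the one in `IsGreedy`: the scan runs in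
vertex order and starts from the empty set, so a vertex is compared with the smaller elements only.
-/
theorem construct_spec {n : ℕ} (G : SimpleGraph (Fin n)) {z : Pointer s → Option (Fin n)}
    {h : VState (RelName (Pointer s)) AlgFlag n} (hh : h.Idle) (hz : h.Points (fun _ => True) z) :
    VState.Agree [.core, .light, .indep, .sol, .cur, .todo] h (construct s n (adjBool G) h) ∧
      IsCandidate G z (vset ((construct s n (adjBool G) h).rel (.inl .sol))) := by
  let h₁ := h.setRel (.inl .core) fun i => coreBit s (h.rel · i)
  let g₁ := h₁.setRel (.inl .light) fun _ => false
  have hg₁ : g₁.Idle := hh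
  obtain ⟨hA₂, hlight⟩ := scan_spec (B := .light) (t := 2) (neg := true)
    (c := fun a _ r' => a && r' (.inl .core)) (by
      intro a r r' u u' _ h'
      simp [h' (.inl .core)]) (adj := adjBool G) (h := g₁) hg₁.1 hg₁.2 (by simp) (by simp)
  let h₂ := scan .light 2 true (fun a _ r' => a && r' (.inl .core)) n (adjBool G) g₁
  let g₂ := h₂.setRel (.inl .indep) fun _ => false
  have hg₂ : g₂.Idle := hA₂.idle hg₁
  obtain ⟨hA₃, hindep⟩ := scan_spec (B := .indep) (t := 1) (neg := true) (blockBit_steady s)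
    (adj := adjBool G) (h := g₂) hg₂.1 hg₂.2 (by simp) (by simp)
  let h₃ := scan .indep 1 true (blockBit s) n (adjBool G) g₂
  have hA : VState.Agree [.core, .light, .cur, .todo, .indep, .cur, .todo] h h₃ := by
    have := ((((VState.Agree.refl h).setRel .core fun i => coreBit s (h.rel · i)).setRel .light
      fun _ => false).trans hA₂).setRel .indep fun _ => false
    have := this.trans hA₃
    refine ⟨this.1, this.2.1, this.2.2.1, fun x hx => this.2.2.2 x ?_⟩
    simp at hx ⊢
    tauto
  refine ⟨?_, vset (h₃.rel (.inl .indep)), ?_, ?_⟩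
  · have := hA.setRel .sol fun i => solBit s (h₃.rel · i)
    refine ⟨this.1, this.2.1, this.2.2.1, fun x hx => this.2.2.2 x ?_⟩
    simp at hx ⊢
    tauto
  · have hcore₁ : ∀ i, g₁.rel (.inl .core) i = true ↔ i ∈ candidateCore z := by
      intro i
      simp [g₁, h₁, coreBit, (hz _ trivial).1]
    have hcore₂ : ∀ i, g₂.rel (.inl .core) i = true ↔ i ∈ candidateCore z := by
      intro i
      rw [← hcore₁]
      have := hA₂.2.2.2 .core (by simp)
      simp [g₂, h₂, this]
    have hlight₂ : ∀ i, g₂.rel (.inl .light) i = true ↔ G.LeafIn i (candidateCore z) := by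
      intro i
      have e : g₂.rel (.inl .light) i = h₂.rel (.inl .light) i := by simp [g₂]
      rw [e, hlight i]
      have : g₁.rel (.inl .light) i = false := by simp [g₁]
      rw [this, Bool.false_or, Bool.xor_true, Bool.not_eq_true', holdsAt_two_eq_false]
      simp only [SimpleGraph.LeafIn, Bool.and_eq_true, adjBool_eq_true]
      simp only [ne_eq, reduceCtorEq, not_false_eq_true, Function.update_of_ne, Sum.inl.injEq,
        hcore₁]
      exact ⟨fun H a ha b hb hia hib => H a b ⟨hia, ha⟩ ⟨hib, hb⟩,
        fun H a b ha hb => H a ha.2 b hb.2 ha.1 hb.1⟩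
    have hptr : g₂.Points (fun _ => True) z := by
      intro i _
      have := fun b => hA₂.2.2.1 (i, b)
      simpa [g₂, h₂, this, g₁, h₁] using hz i trivial
    intro w
    have e := hindep w
    have hw₀ : g₂.rel (.inl .indep) w = false := by simp [g₂]
    have hst : stage (g₂.rel (.inl .indep)) (h₃.rel (.inl .indep)) w =
        fun j => decide (j < w) && h₃.rel (.inl .indep) j := by
      funext j
      simp [stage, g₂]
    rw [mem_vset, e, hw₀, Bool.false_or, Bool.xor_true, Bool.not_eq_true', ← Bool.not_eq_true,
      holdsAt_one, hst]
    simp only [blockBit, Bool.or_eq_true, Bool.and_eq_true, decide_eq_true_eq, Function.update_self,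
      adjBool_eq_true, Bool.not_eq_true', ne_eq, reduceCtorEq, not_false_eq_true,
      Function.update_of_ne, Sum.inl.injEq, (hptr _ trivial).1, (hptr _ trivial).2, mem_vset]
    rw [← hlight₂, ← hcore₂]
    have hx : CandidateExcluded G z w ↔ ∃ j m,
        decide (∀ k, z (.inr (.inl (m, true))) = some k → k < w) = false ∧
          decide (z (.inr (.inl (m, true))) = some w) = false ∧
            (z (.inr (.inl (m, true))) = some j ∧ G.Adj w j ∨
              z (.inr (.inl (m, false))) = some j ∧
                (z (.inr (.inl (m, false))) = some w ∨ G.Adj w j)) := by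
      simp only [decide_eq_false_iff_not, not_forall]
      constructor
      · rintro ⟨m, v, hv, hwv, hadj⟩
        have h₁ : ∃ k, ∃ _ : z (.inr (.inl (m, true))) = some k, ¬k < w := ⟨v, hv, not_lt.2 hwv.le⟩
        have h₂ : z (.inr (.inl (m, true))) ≠ some w := by
          rw [hv]
          simpa using hwv.ne'
        rcases hadj with hadj | ⟨u, hu, hwu | hwu⟩
        · exact ⟨v, m, h₁, h₂, Or.inl ⟨hv, hadj⟩⟩
        · exact ⟨u, m, h₁, h₂, Or.inr ⟨hu, Or.inl (hwu ▸ hu)⟩⟩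
        · exact ⟨u, m, h₁, h₂, Or.inr ⟨hu, Or.inr hwu⟩⟩
      · rintro ⟨j, m, ⟨v, hv, hvw⟩, hne, hj⟩
        have hwv : w < v := lt_of_le_of_ne (not_lt.1 hvw) fun he => hne (he ▸ hv)
        refine ⟨m, v, hv, hwv, ?_⟩
        rcases hj with ⟨hj, hadj⟩ | ⟨hj, hj'⟩
        · rw [hv, Option.some_inj] at hj
          exact Or.inl (hj ▸ hadj)
        · refine Or.inr ⟨j, hj, hj'.imp_left fun hw => ?_⟩
          rw [hw, Option.some_inj] at hj
          exact hj
    rw [hx]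
    constructor
    · intro H
      -- Conditions on `w` alone block together with every second vertex; `w` itself serves as a
      -- witness.
      refine ⟨fun hc => H ⟨w, Or.inl (Or.inl (Or.inl hc))⟩, ?_, fun ⟨j, hj⟩ => H ⟨j, Or.inr hj⟩,
        fun x hx hxw hadj => H ⟨x, Or.inl (Or.inr ⟨⟨hxw, hx⟩, hadj⟩)⟩⟩
      by_contra hl
      exact H ⟨w, Or.inl (Or.inl (Or.inr (by simpa using hl)))⟩
    · rintro ⟨h₁, h₂, h₃, h₄⟩ ⟨j, ((hj | hj) | hj) | hj⟩
      · exact h₁ hj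
      · simp [hj] at h₂
      · exact h₄ j hj.1.2 hj.1.1 hj.2
      · exact h₃ ⟨j, hj⟩
  · intro w
    have hcore : h₃.rel (.inl .core) w = true ↔ w ∈ candidateCore z := by
      have e₁ : h₃.rel (.inl .core) = g₂.rel (.inl .core) := hA₃.2.2.2 .core (by simp)
      have e₂ : h₂.rel (.inl .core) = g₁.rel (.inl .core) := hA₂.2.2.2 .core (by simp)
      rw [e₁]
      simp [g₂, e₂, g₁, h₁, coreBit, (hz _ trivial).1]
    have hptr : ∀ i, h₃.rel (.inr (i, false)) w = true ↔ z i = some w := by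
      intro i
      rw [hA.2.2.1, (hz i trivial).1, decide_eq_true_eq]
    have e : (construct s n (adjBool G) h).rel (.inl .sol) w = solBit s (h₃.rel · w) := by
      change (h₃.setRel (.inl .sol) fun i => solBit s (h₃.rel · i)).rel (.inl .sol) w = _
      simp
    rw [mem_vset, e]
    simp only [solBit, Bool.or_eq_true, Bool.and_eq_true, decide_eq_true_eq, hptr, mem_vset,
      Bool.not_eq_true', ← Bool.not_eq_true, hcore]

theorem construct_rel {n : ℕ} {adj : Fin n → Fin n → Bool}
    (h : VState (RelName (Pointer s)) AlgFlag n) (x : Pointer s × Bool) :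
    (construct s n adj h).rel (.inr x) = h.rel (.inr x) := by
  unfold construct
  dsimp only
  rw [VState.rel_setRel, Function.update_of_ne (by simp), scan_rel _ (by simp) (by simp) (by simp),
    VState.rel_setRel, Function.update_of_ne (by simp), scan_rel _ (by simp) (by simp) (by simp)]
  simp

/-- Test whether the candidate given by the pointers is a solution whose size is at most the value
of the counter. -/
def attempt (s : ℕ) (conn ne : Bool) : VFun (RelName (Pointer s)) AlgFlag := fun n adj h =>
  let h₁ := testLinked conn n adj (testForest n adj (construct s n adj h))
  let h₂ := countDown .sol n adj (checkAny ne (fun r => r (.inl .sol)) n adj h₁)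
  h₂.setFl .found (h₂.fl .found || h₂.fl .ok)

theorem Realizable.attempt (conn ne : Bool) : Realizable (_root_.attempt s conn ne) := by
  have h₁ : Realizable fun n adj (h : VState (RelName (Pointer s)) AlgFlag n) =>
      h.setFl .found (h.fl .found || h.fl .ok) :=
    Realizable.setFl AlgFlag.found fun q => q .found || q .ok
  have k₁ := (Realizable.construct s).comp Realizable.testForest
  have k₂ := k₁.comp (Realizable.testLinked conn)
  have k₃ := k₂.comp (Realizable.checkAny ne fun r => r (.inl .sol))
  exact (k₃.comp (Realizable.countDown .sol)).comp h₁

theorem saturate_rel {ι : Type} [DecidableEq ι] {B : Reg} {t : ℕ} {neg : Bool} {c : PairCond ι}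
    {n : ℕ} {adj : Fin n → Fin n → Bool} (h : VState (RelName ι) AlgFlag n) (x : ι × Bool) :
    (saturate B t neg c n adj h).rel (.inr x) = h.rel (.inr x) :=
  forEach_rel h (fun h => scan_rel h (by simp) (by simp) (by simp)) (by simp) (by simp)

theorem attempt_rel {conn ne : Bool} {n : ℕ} {adj : Fin n → Fin n → Bool}
    (h : VState (RelName (Pointer s)) AlgFlag n) (x : Pointer s × Bool) :
    (attempt s conn ne n adj h).rel (.inr x) = h.rel (.inr x) := by
  have h₁ : ∀ h : VState (RelName (Pointer s)) AlgFlag n,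
      (testForest n adj h).rel (.inr x) = h.rel (.inr x) := by
    intro h
    refine (saturate_rel _ x).trans ?_
    simp
  have h₂ : ∀ h : VState (RelName (Pointer s)) AlgFlag n,
      (testLinked conn n adj h).rel (.inr x) = h.rel (.inr x) := by
    intro h
    refine (saturate_rel _ x).trans ?_
    simp
  have h₃ : ∀ h : VState (RelName (Pointer s)) AlgFlag n,
      (countDown .sol n adj h).rel (.inr x) = h.rel (.inr x) := by
    intro h
    exact forEach_rel _ (fun h => by rw [countDownBody_rel]) (by simp) (by simp)
  change (countDown .sol n adj _).rel (.inr x) = _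
  rw [h₃]
  change (testLinked conn n adj _).rel (.inr x) = _
  rw [h₂, h₁, construct_rel]

/-- A transition of the algorithm that keeps the parameter and the pointers, except for those in
`xs`, and that sets the flag `found` if `A` is true. -/
def VState.Accumulates {ι : Type} {n : ℕ} (xs : List ι) (A : Prop)
    (h s : VState (RelName ι) AlgFlag n) : Prop :=
  s.Idle ∧ s.dig.map Prod.fst = h.dig.map Prod.fst ∧
    (∀ i ∉ xs, ∀ b, s.rel (.inr (i, b)) = h.rel (.inr (i, b))) ∧ s.fl .neg = h.fl .neg ∧
      (s.fl .found = true ↔ h.fl .found = true ∨ A)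

/-- No test changes `sol`. The forest test overwrites `ok`, and the later tests can only clear it,
so `ok` ends as the conjunction. By `IsCandidate.unique`, the computed set is the only one that can
witness `Succeeds`. -/
theorem attempt_spec {conn ne : Bool} {n : ℕ} (G : SimpleGraph (Fin n))
    {z : Pointer s → Option (Fin n)} {h : VState (RelName (Pointer s)) AlgFlag n} (hh : h.Idle)
    (hz : h.Points (fun _ => True) z) :
    VState.Accumulates [] (Succeeds G z conn ne (digitsValue (h.dig.map Prod.fst))) h
      (attempt s conn ne n (adjBool G) h) := by
  classical
  obtain ⟨hA₁, hS⟩ := construct_spec G hh hz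
  let h₁ := construct s n (adjBool G) h
  have hh₁ : h₁.Idle := hA₁.idle hh
  let S := vset (h₁.rel (.inl .sol))
  have hA₂ := testForest_spec G hh₁
  let h₂ := testForest n (adjBool G) h₁
  have hh₂ : h₂.Idle := hA₂.idle hh₁
  have hA₃ := testLinked_spec G conn hh₂
  let h₃ := testLinked conn n (adjBool G) h₂
  have hh₃ : h₃.Idle := hA₃.idle hh₂
  have e₂ : h₂.rel (.inl .sol) = h₁.rel (.inl .sol) := hA₂.2.2.2 .sol (by simp)
  have e₃ : h₃.rel (.inl .sol) = h₁.rel (.inl .sol) := (hA₃.2.2.2 .sol (by simp)).trans e₂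
  have hA₄ := checkAny_spec ne (fun r : RelName (Pointer s) → Bool => r (.inl .sol))
    (adj := adjBool G) hh₃
  let h₄ := checkAny ne (fun r : RelName (Pointer s) → Bool => r (.inl .sol)) n (adjBool G) h₃
  have hh₄ : h₄.Idle := by
    change (checkAny ne (fun r : RelName (Pointer s) → Bool => r (.inl .sol)) n (adjBool G) h₃).Idle
    rw [hA₄]
    exact hh₃
  have e₄ : h₄.rel (.inl .sol) = h₁.rel (.inl .sol) := e₃
  have d₄ : h₄.dig = h.dig := hA₃.2.1.trans (hA₂.2.1.trans hA₁.2.1)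
  obtain ⟨hfl, hdig, hrel⟩ := countDown_spec (B := .sol) (adj := adjBool G) hh₄.1 hh₄.2 (by simp)
    (by simp)
  let h₅ := countDown .sol n (adjBool G) h₄
  have hf : ∀ x, x ≠ .ok → h₅.fl x = h.fl x := by
    intro x hx
    have f₄ : h₄.fl = _ := congrArg VState.fl hA₄
    rw [hfl, Function.update_of_ne hx, f₄, VState.fl_setFl, Function.update_of_ne hx, hA₃.1,
      VState.fl_setFl, Function.update_of_ne hx, hA₂.1, VState.fl_setFl, Function.update_of_ne hx,
      hA₁.1]
  have hok : h₅.fl .ok = true ↔ Succeeds G z conn ne (digitsValue (h.dig.map Prod.fst)) := by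
    have f₄ : h₄.fl = _ := congrArg VState.fl hA₄
    rw [hfl, Function.update_self, f₄, VState.fl_setFl, Function.update_self, hA₃.1,
      VState.fl_setFl, Function.update_self, hA₂.1, VState.fl_setFl, Function.update_self, d₄, e₄]
    change _ ↔ ∃ S, _
    have hF : (vset fun i => !h₁.rel (.inl .sol) i) = Finset.univ.filter fun i => i ∉ S := by
      ext i
      simp [S]
    rw [e₂, hF]
    have hN : (∃ i, h₁.rel (.inl .sol) i = true) ↔ S.Nonempty := by simp [S, Finset.Nonempty]
    simp only [e₃, hN, Bool.and_eq_true, decide_eq_true_eq, Bool.or_eq_true, Bool.not_eq_true',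
      ← Bool.not_eq_true]
    constructor
    · rintro ⟨⟨⟨h₁, h₂⟩, h₃⟩, h₄⟩
      exact ⟨S, hS, ⟨h₁, h₂, h₃.resolve_left ∘ not_not.2⟩, h₄⟩
    · rintro ⟨S', hS', ⟨h₁, h₂, h₃⟩, h₄⟩
      obtain rfl : S = S' := hS.unique hS'
      exact ⟨⟨⟨h₁, h₂⟩, or_iff_not_imp_left.2 fun h => h₃ (not_not.1 h)⟩, h₄⟩
  change VState.Accumulates _ _ h (h₅.setFl .found (h₅.fl .found || h₅.fl .ok))
  refine ⟨⟨?_, ?_⟩, ?_, ?_, ?_, ?_⟩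
  · simpa [hf] using hh.1
  · simpa [hf] using hh.2
  · rw [VState.dig_setFl, hdig, d₄]
  · intro i _ b
    exact attempt_rel (conn := conn) (ne := ne) h (i, b)
  · simp [hf]
  · rw [VState.fl_setFl, Function.update_self, hf _ (by simp), Bool.or_eq_true, hok]

end

/-! ### The search through all candidates -/

section

variable {ι : Type} [DecidableEq ι]

/-- Run `F` for all values of the pointers in a list. -/
def forTuples : List ι → VFun (RelName ι) AlgFlag → VFun (RelName ι) AlgFlag
  | [], F => F
  | i :: l, F => forEachOption .loop (.inr (i, false)) (.inr (i, true)) (forTuples l F)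

theorem forTuples_rel {F : VFun (RelName ι) AlgFlag} {n : ℕ} {adj : Fin n → Fin n → Bool}
    {x : ι × Bool} (hF : ∀ h, (F n adj h).rel (.inr x) = h.rel (.inr x)) {l : List ι}
    (hx : x.1 ∉ l) (h : VState (RelName ι) AlgFlag n) :
    (forTuples l F n adj h).rel (.inr x) = h.rel (.inr x) := by
  induction l generalizing h with
  | nil => exact hF h
  | cons i l ih =>
    rw [List.mem_cons, not_or] at hx
    exact forEachOption_rel h (ih hx.2) (fun e => hx.1 (by rw [Sum.inr.inj e]))
      (fun e => hx.1 (by rw [Sum.inr.inj e]))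

theorem Realizable.forTuples {F : VFun (RelName ι) AlgFlag} (hF : Realizable F)
    (hFr : ∀ n adj h x, (F n adj h).rel (.inr x) = h.rel (.inr x)) {l : List ι} (hl : l.Nodup) :
    Realizable (_root_.forTuples l F) := by
  induction l with
  | nil => exact hF
  | cons i l ih =>
    rw [List.nodup_cons] at hl
    exact Realizable.forEachOption _ _ _ (by simp) (ih hl.2)
      fun n adj h => forTuples_rel (fun h => hFr n adj h _) hl.1 h

omit [DecidableEq ι] in
theorem VState.Accumulates.congr {n : ℕ} {xs ys : List ι} {A B : Prop}
    {h s : VState (RelName ι) AlgFlag n} (h₁ : Accumulates xs A h s) (hxy : xs ⊆ ys)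
    (hAB : A ↔ B) : Accumulates ys B h s :=
  ⟨h₁.1, h₁.2.1, fun i hi => h₁.2.2.1 i fun hx => hi (hxy hx), h₁.2.2.2.1, by
    rw [h₁.2.2.2.2, hAB]⟩

omit [DecidableEq ι] in
theorem VState.Accumulates.trans {n : ℕ} {xs : List ι} {A B : Prop}
    {h s u : VState (RelName ι) AlgFlag n} (h₁ : Accumulates xs A h s) (h₂ : Accumulates xs B s u) :
    Accumulates xs (A ∨ B) h u :=
  ⟨h₂.1, h₂.2.1.trans h₁.2.1, fun i hi b => (h₂.2.2.1 i hi b).trans (h₁.2.2.1 i hi b),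
    h₂.2.2.2.1.trans h₁.2.2.2.1, by rw [h₂.2.2.2.2, h₁.2.2.2.2, or_assoc]⟩

/-- Induction on the list: the outer loop fixes the first pointer, and the inner ones run through
the others. Since `found` is never cleared and the initial digits are kept, the results of the runs
accumulate to a disjunction. -/
theorem forTuples_spec {F : VFun (RelName ι) AlgFlag} {n : ℕ} {adj : Fin n → Fin n → Bool}
    {d : List Bool} {A : (ι → Option (Fin n)) → Prop}
    (hF : ∀ z h, h.Idle → h.dig.map Prod.fst = d → h.Points (fun _ => True) z →
      VState.Accumulates [] (A z) h (F n adj h)) {l : List ι} (hl : l.Nodup)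
    (z : ι → Option (Fin n)) {h : VState (RelName ι) AlgFlag n} (hh : h.Idle)
    (hd : h.dig.map Prod.fst = d) (hz : h.Points (· ∉ l) z) :
    VState.Accumulates l (∃ z', (∀ i, i ∉ l → z' i = z i) ∧ A z') h (forTuples l F n adj h) := by
  induction l generalizing h z with
  | nil =>
    refine (hF z h hh hd fun i _ => hz i (by simp)).congr (fun _ h => h) ?_
    constructor
    · exact fun hA => ⟨z, fun _ _ => rfl, hA⟩
    · rintro ⟨z', hz', hA⟩
      obtain rfl : z' = z := funext fun i => hz' i (by simp)
      exact hA
  | cons i l ih =>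
    rw [List.nodup_cons] at hl
    have step : ∀ (s : VState (RelName ι) AlgFlag n) (v : Option (Fin n)) (p q : Fin n → Bool),
        s.Idle → s.dig.map Prod.fst = d → s.Points (· ∉ i :: l) z →
        (p = fun j => decide (v = some j)) → (q = fun j => decide (∀ k, v = some k → k < j)) →
        VState.Accumulates (i :: l)
          (∃ z', z' i = v ∧ (∀ j, j ∉ i :: l → z' j = z j) ∧ A z') s
          (forTuples l F n adj ((s.setRel (.inr (i, false)) p).setRel (.inr (i, true)) q)) := by
      intro s v p q hs hds hzs hp hq
      have := ih hl.2 (Function.update z i v)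
        (h := (s.setRel (.inr (i, false)) p).setRel (.inr (i, true)) q) hs hds (by
        intro j hj
        by_cases hji : j = i
        · subst hji
          simp [hp, hq]
        · simpa [hji] using hzs j (by simp [hj, hji]))
      have := this.congr (List.subset_cons_self i l) (B := ∃ z', z' i = v ∧
        (∀ j, j ∉ i :: l → z' j = z j) ∧ A z') (by
        refine exists_congr fun z' => ?_
        rw [← and_assoc]
        refine and_congr_left fun _ => ?_
        constructor
        · intro hz'
          refine ⟨by simpa using hz' i hl.1, fun j hj => ?_⟩
          rw [List.mem_cons, not_or] at hj
          simpa [hj.1] using hz' j hj.2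
        · rintro ⟨rfl, hz'⟩ j hj
          by_cases hji : j = i
          · subst hji; simp
          · simpa [hji] using hz' j (by simp [hj, hji]))
      refine ⟨this.1, this.2.1, fun j hj b => ?_, this.2.2.2⟩
      rw [this.2.2.1 j hj b]
      rw [List.mem_cons, not_or] at hj
      simp [hj.1]
    -- The bound `v.val < n` is the loop invariant at the end: after `k` rounds, the empty value and
    -- the vertices below `k` have been tried for pointer `i`.
    have key : VState.Accumulates (i :: l) (∃ z', (z' i = none ∨ ∃ v : Fin n, z' i = some v ∧ v.val < n) ∧
        (∀ j, j ∉ i :: l → z' j = z j) ∧ A z') h (forTuples (i :: l) F n adj h) := by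
      refine forEach_induction (lp := AlgFlag.loop) (fun k s => VState.Accumulates (i :: l)
        (∃ z', (z' i = none ∨ ∃ v : Fin n, z' i = some v ∧ v.val < k) ∧
        (∀ j, j ∉ i :: l → z' j = z j) ∧ A z') h s) ?_ ?_
      · have := (step h none (fun _ => false) (fun _ => true) hh hd hz (by simp)
          (by simp)).congr (fun _ h => h) (B := ∃ z', (z' i = none ∨ ∃ v : Fin n, z' i = some v ∧
            v.val < 0) ∧ (∀ j, j ∉ i :: l → z' j = z j) ∧ A z') (by simp)
        rw [VState.setFl_eq_self _ _ _ this.1.1]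
        refine ⟨this.1, this.2.1, fun j hj b => ?_, this.2.2.2⟩
        rw [← this.2.2.1 j hj b]
        rw [List.mem_cons, not_or] at hj
        simp [hj.1]
      · intro v s hs
        have := step s (some v) (fun j => decide (j = v)) (fun j => decide (v < j)) hs.1 (hs.2.1.trans hd) (fun j hj => by
          rw [hs.2.2.1 j hj, hs.2.2.1 j hj]
          exact hz j hj)
          (by simp [eq_comm]) (by simp)
        rw [VState.setFl_eq_self _ _ _ this.1.1]
        refine (hs.trans this).congr (fun _ h => h) ?_
        rw [← exists_or]
        refine exists_congr fun z' => ?_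
        rw [← or_and_right]
        refine and_congr_left fun _ => ?_
        constructor
        · rintro ((h | ⟨w, hw, hlt⟩) | h)
          · exact Or.inl h
          · exact Or.inr ⟨w, hw, by omega⟩
          · exact Or.inr ⟨v, h, by omega⟩
        · rintro (h | ⟨w, hw, hlt⟩)
          · exact Or.inl (Or.inl h)
          · rcases Nat.lt_succ_iff_lt_or_eq.1 hlt with hlt | heq
            · exact Or.inl (Or.inr ⟨w, hw, hlt⟩)
            · exact Or.inr (by rw [hw, Fin.ext heq])
    refine key.congr (fun _ h => h) (exists_congr fun z' => and_iff_right ?_)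
    rcases z' i with _ | v
    · exact Or.inl rfl
    · exact Or.inr ⟨v, rfl, v.2⟩

end

/-- Test all candidates. -/
noncomputable def search (s : ℕ) (conn ne : Bool) : VFun (RelName (Pointer s)) AlgFlag :=
  forTuples Finset.univ.toList (attempt s conn ne)

theorem Realizable.search (s : ℕ) (conn ne : Bool) : Realizable (_root_.search s conn ne) :=
  Realizable.forTuples (Realizable.attempt conn ne) (fun _ _ h x => attempt_rel h x)
    (Finset.nodup_toList _)

theorem search_spec {s : ℕ} {conn ne : Bool} {n : ℕ} (G : SimpleGraph (Fin n))
    {h : VState (RelName (Pointer s)) AlgFlag n} (hh : h.Idle) :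
    ((search s conn ne n (adjBool G) h).fl .found = true ↔ h.fl .found = true ∨
      ∃ z, Succeeds (s := s) G z conn ne (digitsValue (h.dig.map Prod.fst))) ∧
    (search s conn ne n (adjBool G) h).fl .neg = h.fl .neg := by
  have := forTuples_spec (F := attempt s conn ne) (adj := adjBool G) (d := h.dig.map Prod.fst)
    (A := fun z => Succeeds G z conn ne (digitsValue (h.dig.map Prod.fst)))
    (fun z s hs hd hz => hd ▸ attempt_spec G hs hz) (Finset.nodup_toList Finset.univ)
    (fun _ => none) hh rfl (fun i hi => absurd (by simp) hi)
  refine ⟨?_, this.2.2.2.1⟩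
  rw [search, this.2.2.2.2]
  simp

/-! ### Optimal candidates -/

theorem exists_getElem?_eq_some_iff {α : Type*} {l : List α} {m : ℕ} (h : l.length ≤ m) {a : α} :
    (∃ i : Fin m, l[i.val]? = some a) ↔ a ∈ l := by
  rw [List.mem_iff_getElem?]
  constructor
  · rintro ⟨i, hi⟩
    exact ⟨i, hi⟩
  · rintro ⟨i, hi⟩
    obtain ⟨hlt, -⟩ := List.getElem?_eq_some_iff.1 hi
    exact ⟨⟨i, by omega⟩, hi⟩

open scoped Classical in
-- The independent part `J₀` of the forest is enlarged to a maximal independent set `J` in `W`. This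
-- moves the vertices of `T` from the solution to the forest; those in `T'` are moved back for the
-- sake of connectivity. As `S₀ = S₁ ∪ T` and `T' ⊆ T`, the result is no larger than `S₀`.
theorem exists_candidate {s n : ℕ} {G : SimpleGraph (Fin n)} (hs : ∀ U, ¬G.HasMatching s U)
    {conn ne : Bool} (hne : ne = true → conn = true) {S₀ : Finset (Fin n)}
    (h : IsSolution G conn ne S₀) :
    ∃ (z : Pointer s → Option (Fin n)) (S : Finset (Fin n)),
      IsCandidate G z S ∧ IsSolution G conn ne S ∧ S.card ≤ S₀.card := by
  obtain ⟨hF, hL, hN⟩ := h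
  obtain ⟨C, hCU, hC, hI, hleaf⟩ := hF.exists_core (hs _)
  let J₀ := (Finset.univ.filter fun i => i ∉ S₀) \ C
  let W := Finset.univ.filter fun w => w ∉ C ∧ G.LeafIn w C
  have hJ₀ : ∀ x, x ∈ J₀ ↔ x ∉ S₀ ∧ x ∉ C := fun x => by
    simp only [J₀, Finset.mem_sdiff, Finset.mem_filter, Finset.mem_univ, true_and]
  have hW : ∀ x, x ∈ W ↔ x ∉ C ∧ G.LeafIn x C := fun x => by simp [W]
  have hCS : ∀ x ∈ C, x ∉ S₀ := fun x hx => (Finset.mem_filter.1 (hCU hx)).2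
  have hJ₀W : J₀ ⊆ W := fun x hx => (hW x).2 ⟨((hJ₀ x).1 hx).2, hleaf x (by convert hx)⟩
  have hJ₀I : G.Indep J₀ := by convert hI
  obtain ⟨J, hJ, hmax⟩ := Finset.exists_max_image
    (W.powerset.filter fun J => J₀ ⊆ J ∧ G.Indep J) Finset.card
    ⟨J₀, Finset.mem_filter.2 ⟨Finset.mem_powerset.2 hJ₀W, subset_rfl, hJ₀I⟩⟩
  simp only [Finset.mem_filter, Finset.mem_powerset] at hJ hmax
  obtain ⟨hJW, hJ₀J, hJI⟩ := hJ
  obtain ⟨P, hP, -, hJP⟩ := G.exists_excluded (hs W) hJW hJI (by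
    intro w hw hwJ
    by_contra! hno
    have := hmax (insert w J) ⟨Finset.insert_subset hw hJW, hJ₀J.trans (Finset.subset_insert _ _), by
      intro a ha b hb hab
      rcases Finset.mem_insert.1 ha with ha | ha <;> rcases Finset.mem_insert.1 hb with hb | hb
      · exact G.irrefl (ha ▸ hb ▸ hab)
      · exact hno b hb (ha ▸ hab)
      · exact hno a ha (hb ▸ hab.symm)
      · exact hJI a ha b hb hab⟩
    rw [Finset.card_insert_of_notMem hwJ] at this
    omega)
  let S₁ := Finset.univ.filter fun w => w ∉ C ∧ w ∉ J
  let T := J \ J₀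
  have hS₁ : ∀ x, x ∈ S₁ ↔ x ∉ C ∧ x ∉ J := fun x => by simp [S₁]
  have hT : ∀ x, x ∈ T ↔ x ∈ J ∧ x ∉ J₀ := fun x => by simp only [T, Finset.mem_sdiff]
  have hST : S₁ ∪ T = S₀ := by
    ext x
    rw [Finset.mem_union, hS₁, hT]
    constructor
    · rintro (⟨h₁, h₂⟩ | ⟨h₁, h₂⟩)
      · by_contra hx
        exact h₂ (hJ₀J ((hJ₀ x).2 ⟨hx, h₁⟩))
      · by_contra hx
        exact h₂ ((hJ₀ x).2 ⟨hx, ((hW x).1 (hJW h₁)).1⟩)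
    · intro hx
      have hxC : x ∉ C := fun h => hCS x h hx
      have hxJ₀ : x ∉ J₀ := fun h => ((hJ₀ x).1 h).1 hx
      by_cases hxJ : x ∈ J
      · exact Or.inr ⟨hxJ, hxJ₀⟩
      · exact Or.inl ⟨hxC, hxJ⟩
  obtain ⟨T', hT'T, hT'c, hlink, hnon⟩ : ∃ T' ⊆ T, T'.card ≤ 2 * s + 1 ∧
      (conn = true → G.Linked (S₁ ∪ T')) ∧ (ne = true → (S₁ ∪ T').Nonempty) := by
    cases conn with
    -- Without connectivity nothing is put back. The result may then be empty, so nonemptiness is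
    -- demanded only together with connectivity.
    | false => exact ⟨∅, by simp, by simp, by simp, fun h => absurd (hne h) (by simp)⟩
    | true =>
      have hl : G.Linked (S₁ ∪ T) := hST.symm ▸ hL rfl
      obtain ⟨T', h₁, h₂, h₃, h₄⟩ := G.exists_linked (S := S₁) (T := T) (by convert hl)
        (hJI.mono Finset.sdiff_subset) (hs _)
      have hn : ne = true → (S₁ ∪ T).Nonempty := fun h => hST.symm ▸ hN h
      exact ⟨T', h₁, h₂, fun _ => by convert h₃, fun h => by convert h₄ (by convert hn h)⟩
  -- Positions beyond the end of a list yield `none`, so superfluous pointers are empty.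
  let z : Pointer s → Option (Fin n)
    | .inl i => C.toList[i.val]?
    | .inr (.inl (m, b)) => P[m.val]?.map fun e => bif b then e.2 else e.1
    | .inr (.inr i) => T'.toList[i.val]?
  have hzC : candidateCore z = C := by
    ext x
    rw [mem_candidateCore]
    simp only [z]
    rw [exists_getElem?_eq_some_iff (by simpa using hC), Finset.mem_toList]
  have hzT : ∀ x, (∃ i, z (.inr (.inr i)) = some x) ↔ x ∈ T' := fun x => by
    simp only [z]
    rw [exists_getElem?_eq_some_iff (by simpa using hT'c), Finset.mem_toList]
  have hzP : ∀ w, CandidateExcluded G z w ↔ G.Excluded P w := by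
    intro w
    constructor
    · rintro ⟨m, v, hv, hwv, hadj⟩
      simp only [z, Option.map_eq_some_iff] at hv hadj
      obtain ⟨e, he, hev⟩ := hv
      simp only [cond_true] at hev
      refine ⟨e, List.mem_of_getElem? he, hev ▸ hwv, ?_⟩
      rcases hadj with hadj | ⟨u, ⟨e', he', heu⟩, hwu⟩
      · exact Or.inr (Or.inr (hev ▸ hadj))
      · obtain rfl : e = e' := Option.some_inj.1 (he.symm.trans he')
        simp only [cond_false] at heu
        rcases hwu with hwu | hwu
        · exact Or.inl (heu ▸ hwu)
        · exact Or.inr (Or.inl (heu ▸ hwu))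
    · rintro ⟨e, he, hwe, h⟩
      obtain ⟨m, hm⟩ := (exists_getElem?_eq_some_iff hP).2 he
      refine ⟨m, e.2, by simp [z, hm], hwe, ?_⟩
      rcases h with h | h | h
      · exact Or.inr ⟨e.1, by simp [z, hm], Or.inl h⟩
      · exact Or.inr ⟨e.1, by simp [z, hm], Or.inr h⟩
      · exact Or.inl h
  refine ⟨z, S₁ ∪ T', ⟨J, fun w => ?_, fun w => ?_⟩, ⟨?_, hlink, hnon⟩, ?_⟩
  · rw [hJP w, hzC, hzP, hW, and_assoc]
  · rw [Finset.mem_union, hS₁, hzC, hzT]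
  · have := (hF.mono hCU).union hJI fun w hw => ((hW w).1 (hJW hw)).2
    refine this.mono fun x hx => ?_
    simp only [Finset.mem_filter, Finset.mem_univ, true_and, Finset.mem_union, not_or, hS₁] at hx ⊢
    tauto
  · exact Finset.card_le_card (hST ▸ Finset.union_subset_union_right hT'T)

theorem exists_succeeds_iff {s n : ℕ} {G : SimpleGraph (Fin n)} (hG : IsSP2Free s G)
    {conn ne : Bool} (hne : ne = true → conn = true) {K : ℕ} :
    (∃ z : Pointer s → Option (Fin n), Succeeds G z conn ne K) ↔
      ∃ S, IsSolution G conn ne S ∧ S.card ≤ K := by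
  constructor
  · rintro ⟨z, S, -, hS, hK⟩
    exact ⟨S, hS, hK⟩
  · rintro ⟨S₀, hS₀, hK⟩
    obtain ⟨z, S, hz, hS, hc⟩ :=
      exists_candidate (fun U => SimpleGraph.not_hasMatching_of_isSP2Free hG U) hne hS₀
    exact ⟨z, S, hz, hS, hc.trans hK⟩

/-! ### The three problems in terms of leaves and cuts -/

theorem isFeedbackVertexSet_iff {n : ℕ} {G : SimpleGraph (Fin n)} {S : Finset (Fin n)} :
    IsFeedbackVertexSet G S ↔ G.Forest (Finset.univ.filter fun i => i ∉ S) := by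
  rw [← SimpleGraph.isAcyclic_induce_iff_forest, IsFeedbackVertexSet]
  have : ((S : Set (Fin n))ᶜ) = ((Finset.univ.filter fun i => i ∉ S : Finset (Fin n)) : Set (Fin n)) := by
    ext x
    simp
  rw [this]

theorem hasFVS_iff {n : ℕ} {G : SimpleGraph (Fin n)} {k : ℤ} :
    HasFVS G k ↔ ∃ S, IsSolution G false false S ∧ (S.card : ℤ) ≤ k := by
  refine exists_congr fun S => ?_
  rw [isFeedbackVertexSet_iff]
  simp [IsSolution]

theorem hasConnectedFVS_iff {n : ℕ} {G : SimpleGraph (Fin n)} {k : ℤ} :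
    HasConnectedFVS G k ↔ ∃ S, IsSolution G true false S ∧ (S.card : ℤ) ≤ k := by
  refine exists_congr fun S => ?_
  rw [isFeedbackVertexSet_iff, SimpleGraph.preconnected_induce_iff_linked]
  simp [IsSolution, and_assoc]

theorem hasNonemptyConnectedFVS_iff {n : ℕ} {G : SimpleGraph (Fin n)} {k : ℤ} :
    HasNonemptyConnectedFVS G k ↔ ∃ S, IsSolution G true true S ∧ (S.card : ℤ) ≤ k := by
  refine exists_congr fun S => ?_
  rw [isFeedbackVertexSet_iff, SimpleGraph.connected_iff,
    SimpleGraph.preconnected_induce_iff_linked]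
  simp [IsSolution, and_assoc, Finset.Nonempty]

/-! ### The Turing machine -/

section

variable (s : ℕ)

/-- The transducer that prepares the cells: its state is empty before the sign is read, holds the
sign while the digits are read, and holds the sign and the information whether a row begins while
the matrix is read. -/
def parseStep : Option (Bool × Option Bool) → Option Bool →
    Option (Bool × Option Bool) × Option (TapeCell (RelName (Pointer s)))
  | none, a => (a.map fun b => (b, none), none)
  | some (g, none), some d => (some (g, none), some (.inl (d, d)))
  | some (g, none), none => (some (g, some true), none)
  | some (g, some f), some a =>
    (some (g, some false), some (.inr (a, f, fun _ => false, fun _ => false)))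
  | some (g, some _), none => (some (g, some true), none)

/-- The flags at the start. -/
def initialFlags (g : Bool) : AlgFlag → Bool
  | .neg => g
  | _ => false

/-- The state at the start. -/
def initialState (x : GraphInstance) : VState (RelName (Pointer s)) AlgFlag x.n where
  fl := initialFlags (decide (x.k < 0))
  rel _ _ := false
  dig := (Computability.encodeNat x.k.natAbs).map fun d => (d, d)

theorem transduce_parseStep (x : GraphInstance) :
    (transduce (parseStep s) none x.encode).1 = some (decide (x.k < 0), some true) ∧
    (transduce (parseStep s) none x.encode).2.reduceOption =
      (initialState s x).tape (adjBool x.graph) := by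
  set g := decide (x.k < 0) with hg
  have h₁ : ∀ l : List Bool, transduce (parseStep s) (some (g, none)) (l.map some) =
      (some (g, none), l.map fun d => some (.inl (d, d))) := by
    intro l
    induction l with
    | nil => rfl
    | cons d l ih => simp [transduce, parseStep, ih]
  have h₂ : ∀ i, transduce (parseStep s) (some (g, some true)) (x.row i ++ [none]) =
      (some (g, some true), ((List.finRange x.n).map fun j =>
        some (.inr (adjBool x.graph i j, decide (j.val = 0), fun _ => false, fun _ => false))) ++
          [none]) := by
    intro i
    have hrow : x.row i = (List.finRange x.n).map fun j => some (adjBool x.graph i j) :=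
      List.ofFn_eq_map
    obtain ⟨h₃, h₄⟩ := transduce_map_finRange (parseStep s) x.n
      (fun j => some (adjBool x.graph i j))
      (fun j => some (.inr (adjBool x.graph i j, decide (j.val = 0), fun _ => false,
        fun _ => false)))
      (fun k p => p = some (g, some (decide (k = 0)))) (some (g, some true)) (by simp) (by
        rintro j p rfl
        simp [parseStep])
    rw [← hrow] at h₃ h₄
    rw [transduce_append, h₃, h₄]
    simp [transduce, parseStep]
  obtain ⟨h₃, h₄⟩ := transduce_flatMap_finRange (parseStep s) x.n (fun i => x.row i ++ [none])
    (fun i => ((List.finRange x.n).map fun j =>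
        some (.inr (adjBool x.graph i j, decide (j.val = 0), fun _ => false, fun _ => false))) ++
          [none])
    (fun _ p => p = some (g, some true)) (some (g, some true)) rfl (by
      rintro i p rfl
      exact ⟨congrArg Prod.fst (h₂ i), congrArg Prod.snd (h₂ i)⟩)
  have e : transduce (parseStep s) none x.encode = (some (g, some true),
      none :: ((Computability.encodeNat x.k.natAbs).map fun d => some (.inl (d, d))) ++
        none :: (List.finRange x.n).flatMap fun i => ((List.finRange x.n).map fun j =>
          some (.inr (adjBool x.graph i j, decide (j.val = 0), fun _ => false, fun _ => false))) ++
            [none]) := by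
    rw [GraphInstance.encode, List.cons_append, transduce, ← hg]
    simp only [parseStep, Option.map_some, transduce_append, h₁, transduce, h₃, h₄]
    rfl
  rw [e]
  refine ⟨rfl, ?_⟩
  simp only [List.cons_append, List.reduceOption_cons_of_none, List.reduceOption_append]
  rw [VState.tape, VState.cells]
  congr 1
  · simp [initialState, List.reduceOption, Function.comp_def]
  · simp [List.reduceOption, List.filterMap_flatMap, List.filterMap_append, initialState]

theorem digitsValue_encodeNat (k : ℕ) : digitsValue (Computability.encodeNat k) = k := by
  have h : ∀ m : PosNum, digitsValue (Computability.encodePosNum m) = (m : ℕ) := by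
    intro m
    induction m with
    | one => rfl
    | bit0 m ih => simp [Computability.encodePosNum, digitsValue, ih]; omega
    | bit1 m ih => simp [Computability.encodePosNum, digitsValue, ih]; omega
  have h' : ∀ m : Num, digitsValue (Computability.encodeNum m) = (m : ℕ) := by
    rintro (_ | m)
    · rfl
    · exact h m
  rw [Computability.encodeNat, h', Num.to_of_nat]

theorem Polynomial.eval_monotone (T : Polynomial ℕ) : Monotone fun n => T.eval n := by
  intro a b h
  simp only [Polynomial.eval_eq_sum_range]
  gcongr

theorem GraphInstance.length_row (x : GraphInstance) (i : Fin x.n) : (x.row i).length = x.n := by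
  simp [row]

/-- Every digit and every entry of the matrix has a symbol of its own in the input, so bounds in the
length of the tape become bounds in the length of the input. -/
theorem length_tape_le (x : GraphInstance) :
    ((initialState s x).tape (adjBool x.graph)).length ≤ x.encode.length := by
  rw [VState.length_tape]
  simp [initialState, GraphInstance.encode, List.length_flatMap, GraphInstance.length_row]
  nlinarith

set_option synthInstance.maxSize 1000 in
instance : Fintype (TapeCell (RelName (Pointer s))) := inferInstance

instance : Inhabited (TapeCell (RelName (Pointer s))) := ⟨.inl (false, false)⟩

theorem solvable_of_isSolution {P : ∀ {n : ℕ}, SimpleGraph (Fin n) → ℤ → Prop} (conn ne : Bool)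
    (hne : ne = true → conn = true)
    (hP : ∀ {n : ℕ} (G : SimpleGraph (Fin n)) (k : ℤ),
      P G k ↔ ∃ S, IsSolution G conn ne S ∧ (S.card : ℤ) ≤ k) :
    SolvableInPolyTimeOn (IsSP2Free s) P := by
  obtain ⟨p, T, hp⟩ := Realizable.search s conn ne
  let d : SweepDecider (AlgFlag → Bool) (TapeCell (RelName (Pointer s))) :=
    { P := Option (Bool × Option Bool)
      start := none
      parse := parseStep s
      init := fun q => initialFlags (q.elim false Prod.fst)
      prog := p
      -- The counter holds the absolute value of `k`, so negative parameters are rejected by their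
      -- sign.
      answer := fun q => q .found && !q .neg }
  refine d.nonempty_computable _ _ (T + Polynomial.X) fun x => ?_
  obtain ⟨x, hx⟩ := x
  let h := initialState s x
  have hh : h.Idle := ⟨rfl, rfl⟩
  obtain ⟨hdig, t, ht, hexec⟩ := hp x.n (adjBool x.graph) h
  obtain ⟨hfound, hneg⟩ := search_spec (s := s) (conn := conn) (ne := ne) x.graph hh
  let u := search s conn ne x.n (adjBool x.graph) h
  have hsol : ∀ K, (∃ z, Succeeds (s := s) x.graph z conn ne K) ↔ _ := fun K =>
    exists_succeeds_iff hx hne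
  have hval : digitsValue (h.dig.map Prod.fst) = x.k.natAbs := by
    simp [h, initialState, Function.comp_def, digitsValue_encodeNat]
  refine ⟨(u.fl, u.tape (adjBool x.graph)), t, ?_, ?_, ?_⟩
  · have hpar : d.parsed x.encode = (h.fl, h.tape (adjBool x.graph)) := by
      obtain ⟨h₁, h₂⟩ := transduce_parseStep s x
      refine Prod.ext ?_ h₂
      change initialFlags ((transduce (parseStep s) none x.encode).1.elim false Prod.fst) = _
      rw [h₁]
      rfl
    rw [hpar]
    exact hexec
  · classical
    change (u.fl .found && !u.fl .neg) = decide (P x.graph x.k)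
    have hneg' : u.fl .neg = decide (x.k < 0) := hneg
    have hfound' : u.fl .found = true ↔
        ∃ S, IsSolution x.graph conn ne S ∧ S.card ≤ x.k.natAbs := by
      rw [hfound, hval, hsol]
      exact or_iff_right (by simp [h, initialState, initialFlags])
    rw [Bool.eq_iff_iff, decide_eq_true_eq, Bool.and_eq_true, hfound', hneg', hP]
    simp only [Bool.not_eq_true', decide_eq_false_iff_not, not_lt]
    constructor
    · rintro ⟨⟨S, hS, hc⟩, hk⟩
      exact ⟨S, hS, by omega⟩
    · rintro ⟨S, hS, hc⟩
      exact ⟨⟨S, hS, by omega⟩, by omega⟩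
  · have hlen : (u.tape (adjBool x.graph)).length = (h.tape (adjBool x.graph)).length := by
      rw [VState.length_tape, VState.length_tape, hdig]
    have hle := length_tape_le s x
    have := Polynomial.eval_monotone T hle
    simp only [Polynomial.eval_add, Polynomial.eval_X]
    change t + (u.tape (adjBool x.graph)).length ≤ _
    rw [hlen]
    exact Nat.add_le_add (ht.trans this) hle

end

theorem theorem3p5 (s : ℕ) (hs : 1 ≤ s) :
    SolvableInPolyTimeOn (IsSP2Free s) HasFVS ∧
    SolvableInPolyTimeOn (IsSP2Free s) HasConnectedFVS ∧
    SolvableInPolyTimeOn (IsSP2Free s) HasNonemptyConnectedFVS :=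
  ⟨solvable_of_isSolution s false false (by simp) fun _ _ => hasFVS_iff,
    solvable_of_isSolution s true false (by simp) fun _ _ => hasConnectedFVS_iff,
    solvable_of_isSolution s true true (by simp) fun _ _ => hasNonemptyConnectedFVS_iff⟩
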